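/- All manifolds and maps are smooth. Let $M$ be a closed oriented $3$-manifold, let $\pi: N\to M$ be an oriented $\mathbb{S}^1$-bundle (a locally trivial bundle with fibre $\mathbb{S}^1$ whose transition maps preserve the orientation of the fibre), and let $g: N\to TM$ be a convex bundle immersion. That is, $g$ is a smooth map covering $\mathrm{id}_M$ such that for each $p\in M$ the restriction $g_p: N_p\to T_pM$ to the fibre is an immersion, and the curve of oriented lines $[g_p']$ in the sphere $\mathbb{S}(T_pM)$ of oriented lines is convex: if $T_pM$ is identified with $\mathbb{R}^3$ by an orientation-preserving linear isomorphism and $N_p$ is parametrised by $t \in \mathbb{S}^1$ compatibly with its orientation, then the curve $\gamma=g_p'/|g_p'|$ in $\mathbb{S}^2$ satisfies $\det(\gamma(t),\gamma'(t),\gamma''(t))>0$ for all $t$. Let $(X,J)$ be an almost complex manifold of real dimension $6$ and let $\iota: M\to X$ be a totally real immersion, i.e. an immersion with $\iota_*T_pM\cap J(\iota_*T_pM)=0$ for all $p \in M$. Then there exists a co-real immersion $\tilde g: N\to X$, i.e. an immersion whose complex tangencies $$\mathcal{D}^{\tilde g}_J := \tilde g_*^{-1}\big(\tilde g_*TN\cap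 J(\tilde g_*TN)\big)$$ have rank $2$ everywhere, such that $\mathcal{D}=\mathcal{D}^{\tilde g}_J$ is an Engel distribution on $N$: $\mathcal{D}$ is a smooth rank-$2$ subbundle of $TN$, $[\mathcal{D},\mathcal{D}]$ is a smooth subbundle, and $\mathcal{D}\subsetneq[\mathcal{D},\mathcal{D}]\subsetneq[\mathcal{D},[\mathcal{D},\mathcal{D}]]=TN$ at every point. Moreover, if $g$ and $\iota$ are embeddings, then $\tilde g$ can be chosen to be an embedding. -/

import Mathlib

open Set Filter Topology Bundle
open scoped Manifold ContDiff

noncomputable section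

namespace CREngel

section Manifolds

variable {E : Type*} [NormedAddCommGroup E] [NormedSpace ℝ E]
  {H : Type*} [TopologicalSpace H] (I : ModelWithCorners ℝ E H)
  {M : Type*} [TopologicalSpace M] [ChartedSpace H M]
  {E' : Type*} [NormedAddCommGroup E'] [NormedSpace ℝ E']
  {H' : Type*} [TopologicalSpace H'] (I' : ModelWithCorners ℝ E' H')
  {X : Type*} [TopologicalSpace X] [ChartedSpace H' X]

/-! ### Immersions, embeddings, orientations -/

/-- A smooth immersion: a smooth map with injective differential at every point. -/
structure IsImmersion (f : M → X) : Prop where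
  contMDiff : ContMDiff I I' ∞ f
  injective_mfderiv : ∀ x, Function.Injective (mfderiv I I' f x)

/-- A smooth embedding: an immersion that is a homeomorphism onto its image. -/
structure IsEmbedding (f : M → X) : Prop where
  isImmersion : IsImmersion I I' f
  isEmbedding : Topology.IsEmbedding f

variable (M) in
/-- An orientation of a manifold of dimension `n`: an orientation of each tangent space, locally
constant in the local trivialisations of the tangent bundle. -/
structure ManifoldOrientation (n : ℕ) [IsManifold I 1 M] where
  /-- the orientation of each tangent space -/
  orientation : ∀ x : M, Orientation ℝ (TangentSpace I x) (Fin n)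
  locally_constant : ∀ x₀ : M, ∃ o : Orientation ℝ E (Fin n), ∀ᶠ x in 𝓝 x₀,
    ∀ hx : x ∈ (trivializationAt E (TangentSpace I : M → Type _) x₀).baseSet,
      Orientation.map (Fin n)
        ((trivializationAt E (TangentSpace I : M → Type _) x₀).continuousLinearEquivAt
          ℝ x hx).toLinearEquiv (orientation x) = o

/-! ### Distributions and the Engel condition -/

/-- `Γ(D)`: the smooth vector fields on `M` tangent to `D`. -/
def sections (D : ∀ x : M, Submodule ℝ (TangentSpace I x)) [IsManifold I 1 M] :
    Set (∀ x : M, TangentSpace I x) :=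
  {u | ContMDiff I I.tangent ∞ (fun x => (⟨x, u x⟩ : TangentBundle I M)) ∧ ∀ x, u x ∈ D x}

/-- A distribution of rank `k`, i.e. a smooth subbundle of rank `k` of the tangent bundle: every
`D x` has dimension `k`, and `D` is locally spanned by `k` smooth vector fields. -/
structure IsDistribution (k : ℕ) (D : ∀ x : M, Submodule ℝ (TangentSpace I x))
    [IsManifold I 1 M] : Prop where
  finrank_eq : ∀ x, Module.finrank ℝ (D x) = k
  local_frame : ∀ x₀ : M, ∃ U ∈ 𝓝 x₀, ∃ u : Fin k → ∀ x : M, TangentSpace I x,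
    (∀ i, ContMDiffOn I I.tangent ∞ (fun x => (⟨x, u i x⟩ : TangentBundle I M)) U) ∧
    ∀ x ∈ U, Submodule.span ℝ (range fun i => u i x) = D x

/-- The Lie bracket `[D₁, D₂]`: at each point, the span of the values of the brackets of
sections of `D₁` with sections of `D₂`. -/
def bracket (D₁ D₂ : ∀ x : M, Submodule ℝ (TangentSpace I x)) [IsManifold I 1 M] (x : M) :
    Submodule ℝ (TangentSpace I x) :=
  Submodule.span ℝ {w | ∃ u ∈ sections I D₁, ∃ v ∈ sections I D₂,
    w = VectorField.mlieBracket I u v x}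

/-- `D` is an Engel distribution (for `M` of dimension four): `D` is a rank-2 distribution,
`[D, D]` is a distribution, and `D ⊊ [D, D] ⊊ [D, [D, D]] = TM`. -/
structure IsEngel (D : ∀ x : M, Submodule ℝ (TangentSpace I x)) [IsManifold I 1 M] : Prop where
  isDistribution : IsDistribution I 2 D
  isDistribution_bracket : ∃ k, IsDistribution I k (bracket I D D)
  lt_bracket : ∀ x, D x < bracket I D D x
  bracket_lt : ∀ x, bracket I D D x < bracket I D (bracket I D D) x
  bracket_bracket : ∀ x, bracket I D (bracket I D D) x = ⊤

/-! ### Almost complex manifolds, totally real and co-real maps -/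

variable (X) in
/-- An almost complex structure on `X`: a smooth bundle endomorphism `J` of `TX` with
`J² = -1`. -/
structure AlmostComplexStructure [IsManifold I' 1 X] where
  /-- the endomorphism of each tangent space -/
  J : ∀ x : X, TangentSpace I' x →ₗ[ℝ] TangentSpace I' x
  J_J : ∀ (x : X) (v : TangentSpace I' x), J x (J x v) = -v
  smooth : ContMDiff I'.tangent I'.tangent ∞
    (fun v : TangentBundle I' X => (⟨v.proj, J v.proj v.2⟩ : TangentBundle I' X))

variable {I'} in
/-- The maximal complex subspace `W ∩ J W` of the image `W = f_* T_xM` of the differential. -/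
def imageTangency [IsManifold I' 1 X] (J : AlmostComplexStructure I' X) (f : M → X) (x : M) :
    Submodule ℝ (TangentSpace I' (f x)) :=
  LinearMap.range (mfderiv I I' f x).toLinearMap ⊓
    (LinearMap.range (mfderiv I I' f x).toLinearMap).map (J.J (f x))

variable {I'} in
/-- The complex tangencies `f_*⁻¹ (f_* TM ∩ J (f_* TM))` of a map `f : M → X`. -/
def complexTangencies [IsManifold I' 1 X] (J : AlmostComplexStructure I' X) (f : M → X) (x : M) :
    Submodule ℝ (TangentSpace I x) :=
  (imageTangency I J f x).comap (mfderiv I I' f x).toLinearMap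

variable {I'} in
/-- A totally real immersion: the image of each tangent space contains no complex line, i.e.
`f_* T_xM ∩ J (f_* T_xM) = 0`. -/
structure IsTotallyRealImmersion [IsManifold I' 1 X] (J : AlmostComplexStructure I' X)
    (f : M → X) : Prop where
  isImmersion : IsImmersion I I' f
  totallyReal : ∀ x, imageTangency I J f x = ⊥

variable {I'} in
/-- A co-real immersion of a 4-manifold into an almost complex manifold of real dimension 6:
an immersion whose complex tangencies have rank 2 everywhere. -/
structure IsCoRealImmersion [IsManifold I' 1 X] (J : AlmostComplexStructure I' X)
    (f : M → X) : Prop where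
  isImmersion : IsImmersion I I' f
  finrank_eq : ∀ x, Module.finrank ℝ (complexTangencies I J f x) = 2

end Manifolds

/-! ### Oriented circle bundles over 3-manifolds -/

/-- A smooth map `f` from the circle to itself has everywhere positive angular derivative:
`d/ds f(e^{is}) = a i f(e^{is})` with `a > 0`. -/
def IsOrientationPreserving (f : Circle → Circle) : Prop :=
  ∀ s : ℝ, ∃ a : ℝ, 0 < a ∧
    HasDerivAt (fun r : ℝ => (f (Circle.exp r) : ℂ))
      ((a : ℂ) * Complex.I * (f (Circle.exp s) : ℂ)) s

section CircleBundles

variable {M : Type*} [TopologicalSpace M] [ChartedSpace (EuclideanSpace ℝ (Fin 3)) M]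
  {N : Type*} [TopologicalSpace N] [ChartedSpace (EuclideanSpace ℝ (Fin 4)) N]

/-- The structure of an oriented smooth circle bundle on `pr : N → M`: a covering of `M` by smooth
local trivialisations whose transition maps preserve the orientation of the circle. -/
structure OrientedCircleBundle (pr : N → M) where
  /-- the local trivialisations -/
  atlas : Set (Trivialization Circle pr)
  covers : ∀ p : M, ∃ e ∈ atlas, p ∈ e.baseSet
  smooth : ∀ e ∈ atlas, ContMDiffOn (𝓡 4) ((𝓡 3).prod (𝓡 1)) ∞ e e.source
  smooth_symm : ∀ e ∈ atlas,
    ContMDiffOn ((𝓡 3).prod (𝓡 1)) (𝓡 4) ∞ e.toOpenPartialHomeomorph.symm e.target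
  oriented : ∀ e ∈ atlas, ∀ e' ∈ atlas, ∀ p ∈ e.baseSet ∩ e'.baseSet,
    IsOrientationPreserving fun z => (e' (e.toOpenPartialHomeomorph.symm (p, z))).2

/-- The restriction `g_p` of a fibred map `g : N → TM` to the fibre over `p`, parametrised by
the angle `t` through the local trivialisation `e` (with `p` in its base set). As `g` is fibred,
the vector on the right is based at `p`. -/
def fibreCurve {pr : N → M} (g : N → TangentBundle (𝓡 3) M) (e : Trivialization Circle pr) (p : M)
    (t : ℝ) : TangentSpace (𝓡 3) p :=
  (g (e.toOpenPartialHomeomorph.symm (p, Circle.exp t))).2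

/-- A bundle immersion `g : N → TM`: a smooth map covering the identity of `M` whose restriction
`N_p → T_pM` to every fibre is an immersion. -/
structure IsBundleImmersion [IsManifold (𝓡 3) 1 M] {pr : N → M} (B : OrientedCircleBundle pr)
    (g : N → TangentBundle (𝓡 3) M) : Prop where
  contMDiff : ContMDiff (𝓡 4) (𝓡 3).tangent ∞ g
  proj_eq : ∀ q, (g q).proj = pr q
  fibre_immersed : ∀ e ∈ B.atlas, ∀ p ∈ e.baseSet, ∀ t, deriv (fibreCurve g e p) t ≠ 0

/-! ### Convexity -/

/-- Convexity of a curve `γ` in the unit sphere of `ℝ³`: `det (γ, γ', γ'') > 0` everywhere. -/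
def IsConvexCurve (γ : ℝ → EuclideanSpace ℝ (Fin 3)) : Prop :=
  ∀ t, 0 < (EuclideanSpace.basisFun (Fin 3) ℝ).toBasis.det ![γ t, deriv γ t, deriv (deriv γ) t]

/-- Convexity of the curve of oriented lines `[v t]` in an oriented 3-dimensional space `V`, for a
curve `v` of nonzero vectors: after identifying `V` with `ℝ³` by an orientation preserving linear
isomorphism, the normalised curve in the unit sphere is convex. (This does not depend on the
isomorphism.) -/
def IsConvexLineCurve {V : Type*} [AddCommGroup V] [Module ℝ V] (o : Orientation ℝ V (Fin 3))
    (v : ℝ → V) : Prop :=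
  ∀ A : V ≃ₗ[ℝ] EuclideanSpace ℝ (Fin 3),
    Orientation.map (Fin 3) A o = (EuclideanSpace.basisFun (Fin 3) ℝ).toBasis.orientation →
      IsConvexCurve fun t => ‖A (v t)‖⁻¹ • A (v t)

/-- A convex bundle immersion `g : N → TM`: a bundle immersion such that, for every `p`, the curve
of oriented lines `t ↦ [(g_p)'(t)]` spanned by the fibrewise derivative is convex in `T_pM`. -/
structure IsConvexBundleImmersion [IsManifold (𝓡 3) 1 M] (o : ManifoldOrientation (𝓡 3) M 3)
    {pr : N → M} (B : OrientedCircleBundle pr) (g : N → TangentBundle (𝓡 3) M) : Prop where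
  isBundleImmersion : IsBundleImmersion B g
  convex : ∀ e ∈ B.atlas, ∀ p ∈ e.baseSet,
    IsConvexLineCurve (o.orientation p) (deriv (fibreCurve g e p))

end CircleBundles

end CREngel

end

/-! Thicken `ι` to a smooth map `Ψ : TM → X` with `Ψ(p, 0) = ι(p)` whose fibre derivative along the
zero section is `c(p) • J ∘ ι_*` with `c(p) ≠ 0` (`exists_isTube`). The required map is `q ↦ Ψ(ε
g(q))` for a small `ε ≠ 0` (`tubeMap`).

In coordinates `(y, t)` on `N`, with `y` in a chart of `M` and `t` the fibre angle, total reality of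
`ι` persists for small `ε`: every vector of `TX` along the image is uniquely `A w + J A w'`, where
`A` is the derivative of the map in the `y`-directions. The `t`-derivative is divisible by `ε`, so
it equals `ε (A a + J A b)` with `a`, `b` smooth in `(ε, y, t)`, also at `ε = 0`. Then `∂_t - ε a`
is sent to `ε J A b`, and `b` to `A b`, so for `ε ≠ 0` the complex tangencies are spanned by `v =
∂_t - ε a` and `h = b` (`exists_isCoRealDatum`, `IsCoRealDatum.mem_iff`).

At `ε = 0` over the fibre of `p`, `v` is `∂_t` and `b` is `c(p) g_p'`, so `v, h, [v, h], [v, [v,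
h]]` become `∂_t` and the multiples by `c(p)` of `g_p', g_p'', g_p'''`. Convexity of `[g_p']` says
precisely that the last three are independent, up to a choice of sign. Independence is open, so the
four fields still frame `TN` for small `ε ≠ 0`, and such a frame makes the distribution Engel
(`isEngel_of_isEngelFrameAt`).

All of this is local near `(0, q₀)` in `ℝ × N`; compactness of `N` yields one `ε` for all points
(`IsTube.eventually_isEngelFrameAt`). For embeddings, `Ψ` is a local diffeomorphism along the zero
section, and compactness of `N × N` gives injectivity (`IsTube.eventually_eq_of_tubeMap_eq`). -/

noncomputable section

namespace CREngel

set_option linter.unusedSectionVars false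

/-! ### Global sections, brackets and smooth frames -/

section EngelCriterion

open VectorField

variable {E : Type*} [NormedAddCommGroup E] [NormedSpace ℝ E] [FiniteDimensional ℝ E]
  {H : Type*} [TopologicalSpace H] {I : ModelWithCorners ℝ E H}
  {M : Type*} [TopologicalSpace M] [T2Space M] [ChartedSpace H M] [IsManifold I ∞ M]

/-- A vector field tangent to `D` and smooth near `q` agrees near `q` with a global section. -/
theorem exists_mem_sections_eventuallyEq {D : ∀ x : M, Submodule ℝ (TangentSpace I x)} {q : M}
    {U : Set M} (hU : U ∈ 𝓝 q) {u : ∀ x : M, TangentSpace I x}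
    (hu : ContMDiffOn I I.tangent ∞ (fun x => (⟨x, u x⟩ : TangentBundle I M)) U)
    (hD : ∀ x ∈ U, u x ∈ D x) :
    ∃ v ∈ sections I D, v =ᶠ[𝓝 q] u := by
  have hV : interior U ∈ 𝓝 q := interior_mem_nhds.2 hU
  obtain ⟨χ, hχ⟩ := ((SmoothBumpFunction.nhds_basis_tsupport (I := I) q).mem_iff).1 hV
  refine ⟨(χ : M → ℝ) • u, ⟨?_, fun x => ?_⟩, ?_⟩
  · exact ContMDiffOn.smul_section_of_tsupport (u := interior U)
      χ.contMDiff.contMDiffOn isOpen_interior hχ.2 (hu.mono interior_subset)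
  · by_cases hx : x ∈ tsupport χ
    · exact (D x).smul_mem _ (hD x (interior_subset (hχ.2 hx)))
    · have : χ x = 0 := image_eq_zero_of_notMem_tsupport hx
      simp [this]
  · filter_upwards [χ.eventuallyEq_one] with x hx
    simp only [Pi.smul_apply', hx, Pi.one_apply, one_smul]
    rfl

/-- There is a global smooth function with prescribed derivative along a nonzero vector. -/
theorem exists_contMDiff_mvfderiv_eq_one (x : M) {v : TangentSpace I x} (hv : v ≠ 0) :
    ∃ f : M → ℝ, ContMDiff I 𝓘(ℝ, ℝ) ∞ f ∧ f x = 0 ∧ mvfderiv I f x v = 1 := by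
  have hinj : (mfderiv I 𝓘(ℝ, E) (extChartAt I x) x v : E) ≠ 0 := by
    intro h
    have := (isInvertible_mfderiv_extChartAt (I := I) (mem_extChartAt_source (I := I) x)).injective
    exact hv (this (by rw [h, map_zero]))
  obtain ⟨l, hl⟩ : ∃ l : E →L[ℝ] ℝ, l (mfderiv I 𝓘(ℝ, E) (extChartAt I x) x v) = 1 :=
    SeparatingDual.exists_eq_one hinj
  obtain ⟨χ⟩ := (inferInstance : Nonempty (SmoothBumpFunction I x))
  have hsm : ContMDiffOn I 𝓘(ℝ, ℝ) ∞ (fun y => l (extChartAt I x y - extChartAt I x x))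
      (chartAt H x).source :=
    l.contMDiff.comp_contMDiffOn
      ((contMDiffOn_extChartAt (I := I) (n := ∞)).sub contMDiffOn_const)
  refine ⟨fun y => χ y • l (extChartAt I x y - extChartAt I x x), χ.contMDiff_smul hsm, by simp, ?_⟩
  have heq : (fun y => χ y • l (extChartAt I x y - extChartAt I x x)) =ᶠ[𝓝 x]
      fun y => l (extChartAt I x y - extChartAt I x x) := by
    filter_upwards [χ.eventuallyEq_one] with y hy
    simp [hy]
  have h1 : HasMFDerivAt I 𝓘(ℝ, E) (extChartAt I x) x (mfderiv I 𝓘(ℝ, E) (extChartAt I x) x) :=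
    (mdifferentiableAt_extChartAt (mem_chart_source H x)).hasMFDerivAt
  have hg : HasFDerivAt (fun z : E => l (z - extChartAt I x x)) l (extChartAt I x x) := by
    have := l.hasFDerivAt.comp (extChartAt I x x)
      ((hasFDerivAt_id (𝕜 := ℝ) (extChartAt I x x)).sub_const (extChartAt I x x))
    rwa [ContinuousLinearMap.comp_id] at this
  have h2 := (hg.hasMFDerivAt.comp x h1).congr_of_eventuallyEq heq
  rw [mvfderiv, h2.mfderiv]
  exact hl

/-- The Leibniz rule gives `[u, f w] = f [u, w] + (u f) w`; choosing `f` with `f x = 0` and `(u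
f)(x) = 1` leaves `w x`. This is how `D ⊆ [D, D]` follows, since `bracket` contains values of
brackets only. -/
theorem mem_bracket_of_mem_sections {D₁ D₂ : ∀ x : M, Submodule ℝ (TangentSpace I x)}
    {u w : ∀ x : M, TangentSpace I x} (hu : u ∈ sections I D₁) (hw : w ∈ sections I D₂) {x : M}
    (hx : u x ≠ 0) : w x ∈ bracket I D₁ D₂ x := by
  obtain ⟨f, hf, hf0, hf1⟩ := exists_contMDiff_mvfderiv_eq_one x hx
  refine Submodule.subset_span ⟨u, hu, f • w, ⟨hf.smul_section hw.1, fun y => ?_⟩, ?_⟩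
  · exact (D₂ y).smul_mem _ (hw.2 y)
  · have : IsManifold I 2 M := IsManifold.of_le (n := ∞) ENat.LEInfty.out
    rw [mlieBracket_smul_right (hf.mdifferentiableAt (by simp)) (hw.1.mdifferentiableAt (by simp)),
      hf0, hf1]
    simp

theorem mlieBracket_mem_bracket {D₁ D₂ : ∀ x : M, Submodule ℝ (TangentSpace I x)}
    {u w : ∀ x : M, TangentSpace I x} (hu : u ∈ sections I D₁) (hw : w ∈ sections I D₂) (x : M) :
    mlieBracket I u w x ∈ bracket I D₁ D₂ x :=
  Submodule.subset_span ⟨u, hu, w, hw, rfl⟩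

theorem contMDiff_mlieBracket {u w : ∀ x : M, TangentSpace I x}
    (hu : ContMDiff I I.tangent ∞ (fun x => (⟨x, u x⟩ : TangentBundle I M)))
    (hw : ContMDiff I I.tangent ∞ (fun x => (⟨x, w x⟩ : TangentBundle I M))) :
    ContMDiff I I.tangent ∞ (fun x => (⟨x, mlieBracket I u w x⟩ : TangentBundle I M)) := by
  have : IsManifold I (minSmoothness ℝ 2) M := by
    rw [minSmoothness_of_isRCLikeNormedField]
    exact IsManifold.of_le (n := ∞) ENat.LEInfty.out
  have : IsManifold I ((∞ : WithTop ℕ∞) + 1) M := (inferInstance : IsManifold I ∞ M)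
  exact ContDiff.mlieBracket_vectorField (m := ⊤) (n := ⊤) hu hw (by simp)

/-- The representation of a family of vector fields in the trivialisation at `q`, as a
linear map. -/
def frameMap {k : ℕ} (u : Fin k → ∀ x : M, TangentSpace I x) (q x : M) : (Fin k → ℝ) →L[ℝ] E :=
  ∑ i, (ContinuousLinearMap.proj (R := ℝ) i).smulRight
    (trivializationAt E (TangentSpace I : M → Type _) q ⟨x, u i x⟩).2

theorem contMDiffAt_frameMap {k : ℕ} {u : Fin k → ∀ x : M, TangentSpace I x} {q : M}
    (hu : ∀ i, ContMDiffAt I I.tangent ∞ (fun x => (⟨x, u i x⟩ : TangentBundle I M)) q) :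
    ContMDiffAt I 𝓘(ℝ, (Fin k → ℝ) →L[ℝ] E) ∞ (frameMap u q) q := by
  have h : ∀ i, ContMDiffAt I 𝓘(ℝ, E) ∞
      (fun x => (trivializationAt E (TangentSpace I : M → Type _) q ⟨x, u i x⟩).2) q := fun i =>
    (contMDiffAt_section (F := E) (E := (TangentSpace I : M → Type _)) _).1 (hu i)
  unfold frameMap
  refine ContMDiffAt.sum fun i _ => ?_
  exact (ContinuousLinearMap.contMDiff (ContinuousLinearMap.smulRightL ℝ (Fin k → ℝ) E
    (ContinuousLinearMap.proj (R := ℝ) i))).contMDiffAt.comp q (h i)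

theorem frameMap_apply {k : ℕ} (u : Fin k → ∀ x : M, TangentSpace I x) {q x : M}
    (hx : x ∈ (trivializationAt E (TangentSpace I : M → Type _) q).baseSet) (c : Fin k → ℝ) :
    frameMap u q x c =
      (trivializationAt E (TangentSpace I : M → Type _) q).continuousLinearEquivAt ℝ x hx
        (∑ i, c i • u i x) := by
  simp [frameMap, map_sum]

theorem injective_frameMap_iff {k : ℕ} (u : Fin k → ∀ x : M, TangentSpace I x) {q x : M}
    (hx : x ∈ (trivializationAt E (TangentSpace I : M → Type _) q).baseSet) :
    Function.Injective (frameMap u q x) ↔ LinearIndependent ℝ fun i => u i x := by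
  have : (frameMap u q x : (Fin k → ℝ) → E) =
      ((trivializationAt E (TangentSpace I : M → Type _) q).continuousLinearEquivAt ℝ x hx) ∘
        fun c => ∑ i, c i • u i x := by
    ext1 c
    exact frameMap_apply u hx c
  rw [this, Function.Injective.of_comp_iff (ContinuousLinearEquiv.injective _),
    linearIndependent_iff_injective_fintypeLinearCombination]
  rfl

theorem eventually_linearIndependent {k : ℕ} {u : Fin k → ∀ x : M, TangentSpace I x} {q : M}
    (hu : ∀ i, ContMDiffAt I I.tangent ∞ (fun x => (⟨x, u i x⟩ : TangentBundle I M)) q)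
    (hq : LinearIndependent ℝ fun i => u i q) :
    ∀ᶠ x in 𝓝 q, LinearIndependent ℝ fun i => u i x := by
  have hb := mem_baseSet_trivializationAt E (TangentSpace I : M → Type _) q
  have hc := (contMDiffAt_frameMap hu).continuousAt
  have ho : IsOpen {f : (Fin k → ℝ) →L[ℝ] E | Function.Injective f} :=
    ContinuousLinearMap.isOpen_injective
  filter_upwards [hc.eventually (ho.mem_nhds ((injective_frameMap_iff u hb).2 hq)),
    (trivializationAt E (TangentSpace I : M → Type _) q).open_baseSet.mem_nhds hb] with x hx hxb
  exact (injective_frameMap_iff u hxb).1 hx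

/-- The coefficients of a smooth vector field in a smooth frame are differentiable. -/
theorem exists_coefficients {k : ℕ} {u : Fin k → ∀ x : M, TangentSpace I x} {q : M}
    (hu : ∀ i, ContMDiffAt I I.tangent ∞ (fun x => (⟨x, u i x⟩ : TangentBundle I M)) q)
    (hq : LinearIndependent ℝ fun i => u i q) {w : ∀ x : M, TangentSpace I x}
    (hw : ContMDiffAt I I.tangent ∞ (fun x => (⟨x, w x⟩ : TangentBundle I M)) q)
    (hspan : ∀ᶠ x in 𝓝 q, w x ∈ Submodule.span ℝ (range fun i => u i x)) :
    ∃ a : Fin k → M → ℝ, (∀ i, MDifferentiableAt I 𝓘(ℝ, ℝ) (a i) q) ∧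
      ∀ᶠ x in 𝓝 q, w x = ∑ i, a i x • u i x := by
  have hb := mem_baseSet_trivializationAt E (TangentSpace I : M → Type _) q
  have hinj := (injective_frameMap_iff u hb).2 hq
  obtain ⟨P, hP⟩ := (frameMap u q q : (Fin k → ℝ) →ₗ[ℝ] E).exists_leftInverse_of_injective
    (LinearMap.ker_eq_bot.2 hinj)
  -- A fixed left inverse `P` of the frame at `q` turns the frame at nearby points into a square
  -- matrix `Φ`, equal to the identity at `q`. The coefficients of `w` are then `Φ⁻¹ P w`, smooth
  -- because inversion is.
  let P' : E →L[ℝ] (Fin k → ℝ) := LinearMap.toContinuousLinearMap P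
  let Φ : M → ((Fin k → ℝ) →L[ℝ] (Fin k → ℝ)) := fun x => P'.comp (frameMap u q x)
  have hΦ : ContMDiffAt I 𝓘(ℝ, (Fin k → ℝ) →L[ℝ] (Fin k → ℝ)) ∞ Φ q :=
    (ContinuousLinearMap.contMDiff
      (ContinuousLinearMap.compL ℝ (Fin k → ℝ) E (Fin k → ℝ) P')).contMDiffAt.comp q
      (contMDiffAt_frameMap hu)
  have hΦq : Φ q = ContinuousLinearMap.id ℝ _ := by
    ext1 c
    exact LinearMap.congr_fun hP c
  have hΦinv : (Φ q).IsInvertible := by rw [hΦq]; exact ⟨ContinuousLinearEquiv.refl ℝ _, rfl⟩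
  have hinvn : ContMDiffAt I 𝓘(ℝ, (Fin k → ℝ) →L[ℝ] (Fin k → ℝ)) ∞
      (fun x => (Φ x).inverse) q :=
    ((hΦinv.contDiffAt_map_inverse).contMDiffAt).comp q hΦ
  have hW : ContMDiffAt I 𝓘(ℝ, E) ∞
      (fun x => (trivializationAt E (TangentSpace I : M → Type _) q ⟨x, w x⟩).2) q :=
    (contMDiffAt_section (F := E) (E := (TangentSpace I : M → Type _)) _).1 hw
  have hc : ContMDiffAt I 𝓘(ℝ, Fin k → ℝ) ∞ (fun x => (Φ x).inverse
      (P' (trivializationAt E (TangentSpace I : M → Type _) q ⟨x, w x⟩).2)) q :=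
    hinvn.clm_apply ((P'.contMDiff.contMDiffAt).comp q hW)
  refine ⟨fun i x => (Φ x).inverse
      (P' (trivializationAt E (TangentSpace I : M → Type _) q ⟨x, w x⟩).2) i, fun i => ?_, ?_⟩
  · exact (((ContinuousLinearMap.proj (R := ℝ) (φ := fun _ : Fin k => ℝ) i).contMDiff.contMDiffAt
      (n := ∞)).comp q hc).mdifferentiableAt (by simp)
  · have ho : IsOpen {f : (Fin k → ℝ) →L[ℝ] (Fin k → ℝ) | f.IsInvertible} :=
      ContinuousLinearEquiv.isOpen
    filter_upwards [hspan, hΦ.continuousAt.eventually (ho.mem_nhds hΦinv),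
      (trivializationAt E (TangentSpace I : M → Type _) q).open_baseSet.mem_nhds hb]
      with x hx hinvx hxb
    obtain ⟨c, hc⟩ := (Submodule.mem_span_range_iff_exists_fun ℝ).1 hx
    have h1 : (trivializationAt E (TangentSpace I : M → Type _) q ⟨x, w x⟩).2 =
        frameMap u q x c := by
      rw [frameMap_apply u hxb, hc]
      simp
    have h2 : (Φ x).inverse (P' (frameMap u q x c)) = c := by
      obtain ⟨e, he⟩ := hinvx
      change (Φ x).inverse (Φ x c) = c
      rw [← he]
      simp
    simp only [h1, h2, hc]

end EngelCriterion

/-! ### Engel distributions from local frames -/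

section EngelCriterion

open VectorField

variable {E : Type*} [NormedAddCommGroup E] [NormedSpace ℝ E] [FiniteDimensional ℝ E]
  {H : Type*} [TopologicalSpace H] {I : ModelWithCorners ℝ E H}
  {M : Type*} [TopologicalSpace M] [T2Space M] [ChartedSpace H M] [IsManifold I ∞ M]

/-- Near `x` every section is `a u₁ + b u₂` with differentiable coefficients, so by the Leibniz rule
a bracket of two sections is a combination of `u₁`, `u₂` and `[u₁, u₂]`. The spanning hypothesis is
needed on a neighbourhood because brackets involve first derivatives. -/
theorem bracket_le_span {D : ∀ x : M, Submodule ℝ (TangentSpace I x)}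
    {u₁ u₂ : ∀ x : M, TangentSpace I x} (h₁ : u₁ ∈ sections I D) (h₂ : u₂ ∈ sections I D) {x : M}
    (hli : LinearIndependent ℝ ![u₁ x, u₂ x])
    (hspan : ∀ᶠ y in 𝓝 x, D y ≤ Submodule.span ℝ {u₁ y, u₂ y}) :
    bracket I D D x ≤ Submodule.span ℝ {u₁ x, u₂ x, mlieBracket I u₁ u₂ x} := by
  have : IsManifold I 2 M := IsManifold.of_le (n := ∞) ENat.LEInfty.out
  have key : ∀ w ∈ sections I D, ∃ a b : M → ℝ, MDifferentiableAt I 𝓘(ℝ, ℝ) a x ∧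
      MDifferentiableAt I 𝓘(ℝ, ℝ) b x ∧ w =ᶠ[𝓝 x] a • u₁ + b • u₂ := by
    intro w hw
    have hr : ∀ y, (range fun i => ![u₁, u₂] i y) = {u₁ y, u₂ y} := by
      intro y
      ext v
      simp [Fin.exists_fin_two, eq_comm]
    obtain ⟨a, ha, haw⟩ := exists_coefficients (k := 2) (u := ![u₁, u₂]) (q := x) (w := w)
      (by
        intro i
        fin_cases i
        · exact h₁.1.contMDiffAt
        · exact h₂.1.contMDiffAt)
      (by
        convert hli using 1
        ext1 i
        fin_cases i <;> rfl) hw.1.contMDiffAt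
      (by
        filter_upwards [hspan] with y hy
        rw [hr]
        exact hy (hw.2 y))
    refine ⟨a 0, a 1, ha 0, ha 1, ?_⟩
    filter_upwards [haw] with y hy
    rw [hy, Fin.sum_univ_two]
    rfl
  have d₁ := h₁.1.mdifferentiableAt (x := x) (by simp)
  have d₂ := h₂.1.mdifferentiableAt (x := x) (by simp)
  have sm : ∀ {f : M → ℝ} {w : ∀ x : M, TangentSpace I x}, MDifferentiableAt I 𝓘(ℝ, ℝ) f x →
      MDifferentiableAt I I.tangent (fun y => (⟨y, w y⟩ : TangentBundle I M)) x →
      MDifferentiableAt I I.tangent (fun y => (⟨y, (f • w) y⟩ : TangentBundle I M)) x :=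
    fun hf hw => hf.smul_section hw
  set S := Submodule.span ℝ {u₁ x, u₂ x, mlieBracket I u₁ u₂ x} with hS
  have m₁ : u₁ x ∈ S := Submodule.subset_span (by simp)
  have m₂ : u₂ x ∈ S := Submodule.subset_span (by simp)
  have m₃ : mlieBracket I u₁ u₂ x ∈ S := Submodule.subset_span (by simp)
  have m₃' : mlieBracket I u₂ u₁ x ∈ S := by
    rw [mlieBracket_swap_apply]
    exact S.neg_mem m₃
  have m₀ : ∀ u : (∀ x : M, TangentSpace I x), mlieBracket I u u x = 0 := by
    intro u
    have h := mlieBracket_swap_apply (I := I) (V := u) (W := u) (x := x)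
    have h2 : (2 : ℝ) • mlieBracket I u u x = 0 := by
      rw [two_smul]
      nth_rewrite 1 [h]
      exact neg_add_cancel _
    exact (smul_eq_zero.1 h2).resolve_left two_ne_zero
  refine Submodule.span_le.2 ?_
  rintro _ ⟨u, hu, v, hv, rfl⟩
  obtain ⟨a, b, ha, hb, hab⟩ := key u hu
  obtain ⟨c, d, hc, hd, hcd⟩ := key v hv
  have right : ∀ w : (∀ x : M, TangentSpace I x),
      MDifferentiableAt I I.tangent (fun y => (⟨y, w y⟩ : TangentBundle I M)) x →
      mlieBracket I w u₁ x ∈ S → mlieBracket I w u₂ x ∈ S →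
      mlieBracket I w (c • u₁ + d • u₂) x ∈ S := by
    intro w _ hw₁ hw₂
    rw [mlieBracket_add_right (sm hc d₁) (sm hd d₂), mlieBracket_smul_right hc d₁,
      mlieBracket_smul_right hd d₂]
    exact S.add_mem (S.add_mem (S.smul_mem _ m₁) (S.smul_mem _ hw₁))
      (S.add_mem (S.smul_mem _ m₂) (S.smul_mem _ hw₂))
  rw [hab.mlieBracket_vectorField_eq hcd, mlieBracket_add_left (sm ha d₁) (sm hb d₂),
    mlieBracket_smul_left ha d₁, mlieBracket_smul_left hb d₂]
  have r₁ := right u₁ d₁ (by rw [m₀]; exact S.zero_mem) m₃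
  have r₂ := right u₂ d₂ m₃' (by rw [m₀]; exact S.zero_mem)
  exact S.add_mem (S.add_mem (S.smul_mem _ m₁) (S.smul_mem _ r₁))
      (S.add_mem (S.smul_mem _ m₂) (S.smul_mem _ r₂))

/-- Near `q`, the fields `u₁`, `u₂` span `D` and, with their iterated brackets, `TM`. -/
structure IsEngelFrameAt (D : ∀ x : M, Submodule ℝ (TangentSpace I x))
    (u₁ u₂ : ∀ x : M, TangentSpace I x) (q : M) : Prop where
  contMDiffAt : ∃ U ∈ 𝓝 q,
    ContMDiffOn I I.tangent ∞ (fun x => (⟨x, u₁ x⟩ : TangentBundle I M)) U ∧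
    ContMDiffOn I I.tangent ∞ (fun x => (⟨x, u₂ x⟩ : TangentBundle I M)) U ∧
    ∀ x ∈ U, u₁ x ∈ D x ∧ u₂ x ∈ D x
  linearIndependent : LinearIndependent ℝ ![u₁ q, u₂ q, mlieBracket I u₁ u₂ q,
    mlieBracket I u₁ (mlieBracket I u₁ u₂) q]

theorem range_cons_three {V : Type*} (a b c : V) : range ![a, b, c] = {a, b, c} := by
  simp only [Matrix.range_cons, Matrix.range_empty, union_empty, singleton_union]

theorem range_cons_two {V : Type*} (a b : V) : range ![a, b] = {a, b} := by
  simp only [Matrix.range_cons, Matrix.range_empty, union_empty, singleton_union]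

theorem LinearIndependent.of_cons_four {V : Type*} [AddCommGroup V] [Module ℝ V] {a b c d : V}
    (h : LinearIndependent ℝ ![a, b, c, d]) :
    LinearIndependent ℝ ![a, b] ∧ LinearIndependent ℝ ![a, b, c] := by
  constructor
  · convert h.comp ![0, 1] (by decide) using 1
    ext1 i
    fin_cases i <;> rfl
  · convert h.comp ![0, 1, 2] (by decide) using 1
    ext1 i
    fin_cases i <;> rfl

/-- The definition of `bracket` sees global sections only, so the local frame is first replaced by
global sections with the same germs at `q`. Independence is open, and the rank of `D` then turns
independence of `v₁`, `v₂` into spanning, nearby as well as at `q`. -/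
theorem exists_sections_of_frame {D : ∀ x : M, Submodule ℝ (TangentSpace I x)}
    (hD : ∀ x, Module.finrank ℝ (D x) = 2) {u₁ u₂ : ∀ x : M, TangentSpace I x} {q : M}
    (h : IsEngelFrameAt D u₁ u₂ q) :
    ∃ v₁ ∈ sections I D, ∃ v₂ ∈ sections I D, ∀ᶠ x in 𝓝 q,
      LinearIndependent ℝ ![v₁ x, v₂ x, mlieBracket I v₁ v₂ x,
        mlieBracket I v₁ (mlieBracket I v₁ v₂) x] ∧
      D x = Submodule.span ℝ {v₁ x, v₂ x} ∧
      bracket I D D x = Submodule.span ℝ {v₁ x, v₂ x, mlieBracket I v₁ v₂ x} := by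
  obtain ⟨U, hU, s₁, s₂, hUD⟩ := h.contMDiffAt
  obtain ⟨v₁, hv₁, e₁⟩ := exists_mem_sections_eventuallyEq hU s₁ fun x hx => (hUD x hx).1
  obtain ⟨v₂, hv₂, e₂⟩ := exists_mem_sections_eventuallyEq hU s₂ fun x hx => (hUD x hx).2
  have e₃ : mlieBracket I v₁ v₂ =ᶠ[𝓝 q] mlieBracket I u₁ u₂ := by
    filter_upwards [e₁.eventually_nhds, e₂.eventually_nhds] with x h1 h2
    exact Filter.EventuallyEq.mlieBracket_vectorField_eq h1 h2
  have hq : LinearIndependent ℝ ![v₁ q, v₂ q, mlieBracket I v₁ v₂ q,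
      mlieBracket I v₁ (mlieBracket I v₁ v₂) q] := by
    rw [e₁.mlieBracket_vectorField_eq e₃, e₁.eq_of_nhds, e₂.eq_of_nhds, e₃.eq_of_nhds]
    exact h.linearIndependent
  have s₃ := contMDiff_mlieBracket hv₁.1 hv₂.1
  have s₄ := contMDiff_mlieBracket hv₁.1 s₃
  have hev : ∀ᶠ x in 𝓝 q, LinearIndependent ℝ ![v₁ x, v₂ x, mlieBracket I v₁ v₂ x,
      mlieBracket I v₁ (mlieBracket I v₁ v₂) x] := by
    have hfun : ∀ x, (fun i => (![v₁, v₂, mlieBracket I v₁ v₂,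
        mlieBracket I v₁ (mlieBracket I v₁ v₂)] : Fin 4 → ∀ x : M, TangentSpace I x) i x) =
        ![v₁ x, v₂ x, mlieBracket I v₁ v₂ x, mlieBracket I v₁ (mlieBracket I v₁ v₂) x] := by
      intro x
      ext1 i
      fin_cases i <;> rfl
    have := eventually_linearIndependent (k := 4) (q := q) (u := ![v₁, v₂, mlieBracket I v₁ v₂,
        mlieBracket I v₁ (mlieBracket I v₁ v₂)])
      (by
        intro i
        fin_cases i
        · exact hv₁.1.contMDiffAt
        · exact hv₂.1.contMDiffAt
        · exact s₃.contMDiffAt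
        · exact s₄.contMDiffAt) (by rw [hfun]; exact hq)
    filter_upwards [this] with x hx
    rwa [hfun] at hx
  have hspan : ∀ᶠ x in 𝓝 q, D x = Submodule.span ℝ {v₁ x, v₂ x} := by
    filter_upwards [hev] with x hx
    have : FiniteDimensional ℝ (TangentSpace I x) := inferInstanceAs (FiniteDimensional ℝ E)
    symm
    apply Submodule.eq_of_le_of_finrank_eq
    · refine Submodule.span_le.2 ?_
      rintro _ (rfl | rfl)
      exacts [hv₁.2 x, hv₂.2 x]
    · rw [hD, ← range_cons_two, finrank_span_eq_card (LinearIndependent.of_cons_four hx).1]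
      rfl
  refine ⟨v₁, hv₁, v₂, hv₂, ?_⟩
  filter_upwards [hev, hspan, hspan.eventually_nhds] with x hx hDx hspx
  refine ⟨hx, hDx, le_antisymm ?_ ?_⟩
  · exact bracket_le_span hv₁ hv₂ (LinearIndependent.of_cons_four hx).1
      (hspx.mono fun y hy => hy.le)
  · have hne : v₁ x ≠ 0 := (LinearIndependent.of_cons_four hx).1.ne_zero 0
    refine Submodule.span_le.2 ?_
    rintro _ (rfl | rfl | rfl)
    · exact mem_bracket_of_mem_sections hv₁ hv₁ hne
    · exact mem_bracket_of_mem_sections hv₁ hv₂ hne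
    · exact mlieBracket_mem_bracket hv₁ hv₂ x

/-- A rank-2 distribution on a 4-manifold is Engel if around each point it has a frame `u₁`, `u₂`
such that `u₁`, `u₂`, `[u₁, u₂]`, `[u₁, [u₁, u₂]]` are linearly independent. -/
theorem isEngel_of_isEngelFrameAt (hE : Module.finrank ℝ E = 4)
    {D : ∀ x : M, Submodule ℝ (TangentSpace I x)} (hD : ∀ x, Module.finrank ℝ (D x) = 2)
    (h : ∀ q, ∃ u₁ u₂, IsEngelFrameAt D u₁ u₂ q) : IsEngel I D := by
  have hfin : ∀ x : M, FiniteDimensional ℝ (TangentSpace I x) := fun x =>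
    inferInstanceAs (FiniteDimensional ℝ E)
  have key : ∀ q, ∃ v₁ ∈ sections I D, ∃ v₂ ∈ sections I D, ∀ᶠ x in 𝓝 q,
      LinearIndependent ℝ ![v₁ x, v₂ x, mlieBracket I v₁ v₂ x,
        mlieBracket I v₁ (mlieBracket I v₁ v₂) x] ∧
      D x = Submodule.span ℝ {v₁ x, v₂ x} ∧
      bracket I D D x = Submodule.span ℝ {v₁ x, v₂ x, mlieBracket I v₁ v₂ x} := by
    intro q
    obtain ⟨u₁, u₂, hu⟩ := h q
    exact exists_sections_of_frame hD hu
  have hfr : ∀ x, Module.finrank ℝ (bracket I D D x) = 3 := by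
    intro x
    obtain ⟨v₁, hv₁, v₂, hv₂, hev⟩ := key x
    obtain ⟨hli, -, hb⟩ := hev.self_of_nhds
    rw [hb, ← range_cons_three, finrank_span_eq_card (LinearIndependent.of_cons_four hli).2]
    rfl
  have hle : ∀ x, D x ≤ bracket I D D x := by
    intro x
    obtain ⟨v₁, hv₁, v₂, hv₂, hev⟩ := key x
    obtain ⟨-, hD', hb⟩ := hev.self_of_nhds
    rw [hb, hD']
    exact Submodule.span_mono (by grind)
  have htop : ∀ x, bracket I D (bracket I D D) x = ⊤ := by
    intro x
    obtain ⟨v₁, hv₁, v₂, hv₂, hev⟩ := key x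
    obtain ⟨hli, -, -⟩ := hev.self_of_nhds
    have hne : v₁ x ≠ 0 := (LinearIndependent.of_cons_four hli).1.ne_zero 0
    have hw₃ : mlieBracket I v₁ v₂ ∈ sections I (bracket I D D) :=
      ⟨contMDiff_mlieBracket hv₁.1 hv₂.1, fun y => mlieBracket_mem_bracket hv₁ hv₂ y⟩
    rw [← top_le_iff, ← hli.span_eq_top_of_card_eq_finrank (by
      rw [Fintype.card_fin]; exact hE.symm)]
    refine Submodule.span_le.2 ?_
    rintro _ ⟨i, rfl⟩
    fin_cases i
    · exact mem_bracket_of_mem_sections hv₁ ⟨hv₁.1, fun y => hle y (hv₁.2 y)⟩ hne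
    · exact mem_bracket_of_mem_sections hv₁ ⟨hv₂.1, fun y => hle y (hv₂.2 y)⟩ hne
    · exact mem_bracket_of_mem_sections hv₁ hw₃ hne
    · exact mlieBracket_mem_bracket hv₁ hw₃ x
  refine ⟨⟨hD, fun q => ?_⟩, ⟨3, hfr, fun q => ?_⟩, fun x => ?_, fun x => ?_, htop⟩
  · obtain ⟨v₁, hv₁, v₂, hv₂, hev⟩ := key q
    refine ⟨_, hev, ![v₁, v₂], fun i => ?_, fun x hx => ?_⟩
    · fin_cases i
      exacts [hv₁.1.contMDiffOn, hv₂.1.contMDiffOn]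
    · rw [hx.2.1, ← range_cons_two]
      congr 2
      ext1 i
      fin_cases i <;> rfl
  · obtain ⟨v₁, hv₁, v₂, hv₂, hev⟩ := key q
    refine ⟨_, hev, ![v₁, v₂, mlieBracket I v₁ v₂], fun i => ?_, fun x hx => ?_⟩
    · fin_cases i
      exacts [hv₁.1.contMDiffOn, hv₂.1.contMDiffOn,
        (contMDiff_mlieBracket hv₁.1 hv₂.1).contMDiffOn]
    · rw [hx.2.2, ← range_cons_three]
      congr 2
      ext1 i
      fin_cases i <;> rfl
  · refine lt_of_le_of_ne (hle x) fun he => ?_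
    have h2 := hD x
    rw [he, hfr x] at h2
    omega
  · rw [htop x]
    refine lt_top_iff_ne_top.2 fun he => ?_
    have h3 := hfr x
    rw [he, finrank_top] at h3
    have h4 : Module.finrank ℝ (TangentSpace I x) = 4 := hE
    omega

end EngelCriterion

/-! ### Brackets of vector fields depending on a parameter -/

section LocalAnalysis

open VectorField

/-- The Lie bracket of two families of vector fields, taken parameter by parameter. -/
def sliceBracket {P : Type*} [NormedAddCommGroup P] [NormedSpace ℝ P] (U W : ℝ × P → P)
    (p : ℝ × P) : P :=
  lieBracket ℝ (fun z => U (p.1, z)) (fun z => W (p.1, z)) p.2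

theorem fderiv_slice_apply {P Q : Type*} [NormedAddCommGroup P] [NormedSpace ℝ P]
    [NormedAddCommGroup Q] [NormedSpace ℝ Q] {U : ℝ × P → Q} {p : ℝ × P}
    (hU : DifferentiableAt ℝ U p) (v : P) :
    fderiv ℝ (fun z => U (p.1, z)) p.2 v = fderiv ℝ U p (0, v) := by
  have h : HasFDerivAt (fun z : P => (p.1, z)) (ContinuousLinearMap.inr ℝ ℝ P) p.2 :=
    hasFDerivAt_prodMk_right p.1 p.2
  have h2 : HasFDerivAt U (fderiv ℝ U p) (p.1, p.2) := hU.hasFDerivAt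
  have h3 : fderiv ℝ (fun z => U (p.1, z)) p.2 = _ := (h2.comp p.2 h).fderiv
  rw [h3]
  simp

/-- Differentiating a slice is differentiating the full map along `(0, ·)`, so the bracket is smooth
jointly in parameter and point. This lets information at `ε = 0` spread to `ε ≠ 0`. -/
theorem contDiffOn_sliceBracket {P : Type*} [NormedAddCommGroup P] [NormedSpace ℝ P]
    {U W : ℝ × P → P} {Ω : Set (ℝ × P)} (hΩ : IsOpen Ω) (hU : ContDiffOn ℝ ∞ U Ω)
    (hW : ContDiffOn ℝ ∞ W Ω) : ContDiffOn ℝ ∞ (sliceBracket U W) Ω := by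
  have h : ContDiffOn ℝ ∞ (fun p => fderiv ℝ W p (0, U p) - fderiv ℝ U p (0, W p)) Ω :=
    ((hW.fderiv_of_isOpen hΩ (by simp)).clm_apply (contDiffOn_const.prodMk hU)).sub
      ((hU.fderiv_of_isOpen hΩ (by simp)).clm_apply (contDiffOn_const.prodMk hW))
  refine h.congr fun p hp => ?_
  rw [sliceBracket, lieBracket,
    fderiv_slice_apply ((hW.contDiffAt (hΩ.mem_nhds hp)).differentiableAt (by simp)),
    fderiv_slice_apply ((hU.contDiffAt (hΩ.mem_nhds hp)).differentiableAt (by simp))]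

variable {F V : Type*} [NormedAddCommGroup F] [NormedSpace ℝ F]
  [NormedAddCommGroup V] [NormedSpace ℝ V]

theorem fderiv_apply_zero_one {W : F × ℝ → V} {y : F} {t : ℝ}
    (hW : DifferentiableAt ℝ W (y, t)) :
    fderiv ℝ W (y, t) (0, 1) = deriv (fun s => W (y, s)) t := by
  have h : HasFDerivAt (fun s : ℝ => (y, s)) (ContinuousLinearMap.inr ℝ F ℝ) t :=
    hasFDerivAt_prodMk_right y t
  have h2 : deriv (fun s => W (y, s)) t = _ :=
    ((hW.hasFDerivAt).comp_hasDerivAt t h.hasDerivAt).deriv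
  rw [h2]
  simp

theorem contDiffAt_deriv {f : ℝ → F} {t : ℝ} (hf : ContDiffAt ℝ ∞ f t) :
    ContDiffAt ℝ ∞ (deriv f) t :=
  (hf.fderiv_right (m := ∞) (by simp)).clm_apply contDiffAt_const

theorem linearIndependent_frame {x y z : F} (h : LinearIndependent ℝ ![x, y, z]) :
    LinearIndependent ℝ ![((0 : F), (1 : ℝ)), (x, 0), (y, 0), (z, 0)] := by
  rw [Fintype.linearIndependent_iff] at h ⊢
  intro g hg
  simp only [Fin.sum_univ_four, Matrix.cons_val] at hg
  have h1 := congrArg Prod.fst hg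
  have h2 := congrArg Prod.snd hg
  simp at h1 h2
  have h3 := h ![g 1, g 2, g 3] (by simpa [Fin.sum_univ_three] using h1)
  intro i
  fin_cases i
  · exact h2
  · exact h3 0
  · exact h3 1
  · exact h3 2

/-- The vector field `∂_t - ε a` on `F × ℝ`, depending on a parameter `ε`. -/
def vField (a : ℝ × (F × ℝ) → F) (p : ℝ × (F × ℝ)) : F × ℝ := (-(p.1 • a p), 1)

/-- The vector field `b` on `F × ℝ`, tangent to the first factor. -/
def hField (b : ℝ × (F × ℝ) → F) (p : ℝ × (F × ℝ)) : F × ℝ := (b p, 0)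

/-- For `ε = 0` the field `vField a` is the constant `∂_t`, and bracketing with it is
`t`-differentiation: the four vectors are `∂_t, b, b', b''`. They vary continuously with `p` and
independence is an open condition. -/
theorem eventually_linearIndependent_sliceBracket {a b : ℝ × (F × ℝ) → F}
    {Ω : Set (ℝ × (F × ℝ))} (hΩ : IsOpen Ω) (ha : ContDiffOn ℝ ∞ a Ω) (hb : ContDiffOn ℝ ∞ b Ω)
    {y₀ : F} {t₀ : ℝ} (h0 : ((0 : ℝ), (y₀, t₀)) ∈ Ω)
    (hli : LinearIndependent ℝ ![b (0, (y₀, t₀)), deriv (fun s => b (0, (y₀, s))) t₀,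
      deriv (deriv (fun s => b (0, (y₀, s)))) t₀]) :
    ∀ᶠ p in 𝓝 ((0 : ℝ), (y₀, t₀)), LinearIndependent ℝ ![vField a p, hField b p,
      sliceBracket (vField a) (hField b) p,
      sliceBracket (vField a) (sliceBracket (vField a) (hField b)) p] := by
  have hv : ContDiffOn ℝ ∞ (vField a) Ω :=
    ((contDiffOn_fst.smul ha).neg).prodMk contDiffOn_const
  have hh : ContDiffOn ℝ ∞ (hField b) Ω := hb.prodMk contDiffOn_const
  have h3 := contDiffOn_sliceBracket hΩ hv hh
  have h4 := contDiffOn_sliceBracket hΩ hv h3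
  have hnhds := hΩ.mem_nhds h0
  have hvconst : (fun z : F × ℝ => vField a (0, z)) = fun _ => (0, 1) := by
    ext1 z
    simp [vField]
  have hslice : ∀ {W : ℝ × (F × ℝ) → F × ℝ}, ContDiffOn ℝ ∞ W Ω → ∀ {s : ℝ},
      ((0 : ℝ), (y₀, s)) ∈ Ω → sliceBracket (vField a) W (0, (y₀, s)) =
        deriv (fun s => W (0, (y₀, s))) s := by
    intro W hW s hs
    have hd : DifferentiableAt ℝ (fun z => W (0, z)) (y₀, s) :=
      ((hW.contDiffAt (hΩ.mem_nhds hs)).differentiableAt (by simp)).comp (y₀, s)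
        ((differentiableAt_const _).prodMk differentiableAt_id)
    rw [sliceBracket, lieBracket]
    simp only [hvconst]
    rw [congrFun hvconst (y₀, s), fderiv_apply_zero_one hd]
    simp
  -- The inner bracket gets differentiated again in `t`, so its value is needed for all `s` near
  -- `t₀`, not only at `t₀`.
  have hsΩ : ∀ᶠ s in 𝓝 t₀, ((0 : ℝ), (y₀, s)) ∈ Ω := by
    have : ContinuousAt (fun s : ℝ => ((0 : ℝ), (y₀, s))) t₀ := by fun_prop
    exact this.eventually hnhds
  have hline : ∀ {s : ℝ}, ((0 : ℝ), (y₀, s)) ∈ Ω →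
      ContDiffAt ℝ ∞ (fun s => b (0, (y₀, s))) s := by
    intro s hs
    exact (hb.contDiffAt (hΩ.mem_nhds hs)).comp s
      (contDiffAt_const.prodMk (contDiffAt_const.prodMk contDiffAt_id))
  have e3 : ∀ {s : ℝ}, ((0 : ℝ), (y₀, s)) ∈ Ω →
      sliceBracket (vField a) (hField b) (0, (y₀, s)) =
        (deriv (fun s => b (0, (y₀, s))) s, 0) := by
    intro s hs
    rw [hslice hh hs]
    exact (((hline hs).differentiableAt (by simp)).hasDerivAt.prodMk
      (hasDerivAt_const s (0 : ℝ))).deriv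
  have e4 : sliceBracket (vField a) (sliceBracket (vField a) (hField b)) (0, (y₀, t₀)) =
      (deriv (deriv (fun s => b (0, (y₀, s)))) t₀, 0) := by
    rw [hslice h3 h0]
    have : (fun s => sliceBracket (vField a) (hField b) (0, (y₀, s))) =ᶠ[𝓝 t₀]
        fun s => (deriv (fun s => b (0, (y₀, s))) s, (0 : ℝ)) := by
      filter_upwards [hsΩ] with s hs using e3 hs
    rw [this.deriv_eq]
    have hd : DifferentiableAt ℝ (deriv (fun s => b (0, (y₀, s)))) t₀ :=
      (contDiffAt_deriv (hline h0)).differentiableAt (by simp)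
    exact (hd.hasDerivAt.prodMk (hasDerivAt_const t₀ (0 : ℝ))).deriv
  have hq : LinearIndependent ℝ ![vField a (0, (y₀, t₀)), hField b (0, (y₀, t₀)),
      sliceBracket (vField a) (hField b) (0, (y₀, t₀)),
      sliceBracket (vField a) (sliceBracket (vField a) (hField b)) (0, (y₀, t₀))] := by
    rw [e3 h0, e4, congrFun hvconst (y₀, t₀), hField]
    exact linearIndependent_frame hli
  have hc : ContinuousAt (fun p => ![vField a p, hField b p,
      sliceBracket (vField a) (hField b) p,
      sliceBracket (vField a) (sliceBracket (vField a) (hField b)) p]) ((0 : ℝ), (y₀, t₀)) := by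
    rw [continuousAt_pi]
    intro i
    fin_cases i
    · exact hv.continuousOn.continuousAt hnhds
    · exact hh.continuousOn.continuousAt hnhds
    · exact h3.continuousOn.continuousAt hnhds
    · exact h4.continuousOn.continuousAt hnhds
  exact hc.eventually (isOpen_setOfPred_linearIndependent.mem_nhds hq)

end LocalAnalysis

/-! ### Computing the complex tangencies -/

section CoRealFrames

open VectorField

variable {F V : Type*} [NormedAddCommGroup F] [NormedSpace ℝ F]
  [NormedAddCommGroup V] [NormedSpace ℝ V]

/-- The data, at a point, from which the complex tangencies of a co-real map can be computed. -/
structure IsCoRealDatum (D : F × ℝ →ₗ[ℝ] V) (J : V →ₗ[ℝ] V) (ε : ℝ) (a b : F) : Prop where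
  totallyReal : ∀ w w', D (w, 0) + J (D (w', 0)) = 0 → w = 0 ∧ w' = 0
  apply_zero_one : D (0, 1) = ε • (D (a, 0) + J (D (b, 0)))
  ne_zero : b ≠ 0

namespace IsCoRealDatum

variable {D : F × ℝ →ₗ[ℝ] V} {J : V →ₗ[ℝ] V} {ε : ℝ} {a b : F}

theorem apply_eq (h : IsCoRealDatum D J ε a b) (w : F) (s : ℝ) :
    D (w, s) = D (w + (s * ε) • a, 0) + J (D ((s * ε) • b, 0)) := by
  have h1 : ((w, s) : F × ℝ) = (w, 0) + s • ((0 : F), (1 : ℝ)) := by simp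
  have h2 : ((w + (s * ε) • a, 0) : F × ℝ) = (w, 0) + (s * ε) • (a, (0 : ℝ)) := by simp
  have h3 : (((s * ε) • b, 0) : F × ℝ) = (s * ε) • (b, (0 : ℝ)) := by simp
  rw [h1, h2, h3, map_add, map_smul, h.apply_zero_one, map_add, map_smul, map_smul, map_smul]
  module

theorem injective (h : IsCoRealDatum D J ε a b) (hε : ε ≠ 0) : Function.Injective D := by
  rw [injective_iff_map_eq_zero]
  rintro ⟨w, s⟩ hws
  rw [h.apply_eq] at hws
  obtain ⟨h1, h2⟩ := h.totallyReal _ _ hws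
  have hs : s = 0 := by
    have := (smul_eq_zero.1 h2).resolve_right h.ne_zero
    exact (mul_eq_zero.1 this).resolve_right hε
  subst hs
  simpa using h1

/-- By `apply_eq` each `D (w, s)` has a real part and a `J`-part, unique by total reality. Comparing
them in `D (w, s) = J (D (w', s'))` gives two equations: the second only determines `w'`, the first
says `(w, s) = s • (-ε a, 1) - s' ε • (b, 0)` with `s`, `s'` free. -/
theorem mem_iff (h : IsCoRealDatum D J ε a b) (hε : ε ≠ 0) (hJ : ∀ v, J (J v) = -v)
    (ξ : F × ℝ) : D ξ ∈ (LinearMap.range D ⊓ (LinearMap.range D).map J) ↔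
      ξ ∈ Submodule.span ℝ {(-(ε • a), 1), (b, (0 : ℝ))} := by
  have key : ∀ (w w' : F) (s s' : ℝ), D (w, s) = J (D (w', s')) ↔
      w + (s * ε) • a = -((s' * ε) • b) ∧ w' + (s' * ε) • a = (s * ε) • b := by
    intro w w' s s'
    rw [h.apply_eq w s, h.apply_eq w' s', map_add, hJ]
    constructor
    · intro he
      have := h.totallyReal (w + (s * ε) • a + (s' * ε) • b) ((s * ε) • b - (w' + (s' * ε) • a)) (by
        have e1 : ((w + (s * ε) • a + (s' * ε) • b, 0) : F × ℝ) =
          (w + (s * ε) • a, 0) + ((s' * ε) • b, 0) := by simp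
        have e2 : (((s * ε) • b - (w' + (s' * ε) • a), 0) : F × ℝ) =
          ((s * ε) • b, 0) - (w' + (s' * ε) • a, 0) := by simp
        rw [e1, e2, map_add, map_sub, map_sub]
        refine Eq.trans ?_ (sub_eq_zero.2 he)
        abel)
      exact ⟨eq_neg_of_add_eq_zero_left this.1, (sub_eq_zero.1 this.2).symm⟩
    · rintro ⟨h1, h2⟩
      have e1 : ((-((s' * ε) • b), 0) : F × ℝ) = -((s' * ε) • b, 0) := by simp
      rw [h1, h2, e1, map_neg, add_comm]
  obtain ⟨w, s⟩ := ξ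
  rw [Submodule.mem_span_pair, Submodule.mem_inf]
  constructor
  · rintro ⟨-, -, ⟨⟨w', s'⟩, rfl⟩, he⟩
    obtain ⟨h1, -⟩ := (key w w' s s').1 he.symm
    refine ⟨s, -(s' * ε), ?_⟩
    rw [eq_sub_of_add_eq h1]
    ext
    · simp
      module
    · simp
  · rintro ⟨c, d, hcd⟩
    -- The witness solves the two equations of `key` with `s = c`: the first forces `s' = -d / ε`,
    -- and the second then gives `w' = c ε b + d a`.
    refine ⟨⟨_, rfl⟩, D ((c * ε) • b + d • a, -(d / ε)), ⟨_, rfl⟩, ?_⟩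
    have h1 := congrArg Prod.fst hcd
    have h2 := congrArg Prod.snd hcd
    simp at h1 h2
    subst h2
    symm
    rw [key]
    have hd : -(d / ε) * ε = -d := by field_simp
    rw [hd, ← h1]
    constructor
    · module
    · module

end IsCoRealDatum

variable [FiniteDimensional ℝ F] [FiniteDimensional ℝ V]

/-- Solving smoothly for the complex tangencies of `(y, t) ↦ Ψ (y, ε G (y, t))`, for small `ε`. -/
theorem exists_isCoRealDatum (hFV : Module.finrank ℝ V = 2 * Module.finrank ℝ F)
    {O : Set V} (J : V → V →ₗ[ℝ] V)
    (hJ : ContDiffOn ℝ ∞ (fun p : V × V => J p.1 p.2) (O ×ˢ univ))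
    {S : Set (F × F)} (hS : IsOpen S) {Ψ : F × F → V} (hΨ : ContDiffOn ℝ ∞ Ψ S)
    (hSO : MapsTo Ψ S O) {Z : Set (F × ℝ)} (hZ : IsOpen Z) {G : F × ℝ → F}
    (hG : ContDiffOn ℝ ∞ G Z) {y₀ : F} {t₀ : ℝ} (h0S : (y₀, 0) ∈ S) (h0Z : (y₀, t₀) ∈ Z)
    {c : ℝ} (hc : c ≠ 0)
    (hfib : ∀ v, fderiv ℝ Ψ (y₀, 0) (0, v) = c • J (Ψ (y₀, 0)) (fderiv ℝ Ψ (y₀, 0) (v, 0)))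
    (hreal : ∀ w w', fderiv ℝ Ψ (y₀, 0) (w, 0) +
      J (Ψ (y₀, 0)) (fderiv ℝ Ψ (y₀, 0) (w', 0)) = 0 → w = 0 ∧ w' = 0)
    (hli : LinearIndependent ℝ ![deriv (fun s => G (y₀, s)) t₀,
      deriv (deriv (fun s => G (y₀, s))) t₀, deriv (deriv (deriv (fun s => G (y₀, s)))) t₀]) :
    ∃ Ω : Set (ℝ × (F × ℝ)), IsOpen Ω ∧ (0, (y₀, t₀)) ∈ Ω ∧ ∃ a b : ℝ × (F × ℝ) → F,
      ContDiffOn ℝ ∞ a Ω ∧ ContDiffOn ℝ ∞ b Ω ∧ ∀ p ∈ Ω,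
        p.2 ∈ Z ∧ (p.2.1, p.1 • G p.2) ∈ S ∧
        IsCoRealDatum (fderiv ℝ (fun z : F × ℝ => Ψ (z.1, p.1 • G z)) p.2 : F × ℝ →ₗ[ℝ] V)
          (J (Ψ (p.2.1, p.1 • G p.2))) p.1 (a p) (b p) ∧
        LinearIndependent ℝ ![vField a p, hField b p, sliceBracket (vField a) (hField b) p,
          sliceBracket (vField a) (sliceBracket (vField a) (hField b)) p] := by
  let h : ℝ × (F × ℝ) → F × F := fun p => (p.2.1, p.1 • G p.2)
  set Ω₀ : Set (ℝ × (F × ℝ)) := Prod.snd ⁻¹' Z with hΩ₀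
  have hΩ₀o : IsOpen Ω₀ := hZ.preimage continuous_snd
  have hG' : ContDiffOn ℝ ∞ (fun p : ℝ × (F × ℝ) => G p.2) Ω₀ :=
    hG.comp contDiffOn_snd fun p hp => hp
  have hh : ContDiffOn ℝ ∞ h Ω₀ :=
    (contDiff_fst.comp contDiff_snd).contDiffOn.prodMk (contDiffOn_fst.smul hG')
  set Ω₁ := Ω₀ ∩ h ⁻¹' S with hΩ₁
  have hΩ₁o : IsOpen Ω₁ := hh.continuousOn.isOpen_inter_preimage hΩ₀o hS
  have hh₁ : ContDiffOn ℝ ∞ h Ω₁ := hh.mono inter_subset_left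
  have hmaps : MapsTo h Ω₁ S := fun p hp => hp.2
  have hΨ' : ContDiffOn ℝ ∞ (fun p => fderiv ℝ Ψ (h p)) Ω₁ :=
    (hΨ.fderiv_of_isOpen hS (by simp)).comp hh₁ hmaps
  have hdG : ContDiffOn ℝ ∞ (fun p : ℝ × (F × ℝ) => fderiv ℝ G p.2) Ω₁ :=
    (hG.fderiv_of_isOpen hZ (by simp)).comp contDiffOn_snd fun p hp => hp.1
  -- `A` is the derivative of `(y, t) ↦ Ψ (y, ε G (y, t))` in the `y`-directions.
  let A : ℝ × (F × ℝ) → F → V := fun p w => fderiv ℝ Ψ (h p) (w, p.1 • fderiv ℝ G p.2 (w, 0))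
  have hA : ∀ w, ContDiffOn ℝ ∞ (fun p => A p w) Ω₁ := fun w =>
    hΨ'.clm_apply (contDiffOn_const.prodMk (contDiffOn_fst.smul (hdG.clm_apply contDiffOn_const)))
  -- The `t`-derivative of the map is `ε B`. Dividing by `ε` beforehand makes the linear system for
  -- `a`, `b` smooth and nontrivial at `ε = 0`.
  let B : ℝ × (F × ℝ) → V := fun p => fderiv ℝ Ψ (h p) (0, fderiv ℝ G p.2 (0, 1))
  have hB : ContDiffOn ℝ ∞ B Ω₁ :=
    hΨ'.clm_apply (contDiffOn_const.prodMk (hdG.clm_apply contDiffOn_const))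
  let Al : ℝ × (F × ℝ) → F →ₗ[ℝ] V := fun p =>
    { toFun := A p
      map_add' := fun w w' => by
        have e : ((w + w', (0 : ℝ)) : F × ℝ) = (w, 0) + (w', 0) := by simp
        change fderiv ℝ Ψ (h p) (w + w', p.1 • fderiv ℝ G p.2 (w + w', 0)) =
          fderiv ℝ Ψ (h p) (w, p.1 • fderiv ℝ G p.2 (w, 0)) +
            fderiv ℝ Ψ (h p) (w', p.1 • fderiv ℝ G p.2 (w', 0))
        rw [← map_add, e, map_add, smul_add, Prod.mk_add_mk]
      map_smul' := fun r w => by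
        have e : ((r • w, (0 : ℝ)) : F × ℝ) = r • (w, 0) := by simp
        change fderiv ℝ Ψ (h p) (r • w, p.1 • fderiv ℝ G p.2 (r • w, 0)) =
          r • fderiv ℝ Ψ (h p) (w, p.1 • fderiv ℝ G p.2 (w, 0))
        rw [e, map_smul, smul_comm p.1 r, ← Prod.smul_mk, map_smul] }
  let Lin : ℝ × (F × ℝ) → (F × F) →L[ℝ] V := fun p =>
    LinearMap.toContinuousLinearMap ((Al p).coprod ((J (Ψ (h p))).comp (Al p)))
  have hLin_apply : ∀ p w w', Lin p (w, w') = A p w + J (Ψ (h p)) (A p w') := fun p w w' => rfl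
  have hLin : ContDiffOn ℝ ∞ Lin Ω₁ := by
    rw [contDiffOn_clm_apply]
    rintro ⟨w, w'⟩
    simp only [hLin_apply]
    refine (hA w).add ?_
    exact hJ.comp ((hΨ.comp hh₁ hmaps).prodMk (hA w')) fun p hp => ⟨hSO (hmaps hp), mem_univ _⟩
  have hA0 : ∀ s w, A (0, (y₀, s)) w = fderiv ℝ Ψ (y₀, 0) (w, 0) := by
    intro s w
    simp [A, h]
  have hh0 : ∀ s, h (0, (y₀, s)) = (y₀, 0) := fun s => by simp [h]
  -- At `ε = 0` the operator is `(w, w') ↦ ι_* w + J ι_* w'`, injective by total reality and hence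
  -- invertible since the dimensions agree. Invertibility is open, which defines `Ω₂`.
  have hinv0 : ∀ s, (Lin (0, (y₀, s))).IsInvertible := by
    intro s
    have hinj : Function.Injective (Lin (0, (y₀, s))) := by
      rw [injective_iff_map_eq_zero]
      rintro ⟨w, w'⟩ hw
      rw [hLin_apply, hA0, hA0, hh0] at hw
      obtain ⟨rfl, rfl⟩ := hreal w w' hw
      rfl
    have hfr : Module.finrank ℝ (F × F) = Module.finrank ℝ V := by
      rw [Module.finrank_prod, hFV, two_mul]
    let e := LinearEquiv.ofInjectiveOfFinrankEq
      (Lin (0, (y₀, s)) : (F × F) →ₗ[ℝ] V) hinj hfr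
    refine ⟨e.toContinuousLinearEquiv, ?_⟩
    exact ContinuousLinearMap.ext fun x => rfl
  set Ω₂ := Ω₁ ∩ Lin ⁻¹' {L | L.IsInvertible} with hΩ₂
  have hΩ₂o : IsOpen Ω₂ :=
    hLin.continuousOn.isOpen_inter_preimage hΩ₁o ContinuousLinearEquiv.isOpen
  have h0Ω₁ : ∀ s, (y₀, s) ∈ Z → ((0 : ℝ), (y₀, s)) ∈ Ω₁ := fun s hs =>
    ⟨hs, by rw [mem_preimage, hh0]; exact h0S⟩
  have h0Ω₂ : ∀ s, (y₀, s) ∈ Z → ((0 : ℝ), (y₀, s)) ∈ Ω₂ := fun s hs => ⟨h0Ω₁ s hs, hinv0 s⟩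
  -- `a` and `b` are the unique solution of `B = A a + J (A b)`.
  let ab : ℝ × (F × ℝ) → F × F := fun p => (Lin p).inverse (B p)
  have hab : ContDiffOn ℝ ∞ ab Ω₂ := by
    intro p hp
    have h1 : ContDiffAt ℝ ∞ (fun p => (Lin p).inverse) p :=
      (ContinuousLinearMap.IsInvertible.contDiffAt_map_inverse hp.2).comp p
        (hLin.contDiffAt (hΩ₁o.mem_nhds hp.1))
    exact (h1.clm_apply (hB.contDiffAt (hΩ₁o.mem_nhds hp.1))).contDiffWithinAt
  have hab_spec : ∀ p ∈ Ω₂, B p = A p (ab p).1 + J (Ψ (h p)) (A p (ab p).2) := by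
    rintro p ⟨-, e, he⟩
    have : Lin p (ab p) = B p := by
      simp only [ab, ← he]
      simp
    rw [← this]
    exact hLin_apply p (ab p).1 (ab p).2
  -- At `ε = 0`, `B` is the fibre derivative of `Ψ` applied to `∂_t G`, which `hfib` identifies with
  -- `J (A (c ∂_t G))`. Hence `a = 0` and `b = c ∂_t G` along the whole fibre over `y₀`.
  have hγ : ∀ s, (y₀, s) ∈ Z → (ab (0, (y₀, s))).2 = c • deriv (fun s => G (y₀, s)) s := by
    intro s hs
    have hd : DifferentiableAt ℝ G (y₀, s) :=
      (hG.contDiffAt (hZ.mem_nhds hs)).differentiableAt (by simp)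
    have e1 : B (0, (y₀, s)) = Lin (0, (y₀, s)) (0, c • deriv (fun s => G (y₀, s)) s) := by
      rw [hLin_apply, hA0, hA0, hh0]
      change fderiv ℝ Ψ (h (0, (y₀, s))) (0, fderiv ℝ G (y₀, s) (0, 1)) = _
      rw [hh0, fderiv_apply_zero_one hd, hfib]
      have e : ((c • deriv (fun s => G (y₀, s)) s, 0) : F × F) =
        c • (deriv (fun s => G (y₀, s)) s, 0) := by simp
      rw [e, map_smul, map_smul]
      simp only [right_eq_add]
      exact (fderiv ℝ Ψ (y₀, 0)).map_zero
    obtain ⟨e, he⟩ := hinv0 s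
    have : ab (0, (y₀, s)) = (0, c • deriv (fun s => G (y₀, s)) s) := by
      simp only [ab, e1, ← he]
      simp
    rw [this]
  have hZs : ∀ᶠ s in 𝓝 t₀, (y₀, s) ∈ Z := by
    have : ContinuousAt (fun s : ℝ => (y₀, s)) t₀ := by fun_prop
    exact this.eventually (hZ.mem_nhds h0Z)
  have hli' : LinearIndependent ℝ ![(ab (0, (y₀, t₀))).2,
      deriv (fun s => (ab (0, (y₀, s))).2) t₀,
        deriv (deriv (fun s => (ab (0, (y₀, s))).2)) t₀] := by
    have E : (fun s => (ab (0, (y₀, s))).2) =ᶠ[𝓝 t₀] fun s => c • deriv (fun s => G (y₀, s)) s :=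
      hZs.mono hγ
    have E2 : deriv (fun s => (ab (0, (y₀, s))).2) =ᶠ[𝓝 t₀]
        fun s => c • deriv (deriv (fun s => G (y₀, s))) s := by
      filter_upwards [E.eventually_nhds] with s hs
      rw [Filter.EventuallyEq.deriv_eq hs, deriv_fun_const_smul_field]
    rw [E.eq_of_nhds, E2.eq_of_nhds, E2.deriv_eq, deriv_fun_const_smul_field]
    convert hli.units_smul (fun _ => Units.mk0 c hc) using 1
    ext1 i
    fin_cases i <;> rfl
  have hfr := eventually_linearIndependent_sliceBracket hΩ₂o hab.fst hab.snd (h0Ω₂ t₀ h0Z) hli'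
  obtain ⟨W, hWsub, hWo, hW0⟩ := eventually_nhds_iff.1 hfr
  refine ⟨Ω₂ ∩ W, hΩ₂o.inter hWo, ⟨h0Ω₂ t₀ h0Z, hW0⟩, fun p => (ab p).1, fun p => (ab p).2,
    hab.fst.mono inter_subset_left, hab.snd.mono inter_subset_left, ?_⟩
  rintro p ⟨hp, hpW⟩
  refine ⟨hp.1.1, hp.1.2, ?_, hWsub p hpW⟩
  have hdG : HasFDerivAt G (fderiv ℝ G p.2) p.2 :=
    ((hG.contDiffAt (hZ.mem_nhds hp.1.1)).differentiableAt (by simp)).hasFDerivAt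
  have hdΨ : HasFDerivAt Ψ (fderiv ℝ Ψ (h p)) (h p) :=
    ((hΨ.contDiffAt (hS.mem_nhds hp.1.2)).differentiableAt (by simp)).hasFDerivAt
  have hslice : HasFDerivAt (fun z : F × ℝ => Ψ (z.1, p.1 • G z))
      ((fderiv ℝ Ψ (h p)).comp ((ContinuousLinearMap.fst ℝ F ℝ).prod (p.1 • fderiv ℝ G p.2))) p.2 :=
    hdΨ.comp p.2 (hasFDerivAt_fst.prodMk (hdG.const_smul p.1))
  have hDw : ∀ w, fderiv ℝ (fun z : F × ℝ => Ψ (z.1, p.1 • G z)) p.2 (w, 0) = A p w := by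
    intro w
    rw [hslice.fderiv]
    rfl
  refine ⟨fun w w' hw => ?_, ?_, ?_⟩
  · simp only [ContinuousLinearMap.coe_coe, hDw] at hw
    obtain ⟨e, he⟩ := hp.2
    have h1 : Lin p (w, w') = 0 := hw
    rw [← he] at h1
    have := e.map_eq_zero_iff.1 h1
    exact Prod.mk_eq_zero.1 this
  · simp only [ContinuousLinearMap.coe_coe, hDw]
    have := hab_spec p hp
    change _ = p.1 • (A p (ab p).1 + J (Ψ (h p)) (A p (ab p).2))
    rw [← this, hslice.fderiv]
    simp only [B]
    rw [← map_smul]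
    simp
  · have := (hWsub p hpW).ne_zero 1
    intro hb
    apply this
    change (ab p).2 = 0 at hb
    change ((ab p).2, (0 : ℝ)) = 0
    rw [hb]
    rfl

end CoRealFrames

/-! ### Additions on a manifold -/

section LocalAddition

variable {E : Type*} [NormedAddCommGroup E] [NormedSpace ℝ E]
  {H : Type*} [TopologicalSpace H] {I : ModelWithCorners ℝ E H}
  {X : Type*} [TopologicalSpace X] [ChartedSpace H X] [IsManifold I ∞ X]

theorem contMDiff_mk_fibre (x : X) :
    ContMDiff 𝓘(ℝ, E) I.tangent ∞ (fun u : E => (⟨x, u⟩ : TangentBundle I X)) := by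
  intro u
  refine contMDiffAt_totalSpace.2 ⟨contMDiffAt_const, ?_⟩
  have h : x ∈ (trivializationAt E (TangentSpace I : X → Type _) x).baseSet :=
    mem_baseSet_trivializationAt E (TangentSpace I : X → Type _) x
  let T : E →L[ℝ] E := (trivializationAt E (TangentSpace I : X → Type _) x).continuousLinearMapAt
    ℝ x
  refine (T.contMDiff u).congr_of_eventuallyEq (Eventually.of_forall fun v => ?_)
  exact ((trivializationAt E (TangentSpace I : X → Type _) x).continuousLinearMapAt_apply_of_mem
    ℝ h v).symm

theorem contMDiff_smul_tangentBundle :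
    ContMDiff (𝓘(ℝ, ℝ).prod I.tangent) I.tangent ∞
      (fun p : ℝ × TangentBundle I X => (⟨p.2.proj, p.1 • p.2.2⟩ : TangentBundle I X)) := by
  intro p
  have hs : ContMDiffAt (𝓘(ℝ, ℝ).prod I.tangent) I.tangent ∞
    (fun p : ℝ × TangentBundle I X => p.2) p := contMDiffAt_snd
  rw [contMDiffAt_totalSpace] at hs ⊢
  refine ⟨hs.1, ?_⟩
  refine (contMDiffAt_fst.smul hs.2).congr_of_eventuallyEq ?_
  have hb : ∀ᶠ q in 𝓝 p, (q.2.proj) ∈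
      (trivializationAt E (TangentSpace I : X → Type _) p.2.proj).baseSet :=
    hs.1.continuousAt.eventually
      ((trivializationAt E (TangentSpace I : X → Type _) p.2.proj).open_baseSet.mem_nhds
        (mem_baseSet_trivializationAt E (TangentSpace I : X → Type _) p.2.proj))
  filter_upwards [hb] with q hq
  exact ((trivializationAt E (TangentSpace I : X → Type _) p.2.proj).linear ℝ hq).2 q.1 q.2.2

/-- A smooth family of self-maps of `X` indexed by tangent vectors, which is the identity for zero
vectors, and which infinitesimally moves `x` in the direction `ρ x • u` for `u ∈ T_xX`. -/
structure IsAddition (I : ModelWithCorners ℝ E H) {X : Type*} [TopologicalSpace X]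
    [ChartedSpace H X] [IsManifold I ∞ X] (R : TangentBundle I X × X → X) (ρ : X → ℝ) : Prop where
  contMDiff : ContMDiff (I.tangent.prod I) I ∞ R
  zero : ∀ x x', R (⟨x, 0⟩, x') = x'
  nonneg : ∀ x, 0 ≤ ρ x
  hasMFDerivAt : ∀ x, HasMFDerivAt 𝓘(ℝ, E) I (fun u : E => R (⟨x, u⟩, x)) 0
    (ρ x • ContinuousLinearMap.id ℝ E : E →L[ℝ] E)

/-- Letting `R (u, ·)` act on all of `X`, not only on the base point of `u`, makes additions
composable. As `R₁ (0, ·)` is the identity, the derivative at `u = 0` is the sum of the two partial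
ones, so the factors `ρ` add; nonnegativity excludes cancellation. -/
theorem IsAddition.comp {R₁ R₂ : TangentBundle I X × X → X} {ρ₁ ρ₂ : X → ℝ}
    (h₁ : IsAddition I R₁ ρ₁) (h₂ : IsAddition I R₂ ρ₂) :
    IsAddition I (fun p => R₁ (p.1, R₂ p)) (ρ₁ + ρ₂) where
  contMDiff := h₁.contMDiff.comp (contMDiff_fst.prodMk h₂.contMDiff)
  zero x x' := by rw [h₂.zero, h₁.zero]
  nonneg x := add_nonneg (h₁.nonneg x) (h₂.nonneg x)
  hasMFDerivAt x := by
    let f : E × X → X := fun p => R₁ (⟨x, p.1⟩, p.2)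
    have hf : ContMDiff (𝓘(ℝ, E).prod I) I ∞ f :=
      h₁.contMDiff.comp (((contMDiff_mk_fibre x).comp contMDiff_fst).prodMk contMDiff_snd)
    have hfx : HasMFDerivAt (𝓘(ℝ, E).prod I) I f ((0 : E), x)
        (ρ₁ x • ContinuousLinearMap.fst ℝ E E + ContinuousLinearMap.snd ℝ E E :
          E × E →L[ℝ] E) := by
      have hd := hf.mdifferentiableAt (x := ((0 : E), x)) (by simp)
      have := hd.hasMFDerivAt
      rw [mfderiv_prod_eq_add_comp hd] at this
      have e1 : mfderiv 𝓘(ℝ, E) I (fun u : E => R₁ (⟨x, u⟩, x)) 0 =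
        (ρ₁ x • ContinuousLinearMap.id ℝ E : E →L[ℝ] E) := (h₁.hasMFDerivAt x).mfderiv
      have e2 : mfderiv I I (fun x' : X => f ((0 : E), x')) x = ContinuousLinearMap.id ℝ E := by
        have : (fun x' : X => f ((0 : E), x')) = id := by
          ext1 x'
          exact h₁.zero x x'
        rw [this]
        exact mfderiv_id
      refine this.congr_mfderiv (ContinuousLinearMap.ext fun v => ?_)
      have e1v := congrArg (fun L : E →L[ℝ] E => L v.1) e1
      have e2v := congrArg (fun L : E →L[ℝ] E => L v.2) e2
      exact congrArg₂ (· + ·) e1v e2v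
    have hg : HasMFDerivAt 𝓘(ℝ, E) (𝓘(ℝ, E).prod I) (fun u : E => (u, R₂ (⟨x, u⟩, x))) 0
        ((ContinuousLinearMap.id ℝ E).prod (ρ₂ x • ContinuousLinearMap.id ℝ E) : E →L[ℝ] E × E) :=
      (hasMFDerivAt_id (0 : E)).prodMk (h₂.hasMFDerivAt x)
    have hfx' : HasMFDerivAt (𝓘(ℝ, E).prod I) I f ((0 : E), R₂ (⟨x, 0⟩, x))
        (ρ₁ x • ContinuousLinearMap.fst ℝ E E + ContinuousLinearMap.snd ℝ E E :
          E × E →L[ℝ] E) := by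
      rw [h₂.zero]
      exact hfx
    have := HasMFDerivAt.comp (0 : E) hfx' hg
    refine HasMFDerivAt.congr_mfderiv this (ContinuousLinearMap.ext fun v => ?_)
    exact (add_smul (ρ₁ x) (ρ₂ x) (v : E)).symm

end LocalAddition

/-! ### Additions from cut-off translations in charts -/

section ChartTranslation

variable {E : Type*} [NormedAddCommGroup E] [InnerProductSpace ℝ E] [FiniteDimensional ℝ E]
  {H : Type*} [TopologicalSpace H] {I : ModelWithCorners ℝ E H} [I.Boundaryless]
  {X : Type*} [TopologicalSpace X] [T2Space X] [ChartedSpace H X] [IsManifold I ∞ X]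

/-- A diffeomorphism of a Euclidean space onto its image, with values in a small ball. -/
def squash (δ : ℝ) (w : E) : E := (δ * (1 + ‖w‖ ^ 2)⁻¹) • w

theorem contDiff_squash (δ : ℝ) : ContDiff ℝ ∞ (squash δ : E → E) := by
  refine ContDiff.smul (contDiff_const.mul (ContDiff.inv ?_ fun w => ?_)) contDiff_id
  · exact contDiff_const.add (contDiff_norm_sq ℝ)
  · positivity

theorem norm_squash_le {δ : ℝ} (hδ : 0 ≤ δ) (w : E) : ‖squash δ w‖ ≤ δ := by
  rw [squash, norm_smul, Real.norm_of_nonneg (by positivity), mul_assoc]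
  refine mul_le_of_le_one_right hδ ?_
  rw [inv_mul_le_iff₀ (by positivity)]
  nlinarith [sq_nonneg (‖w‖ - 1)]

theorem hasFDerivAt_squash (δ : ℝ) :
    HasFDerivAt (squash δ : E → E) (δ • ContinuousLinearMap.id ℝ E) 0 := by
  have h1 : DifferentiableAt ℝ (fun w : E => δ * (1 + ‖w‖ ^ 2)⁻¹) 0 := by
    refine ContDiffAt.differentiableAt (n := ∞) ?_ (by simp)
    refine (contDiff_const.mul (ContDiff.inv ?_ fun w => ?_)).contDiffAt
    · exact contDiff_const.add (contDiff_norm_sq ℝ)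
    · positivity
  have := h1.hasFDerivAt.smul (hasFDerivAt_id (𝕜 := ℝ) (0 : E))
  refine this.congr_fderiv ?_
  ext v
  simp

open Classical in
/-- Translation by `χ x • w` in the chart at `c`. -/
def chartTranslation (I : ModelWithCorners ℝ E H) (c : X) (χ : X → ℝ) (p : E × X) : X :=
  if p.2 ∈ (extChartAt I c).source then (extChartAt I c).symm (extChartAt I c p.2 + χ p.2 • p.1)
  else p.2

/-- The addition translates by `χ • squash δ (Θ u)` in the chart at `c`, extended by the identity.
Only smoothness of `squash`, its bound by `δ` and its derivative at `0` matter; it need not be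
injective. -/
theorem exists_isAddition (c : X) :
    ∃ (R : TangentBundle I X × X → X) (ρ : X → ℝ), IsAddition I R ρ ∧ ∀ᶠ x in 𝓝 c, 0 < ρ x := by
  obtain ⟨χ⟩ := (inferInstance : Nonempty (SmoothBumpFunction I c))
  set κ := extChartAt I c with hκ
  have htar : IsOpen κ.target := isOpen_extChartAt_target c
  have hsrc : IsOpen κ.source := isOpen_extChartAt_source c
  have hball : Metric.closedBall (κ c) χ.rOut ⊆ κ.target := by
    have := χ.closedBall_subset
    rwa [I.range_eq_univ, inter_univ] at this
  -- The support of `χ` lies in a compact ball inside the chart target; `δ` is a margin by which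
  -- this ball can be thickened without leaving the target, so translations of length at most `δ`
  -- stay in the chart.
  obtain ⟨δ, hδ, hδt⟩ :=
    (isCompact_closedBall (κ c) χ.rOut).exists_cthickening_subset_open htar hball
  have hmem : ∀ x ∈ κ.source, ∀ w, κ x + χ x • squash δ w ∈ κ.target := by
    intro x hx w
    by_cases hχ : χ x = 0
    · rw [hχ, zero_smul, add_zero]
      exact κ.map_source hx
    · have hxs : x ∈ Function.support χ := hχ
      rw [χ.support_eq_inter_preimage] at hxs
      refine hδt (Metric.mem_cthickening_of_dist_le _ (κ x) δ _
        (Metric.ball_subset_closedBall hxs.2) ?_)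
      rw [dist_eq_norm, add_sub_cancel_left, norm_smul, Real.norm_of_nonneg χ.nonneg]
      calc χ x * ‖squash δ w‖ ≤ 1 * δ :=
            mul_le_mul χ.le_one (norm_squash_le hδ.le w) (norm_nonneg _) zero_le_one
        _ = δ := one_mul δ
  let S : E × X → X := fun p => chartTranslation I c χ (squash δ p.1, p.2)
  have hS_source : ∀ w, ∀ x ∈ κ.source, S (w, x) = κ.symm (κ x + χ x • squash δ w) := by
    intro w x hx
    simp only [S, chartTranslation]
    rw [if_pos hx]
  have hS_zero : ∀ w, ∀ x, χ x = 0 → S (w, x) = x := by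
    intro w x hχ
    by_cases hx : x ∈ κ.source
    · rw [hS_source w x hx, hχ, zero_smul, add_zero, κ.left_inv hx]
    · simp only [S, chartTranslation]
      rw [if_neg hx]
  have hS : ContMDiff (𝓘(ℝ, E).prod I) I ∞ S := by
    refine contMDiff_of_contMDiffOn_union_of_isOpen (s := Prod.snd ⁻¹' κ.source)
      (t := Prod.snd ⁻¹' (tsupport χ)ᶜ) ?_ ?_ ?_ (hsrc.preimage continuous_snd)
      ((isClosed_tsupport χ).isOpen_compl.preimage continuous_snd)
    · refine ContMDiffOn.congr (f := fun p : E × X => κ.symm (κ p.2 + χ p.2 • squash δ p.1)) ?_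
        fun p hp => hS_source p.1 p.2 hp
      refine (contMDiffOn_extChartAt_symm c).comp (t := κ.target) ?_ fun p hp => hmem p.2 hp p.1
      have h1 : ContMDiffOn (𝓘(ℝ, E).prod I) 𝓘(ℝ, E) ∞ (fun p : E × X => κ p.2)
          (Prod.snd ⁻¹' κ.source) := by
        refine (contMDiffOn_extChartAt (I := I) (x := c)).comp contMDiffOn_snd fun p hp => ?_
        rw [← extChartAt_source I]
        exact hp
      exact h1.add (((χ.contMDiff.comp contMDiff_snd).smul
        ((contDiff_squash δ).contMDiff.comp contMDiff_fst)).contMDiffOn)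
    · refine contMDiffOn_snd.congr fun p hp => ?_
      exact hS_zero p.1 p.2 (image_eq_zero_of_notMem_tsupport hp)
    · rw [← preimage_union, eq_univ_iff_forall]
      intro p
      by_cases hp : p.2 ∈ tsupport χ
      · exact Or.inl (χ.tsupport_subset_extChartAt_source hp)
      · exact Or.inr hp
  let e := trivializationAt E (TangentSpace I : X → Type _) c
  have hbase : e.baseSet = κ.source := by
    rw [hκ, extChartAt_source]
    rfl
  -- Cutting off the fibre coordinate makes it globally smooth on `TX`. This is one factor `χ`, the
  -- translation contributes the other, whence `ρ = δ χ²`.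
  let Θ : TangentBundle I X → E := fun u => χ u.proj • (e u).2
  have hproj : ContMDiff I.tangent I ∞ (fun u : TangentBundle I X => u.proj) :=
    contMDiff_proj (TangentSpace I : X → Type _)
  have hΘ : ContMDiff I.tangent 𝓘(ℝ, E) ∞ Θ := by
    refine contMDiff_of_contMDiffOn_union_of_isOpen
      (s := (fun u : TangentBundle I X => u.proj) ⁻¹' κ.source)
      (t := (fun u : TangentBundle I X => u.proj) ⁻¹' (tsupport χ)ᶜ) ?_ ?_ ?_
      (hsrc.preimage hproj.continuous)
        ((isClosed_tsupport χ).isOpen_compl.preimage hproj.continuous)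
    · refine (χ.contMDiff.comp hproj).contMDiffOn.smul ?_
      have := (Trivialization.contMDiffOn (IB := I) (n := ∞) e)
      refine ContMDiffOn.mono ?_ (show _ ⊆ e.source from fun u hu => ?_)
      · exact contMDiff_snd.comp_contMDiffOn this
      · rw [e.mem_source, hbase]
        exact hu
    · refine (contMDiffOn_const (c := (0 : E))).congr fun u hu => ?_
      have : χ u.proj = 0 := image_eq_zero_of_notMem_tsupport hu
      simp [Θ, this]
    · rw [← preimage_union, eq_univ_iff_forall]
      intro p
      by_cases hp : p.proj ∈ tsupport χ
      · exact Or.inl (χ.tsupport_subset_extChartAt_source hp)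
      · exact Or.inr hp
  refine ⟨fun p => S (Θ p.1, p.2), fun x => δ * χ x ^ 2, ⟨?_, ?_, ?_, ?_⟩, ?_⟩
  · exact hS.comp ((hΘ.comp contMDiff_fst).prodMk contMDiff_snd)
  · intro x x'
    have hΘ0 : Θ ⟨x, 0⟩ = 0 := by
      by_cases hx : χ x = 0
      · simp [Θ, hx]
      · have hx' : x ∈ e.baseSet := by
          rw [hbase]
          exact χ.tsupport_subset_extChartAt_source (subset_closure hx)
        simp only [Θ]
        have : (e (⟨x, 0⟩ : TangentBundle I X)).2 = 0 := (e.linear ℝ hx').map_zero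
        rw [this, smul_zero]
    change S (Θ ⟨x, 0⟩, x') = x'
    rw [hΘ0]
    by_cases hx' : x' ∈ κ.source
    · rw [hS_source _ _ hx']
      simp [squash, κ.left_inv hx']
    · exact hS_zero _ _ (by
        by_contra h
        exact hx' (χ.tsupport_subset_extChartAt_source (subset_closure h)))
  · intro x
    have := hδ.le
    positivity
  · intro x
    by_cases hx : x ∈ κ.source
    swap
    · have hχ : χ x = 0 := by
        by_contra h
        exact hx (χ.tsupport_subset_extChartAt_source (subset_closure h))
      have h0 : (fun u : E => S (Θ ⟨x, u⟩, x)) = fun _ => x := by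
        ext1 u
        exact hS_zero _ _ hχ
      rw [hχ]
      change HasMFDerivAt 𝓘(ℝ, E) I (fun u : E => S (Θ ⟨x, u⟩, x)) 0 _
      rw [h0]
      refine HasMFDerivAt.congr_mfderiv (hasMFDerivAt_const x (0 : E))
        (ContinuousLinearMap.ext fun v => ?_)
      have h2 : δ * (0 : ℝ) ^ 2 = 0 := by ring
      rw [h2]
      exact (zero_smul ℝ (v : E)).symm
    · have hxe : x ∈ e.baseSet := by rwa [hbase]
      let T : E →L[ℝ] E := e.continuousLinearMapAt ℝ x
      have hxc : x ∈ (chartAt H c).source := by rwa [← extChartAt_source I]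
      -- The fibre coordinate is the derivative of `κ`, so the derivative of the composite is
      -- `(Dκ)⁻¹ ∘ (δ χ² Dκ)`, a scalar on the tangent space independently of the chart.
      have hT : T = mfderiv I 𝓘(ℝ, E) κ x :=
        TangentBundle.continuousLinearMapAt_trivializationAt hxc
      have hΘx : ∀ u : E, Θ ⟨x, u⟩ = χ x • T u := by
        intro u
        simp only [Θ, T]
        congr 1
        exact (e.continuousLinearMapAt_apply_of_mem ℝ hxe u).symm
      have hfun : (fun u : E => S (Θ ⟨x, u⟩, x)) =
          κ.symm ∘ fun u : E => κ x + χ x • squash δ (χ x • T u) := by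
        ext1 u
        rw [hΘx, hS_source _ _ hx]
        rfl
      change HasMFDerivAt 𝓘(ℝ, E) I (fun u : E => S (Θ ⟨x, u⟩, x)) 0 _
      rw [hfun]
      have hin : HasFDerivAt (fun u : E => κ x + χ x • squash δ (χ x • T u))
          ((δ * χ x ^ 2) • T) 0 := by
        have h1 : HasFDerivAt (fun u : E => χ x • T u) (χ x • T) 0 :=
          T.hasFDerivAt.const_smul (χ x)
        have h2 : HasFDerivAt (squash δ : E → E) (δ • ContinuousLinearMap.id ℝ E)
            (χ x • T 0) := by
          rw [map_zero, smul_zero]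
          exact hasFDerivAt_squash δ
        have h3 := ((h2.comp (0 : E) h1).const_smul (χ x)).const_add (κ x)
        refine h3.congr_fderiv (ContinuousLinearMap.ext fun v => ?_)
        change χ x • δ • χ x • T v = (δ * χ x ^ 2) • T v
        module
      have hval : κ x + χ x • squash δ (χ x • T 0) = κ x := by simp [squash]
      have hout : HasMFDerivAt 𝓘(ℝ, E) I κ.symm (κ x + χ x • squash δ (χ x • T 0))
          (mfderiv 𝓘(ℝ, E) I κ.symm (κ x)) := by
        rw [hval]
        refine MDifferentiableAt.hasMFDerivAt ?_
        exact ((contMDiffOn_extChartAt_symm (n := ∞) c).contMDiffAt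
          (htar.mem_nhds (κ.map_source hx))).mdifferentiableAt (by simp)
      have hcomp := HasMFDerivAt.comp (0 : E) hout hin.hasMFDerivAt
      refine HasMFDerivAt.congr_mfderiv hcomp (ContinuousLinearMap.ext fun v => ?_)
      have hid := mfderivWithin_extChartAt_symm_comp_mfderiv_extChartAt' (I := I) (x := c) (y := x)
        hx
      rw [I.range_eq_univ, mfderivWithin_univ] at hid
      let D : E →L[ℝ] E := mfderiv 𝓘(ℝ, E) I κ.symm (κ x)
      have hDT : ∀ w : E, D (T w) = w := by
        intro w
        rw [hT]
        exact congrArg (fun L : E →L[ℝ] E => L w) hid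
      exact (D.map_smul (δ * χ x ^ 2) (T v)).trans
        (congrArg (fun w : E => (δ * χ x ^ 2) • w) (hDT v))
  · filter_upwards [χ.eventuallyEq_one] with x hx
    rw [hx]
    simpa using hδ

/-- Every compact set has an addition which is nondegenerate over it. -/
theorem exists_isAddition_of_isCompact {K : Set X} (hK : IsCompact K) :
    ∃ (R : TangentBundle I X × X → X) (ρ : X → ℝ), IsAddition I R ρ ∧ ∀ x ∈ K, 0 < ρ x := by
  refine hK.induction_on (p := fun K => ∃ (R : TangentBundle I X × X → X) (ρ : X → ℝ),
    IsAddition I R ρ ∧ ∀ x ∈ K, 0 < ρ x) ?_ ?_ ?_ ?_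
  · refine ⟨fun p => p.2, 0, ⟨contMDiff_snd, fun _ _ => rfl, fun _ => le_rfl, fun x => ?_⟩, by simp⟩
    refine HasMFDerivAt.congr_mfderiv (hasMFDerivAt_const x (0 : E))
      (ContinuousLinearMap.ext fun v => ?_)
    exact (zero_smul ℝ (v : E)).symm
  · rintro s t hst ⟨R, ρ, h, hρ⟩
    exact ⟨R, ρ, h, fun x hx => hρ x (hst hx)⟩
  · rintro s t ⟨R₁, ρ₁, h₁, hρ₁⟩ ⟨R₂, ρ₂, h₂, hρ₂⟩
    refine ⟨_, _, h₁.comp h₂, ?_⟩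
    rintro x (hx | hx)
    · exact add_pos_of_pos_of_nonneg (hρ₁ x hx) (h₂.nonneg x)
    · exact add_pos_of_nonneg_of_pos (h₁.nonneg x) (hρ₂ x hx)
  · intro x _
    obtain ⟨R, ρ, h, hρ⟩ := exists_isAddition (I := I) x
    exact ⟨_, mem_nhdsWithin_of_mem_nhds hρ, R, ρ, h, fun y hy => hy⟩

end ChartTranslation

/-! ### Transporting Engel frames through coordinates -/

section PullbackFrame

open VectorField

variable {E : Type*} [NormedAddCommGroup E] [NormedSpace ℝ E] [FiniteDimensional ℝ E]
  {H : Type*} [TopologicalSpace H] {I : ModelWithCorners ℝ E H}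
  {N : Type*} [TopologicalSpace N] [ChartedSpace H N] [IsManifold I ∞ N]
  {P : Type*} [NormedAddCommGroup P] [NormedSpace ℝ P] [FiniteDimensional ℝ P]

theorem contDiffOn_lieBracket {Y : Set P} (hY : IsOpen Y) {W₁ W₂ : P → P}
    (h₁ : ContDiffOn ℝ ∞ W₁ Y) (h₂ : ContDiffOn ℝ ∞ W₂ Y) :
    ContDiffOn ℝ ∞ (lieBracket ℝ W₁ W₂) Y :=
  ((h₂.fderiv_of_isOpen hY (by simp)).clm_apply h₁).sub
    ((h₁.fderiv_of_isOpen hY (by simp)).clm_apply h₂)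

theorem contMDiffAt_mpullback {ψ : N → P} {q : N} (hψ : ContMDiffAt I 𝓘(ℝ, P) ∞ ψ q)
    (hinv : (mfderiv I 𝓘(ℝ, P) ψ q).IsInvertible) {W : P → P} (hW : ContDiffAt ℝ ∞ W (ψ q)) :
    ContMDiffAt I I.tangent ∞
      (fun x => (⟨x, mpullback I 𝓘(ℝ, P) ψ W x⟩ : TangentBundle I N)) q := by
  refine ContMDiffAt.mpullback_vectorField_preimage (n := ∞) ?_ hψ hinv (by simp)
  exact contMDiffAt_vectorSpace_iff_contDiffAt.2 hW

theorem mlieBracket_mpullback {ψ : N → P} {q : N} (hψ : ContMDiffAt I 𝓘(ℝ, P) ∞ ψ q)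
    {W₁ W₂ : P → P} (h₁ : ContDiffAt ℝ ∞ W₁ (ψ q)) (h₂ : ContDiffAt ℝ ∞ W₂ (ψ q)) :
    mlieBracket I (mpullback I 𝓘(ℝ, P) ψ W₁) (mpullback I 𝓘(ℝ, P) ψ W₂) q =
      mpullback I 𝓘(ℝ, P) ψ (lieBracket ℝ W₁ W₂) q := by
  have : IsManifold I (minSmoothness ℝ 2) N := by
    rw [minSmoothness_of_isRCLikeNormedField]
    exact IsManifold.of_le (n := ∞) ENat.LEInfty.out
  rw [← mpullback_mlieBracket (n := ∞)
    ((contMDiffAt_vectorSpace_iff_contDiffAt.2 h₁).mdifferentiableAt (by simp))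
    ((contMDiffAt_vectorSpace_iff_contDiffAt.2 h₂).mdifferentiableAt (by simp)) hψ
    (by rw [minSmoothness_of_isRCLikeNormedField]; exact ENat.LEInfty.out)]
  have h : ∀ V₁ V₂ : (∀ x : P, TangentSpace 𝓘(ℝ, P) x),
      mlieBracket 𝓘(ℝ, P) V₁ V₂ = lieBracket ℝ V₁ V₂ := by
    intro V₁ V₂
    rw [← mlieBracketWithin_univ, mlieBracketWithin_eq_lieBracketWithin]
    exact lieBracketWithin_univ
  exact congrArg (fun V => mpullback I 𝓘(ℝ, P) ψ V q) (h W₁ W₂)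

/-- Pulling back an Engel frame of a vector space by local coordinates. -/
theorem isEngelFrameAt_mpullback {D : ∀ x : N, Submodule ℝ (TangentSpace I x)} {ψ : N → P}
    {U : Set N} (hU : IsOpen U) (hψ : ContMDiffOn I 𝓘(ℝ, P) ∞ ψ U)
    (hinv : ∀ q ∈ U, (mfderiv I 𝓘(ℝ, P) ψ q).IsInvertible)
    {Y : Set P} (hY : IsOpen Y) {W₁ W₂ : P → P}
    (h₁ : ContDiffOn ℝ ∞ W₁ Y) (h₂ : ContDiffOn ℝ ∞ W₂ Y) (hUY : MapsTo ψ U Y)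
    (hD : ∀ q ∈ U, mpullback I 𝓘(ℝ, P) ψ W₁ q ∈ D q ∧ mpullback I 𝓘(ℝ, P) ψ W₂ q ∈ D q)
    {q : N} (hq : q ∈ U)
    (hli : LinearIndependent ℝ ![W₁ (ψ q), W₂ (ψ q), lieBracket ℝ W₁ W₂ (ψ q),
      lieBracket ℝ W₁ (lieBracket ℝ W₁ W₂) (ψ q)]) :
    IsEngelFrameAt D (mpullback I 𝓘(ℝ, P) ψ W₁) (mpullback I 𝓘(ℝ, P) ψ W₂) q := by
  have h₃ := contDiffOn_lieBracket hY h₁ h₂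
  have hψat : ∀ x ∈ U, ContMDiffAt I 𝓘(ℝ, P) ∞ ψ x := fun x hx => hψ.contMDiffAt (hU.mem_nhds hx)
  have hWat : ∀ {W : P → P}, ContDiffOn ℝ ∞ W Y → ∀ x ∈ U, ContDiffAt ℝ ∞ W (ψ x) :=
    fun hW x hx => hW.contDiffAt (hY.mem_nhds (hUY hx))
  refine ⟨⟨U, hU.mem_nhds hq, fun x hx => ?_, fun x hx => ?_, hD⟩, ?_⟩
  · exact (contMDiffAt_mpullback (hψat x hx) (hinv x hx) (hWat h₁ x hx)).contMDiffWithinAt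
  · exact (contMDiffAt_mpullback (hψat x hx) (hinv x hx) (hWat h₂ x hx)).contMDiffWithinAt
  · have e₃ : mlieBracket I (mpullback I 𝓘(ℝ, P) ψ W₁) (mpullback I 𝓘(ℝ, P) ψ W₂) =ᶠ[𝓝 q]
        mpullback I 𝓘(ℝ, P) ψ (lieBracket ℝ W₁ W₂) := by
      filter_upwards [hU.mem_nhds hq] with x hx
      exact mlieBracket_mpullback (hψat x hx) (hWat h₁ x hx) (hWat h₂ x hx)
    rw [(EventuallyEq.refl _ _).mlieBracket_vectorField_eq e₃, e₃.eq_of_nhds,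
      mlieBracket_mpullback (hψat q hq) (hWat h₁ q hq) (hWat h₃ q hq)]
    obtain ⟨e, he⟩ := hinv q hq
    have hpb : ∀ W : P → P, mpullback I 𝓘(ℝ, P) ψ W q = e.symm (W (ψ q)) := by
      intro W
      change (mfderiv I 𝓘(ℝ, P) ψ q).inverse (W (ψ q)) = _
      rw [← he, ContinuousLinearMap.inverse_equiv]
      rfl
    simp only [hpb]
    let e' : P ≃ₗ[ℝ] TangentSpace I q := e.symm.toLinearEquiv
    have := hli.map' e'.toLinearMap e'.ker
    have hcomp : e'.toLinearMap ∘ ![W₁ (ψ q), W₂ (ψ q), lieBracket ℝ W₁ W₂ (ψ q),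
        lieBracket ℝ W₁ (lieBracket ℝ W₁ W₂) (ψ q)] = ![e' (W₁ (ψ q)), e' (W₂ (ψ q)),
        e' (lieBracket ℝ W₁ W₂ (ψ q)), e' (lieBracket ℝ W₁ (lieBracket ℝ W₁ W₂) (ψ q))] := by
      ext1 i
      fin_cases i <;> rfl
    rw [hcomp] at this
    exact this

end PullbackFrame

/-! ### Topology of the total space -/

section CircleBundleTopology

variable {M : Type*} [TopologicalSpace M] [ChartedSpace (EuclideanSpace ℝ (Fin 3)) M]
  {N : Type*} [TopologicalSpace N] [ChartedSpace (EuclideanSpace ℝ (Fin 4)) N] {pr : N → M}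

theorem OrientedCircleBundle.exists_mem_source (B : OrientedCircleBundle pr) (q : N) :
    ∃ e ∈ B.atlas, q ∈ e.source ∧ pr q ∈ e.baseSet := by
  obtain ⟨e, he, hq⟩ := B.covers (pr q)
  exact ⟨e, he, e.mem_source.2 hq, hq⟩

theorem OrientedCircleBundle.continuous (B : OrientedCircleBundle pr) : Continuous pr := by
  rw [continuous_iff_continuousAt]
  intro q
  obtain ⟨e, -, hq, -⟩ := B.exists_mem_source q
  exact e.continuousAt_proj hq

/-- Points in different fibres are separated by `pr`, points of one fibre by a local trivialisation.
-/
theorem OrientedCircleBundle.t2Space [T2Space M] (B : OrientedCircleBundle pr) : T2Space N := by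
  rw [t2Space_iff_disjoint_nhds]
  intro q q' hne
  by_cases h : pr q = pr q'
  · obtain ⟨e, -, hq, hb⟩ := B.exists_mem_source q
    have hq' : q' ∈ e.source := e.mem_source.2 (h ▸ hb)
    have hne' : e q ≠ e q' := fun he => hne (e.injOn hq hq' he)
    have h1 := e.toOpenPartialHomeomorph.continuousOn.continuousAt (e.open_source.mem_nhds hq)
    have h2 := e.toOpenPartialHomeomorph.continuousOn.continuousAt (e.open_source.mem_nhds hq')
    exact h1.disjoint (disjoint_nhds_nhds.2 hne') h2
  · exact B.continuous.continuousAt.disjoint (disjoint_nhds_nhds.2 h) B.continuous.continuousAt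

/-- An ultrafilter on `N` has a limit `p` after projection to `M`, and its circle coordinate in a
trivialisation around `p` has a limit `z`; it therefore converges to the point with coordinates `(p,
z)`. -/
theorem OrientedCircleBundle.compactSpace [CompactSpace M] (B : OrientedCircleBundle pr) :
    CompactSpace N := by
  refine ⟨isCompact_iff_ultrafilter_le_nhds.2 fun f _ => ?_⟩
  obtain ⟨p, -, hp⟩ := isCompact_univ.ultrafilter_le_nhds (f.map pr) (by simp)
  obtain ⟨e, -, hb⟩ := B.covers p
  obtain ⟨z, -, hz⟩ := isCompact_univ.ultrafilter_le_nhds (f.map fun q => (e q).2) (by simp)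
  refine ⟨e.toOpenPartialHomeomorph.symm (p, z), mem_univ _, ?_⟩
  have hsrc : ∀ᶠ q in (f : Filter N), q ∈ e.source := by
    have : ∀ᶠ q in (f : Filter N), pr q ∈ e.baseSet := hp (e.open_baseSet.mem_nhds hb)
    filter_upwards [this] with q hq using e.mem_source.2 hq
  have ht : Tendsto (fun q => (pr q, (e q).2)) (f : Filter N) (𝓝 (p, z)) := by
    rw [nhds_prod_eq]
    exact Tendsto.prodMk hp hz
  have hc : ContinuousAt e.toOpenPartialHomeomorph.symm (p, z) :=
    e.toOpenPartialHomeomorph.continuousAt_symm (e.mem_target.2 hb)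
  have := hc.tendsto.comp ht
  refine (tendsto_id'.1 ((this.congr' ?_)))
  filter_upwards [hsrc] with q hq
  exact e.symm_apply_mk_proj hq

end CircleBundleTopology

/-! ### Chart-and-angle coordinates on the circle bundle -/

section CircleBundleCoordinates

variable {M : Type*} [TopologicalSpace M] [ChartedSpace (EuclideanSpace ℝ (Fin 3)) M]
  [IsManifold (𝓡 3) ∞ M]
  {N : Type*} [TopologicalSpace N] [ChartedSpace (EuclideanSpace ℝ (Fin 4)) N]
  [IsManifold (𝓡 4) ∞ N] {pr : N → M}

/-- The parametrisation of a circle bundle by a chart of the base and an angle. -/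
def bundleParam (e : Trivialization Circle pr) (p₀ : M) (z : EuclideanSpace ℝ (Fin 3) × ℝ) : N :=
  e.toOpenPartialHomeomorph.symm ((extChartAt (𝓡 3) p₀).symm z.1, Circle.exp z.2)

/-- The domain of `bundleParam`. -/
def bundleParamDomain (e : Trivialization Circle pr) (p₀ : M) :
    Set (EuclideanSpace ℝ (Fin 3) × ℝ) :=
  ((extChartAt (𝓡 3) p₀).target ∩ (extChartAt (𝓡 3) p₀).symm ⁻¹' e.baseSet) ×ˢ univ

theorem isOpen_bundleParamDomain (e : Trivialization Circle pr) (p₀ : M) :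
    IsOpen (bundleParamDomain e p₀) :=
  ((continuousOn_extChartAt_symm p₀).isOpen_inter_preimage (isOpen_extChartAt_target p₀)
    e.open_baseSet).prod isOpen_univ

theorem pr_bundleParam {e : Trivialization Circle pr} {p₀ : M} {z : EuclideanSpace ℝ (Fin 3) × ℝ}
    (hz : z ∈ bundleParamDomain e p₀) :
    pr (bundleParam e p₀ z) = (extChartAt (𝓡 3) p₀).symm z.1 :=
  e.proj_symm_apply (e.mem_target.2 hz.1.2)

theorem OrientedCircleBundle.contMDiffOn_bundleParam (B : OrientedCircleBundle pr)
    {e : Trivialization Circle pr} (he : e ∈ B.atlas) (p₀ : M) :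
    ContMDiffOn 𝓘(ℝ, EuclideanSpace ℝ (Fin 3) × ℝ) (𝓡 4) ∞ (bundleParam e p₀)
      (bundleParamDomain e p₀) := by
  refine (B.smooth_symm e he).comp (t := e.target) (ContMDiffOn.prodMk ?_ ?_) fun z hz =>
    e.mem_target.2 hz.1.2
  · exact (contMDiffOn_extChartAt_symm p₀).comp contDiff_fst.contMDiff.contMDiffOn
      fun z hz => hz.1.1
  · exact (contMDiff_circleExp.comp contDiff_snd.contMDiff).contMDiffOn

/-- The angle relative to `w` is the imaginary part of the principal logarithm of `z / w`, smooth
away from the antipode of `w`. -/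
theorem contMDiffAt_circle_log {w z : Circle} (h : ((z / w : Circle) : ℂ) ∈ Complex.slitPlane) :
    ContMDiffAt (𝓡 1) 𝓘(ℝ, ℝ) ∞ (fun z : Circle => (Complex.log ((z / w : Circle) : ℂ)).im) z := by
  have : Fact (Module.finrank ℝ ℂ = 1 + 1) := ⟨Complex.finrank_real_complex⟩
  have h1 : ContMDiff (𝓡 1) 𝓘(ℝ, ℂ) ∞ (fun z : Circle => (z : ℂ)) := contMDiff_coe_sphere
  have h2 : ContMDiff (𝓡 1) (𝓡 1) ∞ (fun z : Circle => z / w) := contMDiff_id.div contMDiff_const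
  have h3 : ContDiffAt ℝ ∞ Complex.log ((z / w : Circle) : ℂ) :=
    (Complex.contDiffAt_log h).restrict_scalars ℝ
  have h4 : ContDiffAt ℝ ∞ (fun c : ℂ => (Complex.log c).im) ((z / w : Circle) : ℂ) :=
    Complex.imCLM.contDiff.contDiffAt.comp _ h3
  exact ContMDiffAt.comp z (g := fun c : ℂ => (Complex.log c).im) h4.contMDiffAt (h1.comp h2 z)

/-- Local coordinates inverse to `bundleParam`. -/
theorem OrientedCircleBundle.exists_coordinates (B : OrientedCircleBundle pr) (q₀ : N) :
    ∃ e ∈ B.atlas, ∃ t₀ : ℝ, pr q₀ ∈ e.baseSet ∧ ∃ U : Set N, IsOpen U ∧ q₀ ∈ U ∧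
      ∃ ψ : N → EuclideanSpace ℝ (Fin 3) × ℝ,
        ContMDiffOn (𝓡 4) 𝓘(ℝ, EuclideanSpace ℝ (Fin 3) × ℝ) ∞ ψ U ∧
        ψ q₀ = (extChartAt (𝓡 3) (pr q₀) (pr q₀), t₀) ∧
        MapsTo ψ U (bundleParamDomain e (pr q₀)) ∧
        (∀ q ∈ U, bundleParam e (pr q₀) (ψ q) = q) ∧
        ∀ q ∈ U, (mfderiv (𝓡 4) 𝓘(ℝ, EuclideanSpace ℝ (Fin 3) × ℝ) ψ q).IsInvertible := by
  obtain ⟨e, he, hqs, hqb⟩ := B.exists_mem_source q₀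
  set p₀ := pr q₀ with hp₀
  set κ := extChartAt (𝓡 3) p₀ with hκ
  obtain ⟨t₀, ht₀⟩ : ∃ t₀ : ℝ, Circle.exp t₀ = (e q₀).2 := ⟨_, Circle.exp_arg _⟩
  -- The branch of the angle is centred at `t₀`, the angle of `q₀`, so `q₀` avoids the cut; `U`
  -- below removes the points whose angle lies on it.
  let ψ : N → EuclideanSpace ℝ (Fin 3) × ℝ := fun q =>
    (κ (pr q), t₀ + (Complex.log (((e q).2 / Circle.exp t₀ : Circle) : ℂ)).im)
  let U₁ : Set N := e.source ∩ pr ⁻¹' κ.source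
  have hU₁ : IsOpen U₁ :=
    e.open_source.inter ((isOpen_extChartAt_source p₀).preimage B.continuous)
  have hlogc : Continuous fun z : Circle => ((z / Circle.exp t₀ : Circle) : ℂ) :=
    continuous_subtype_val.comp (continuous_id.div_const _)
  have hec : ContinuousOn (fun q => (((e q).2 / Circle.exp t₀ : Circle) : ℂ)) U₁ :=
    hlogc.comp_continuousOn (continuous_snd.comp_continuousOn
      (e.toOpenPartialHomeomorph.continuousOn.mono inter_subset_left))
  let U : Set N := U₁ ∩ (fun q => (((e q).2 / Circle.exp t₀ : Circle) : ℂ)) ⁻¹' Complex.slitPlane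
  have hU : IsOpen U := hec.isOpen_inter_preimage hU₁ Complex.isOpen_slitPlane
  have hdiv : (e q₀).2 / Circle.exp t₀ = 1 := by rw [ht₀, div_self']
  have hψU : ContMDiffOn (𝓡 4) 𝓘(ℝ, EuclideanSpace ℝ (Fin 3) × ℝ) ∞ ψ U := by
    have hsm : ContMDiffOn (𝓡 4) ((𝓡 3).prod (𝓡 1)) ∞ e U :=
      (B.smooth e he).mono fun q hq => hq.1.1
    have hpr : ContMDiffOn (𝓡 4) (𝓡 3) ∞ pr U :=
      (contMDiff_fst.comp_contMDiffOn hsm).congr fun q hq => (e.coe_fst hq.1.1).symm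
    refine ContMDiffOn.prodMk_space ?_ ?_
    · refine (contMDiffOn_extChartAt (I := 𝓡 3) (x := p₀)).comp hpr fun q hq => ?_
      rw [← extChartAt_source (𝓡 3)]
      exact hq.1.2
    · refine contMDiffOn_const.add fun q hq => ?_
      exact ContMDiffAt.comp_contMDiffWithinAt
        (g := fun z : Circle => (Complex.log ((z / Circle.exp t₀ : Circle) : ℂ)).im) q
        (contMDiffAt_circle_log hq.2) (contMDiff_snd.comp_contMDiffOn hsm q hq)
  have hmaps : MapsTo ψ U (bundleParamDomain e p₀) := by
    intro q hq
    refine ⟨⟨κ.map_source hq.1.2, ?_⟩, mem_univ _⟩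
    change κ.symm (κ (pr q)) ∈ e.baseSet
    rw [κ.left_inv hq.1.2]
    exact e.mem_source.1 hq.1.1
  have hleft : ∀ q ∈ U, bundleParam e p₀ (ψ q) = q := by
    intro q hq
    have h1 : κ.symm (κ (pr q)) = pr q := κ.left_inv hq.1.2
    have h2 : Circle.exp (t₀ + (Complex.log (((e q).2 / Circle.exp t₀ : Circle) : ℂ)).im) =
        (e q).2 := by
      rw [Circle.exp_add, Complex.log_im, Circle.exp_arg, mul_div_cancel]
    simp only [bundleParam, ψ]
    rw [h1, h2]
    exact e.symm_apply_mk_proj hq.1.1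
  refine ⟨e, he, t₀, hqb, U, hU, ⟨⟨hqs, mem_extChartAt_source p₀⟩, ?_⟩, ψ, hψU, ?_, hmaps, hleft,
    fun q hq => ?_⟩
  · simp only [mem_preimage]
    rw [hdiv]
    simp
  · simp only [ψ]
    rw [hdiv]
    simp
    rfl
  · have hψq : MDifferentiableAt (𝓡 4) 𝓘(ℝ, EuclideanSpace ℝ (Fin 3) × ℝ) ψ q :=
      (hψU.contMDiffAt (hU.mem_nhds hq)).mdifferentiableAt (by simp)
    have hφq : MDifferentiableAt 𝓘(ℝ, EuclideanSpace ℝ (Fin 3) × ℝ) (𝓡 4) (bundleParam e p₀)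
        (ψ q) :=
      ((B.contMDiffOn_bundleParam he p₀).contMDiffAt
        ((isOpen_bundleParamDomain e p₀).mem_nhds (hmaps hq))).mdifferentiableAt (by simp)
    have hcomp := hφq.hasMFDerivAt.comp q hψq.hasMFDerivAt
    have hid : HasMFDerivAt (𝓡 4) (𝓡 4) (bundleParam e p₀ ∘ ψ) q
        (ContinuousLinearMap.id ℝ (EuclideanSpace ℝ (Fin 4))) := by
      refine (hasMFDerivAt_id q).congr_of_eventuallyEq ?_
      filter_upwards [hU.mem_nhds hq] with x hx using hleft x hx
    have hEq := hasMFDerivAt_unique hcomp hid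
    let A : EuclideanSpace ℝ (Fin 4) →L[ℝ] EuclideanSpace ℝ (Fin 3) × ℝ :=
      mfderiv (𝓡 4) 𝓘(ℝ, EuclideanSpace ℝ (Fin 3) × ℝ) ψ q
    let C : EuclideanSpace ℝ (Fin 3) × ℝ →L[ℝ] EuclideanSpace ℝ (Fin 4) :=
      mfderiv 𝓘(ℝ, EuclideanSpace ℝ (Fin 3) × ℝ) (𝓡 4) (bundleParam e p₀) (ψ q)
    -- Differentiating `bundleParam ∘ ψ = id` gives a left inverse of the derivative of `ψ`, and
    -- both sides have dimension 4.
    have hCA : ∀ v, C (A v) = v := fun v =>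
      congrArg (fun L : EuclideanSpace ℝ (Fin 4) →L[ℝ] EuclideanSpace ℝ (Fin 4) => L v) hEq
    have hinj : Function.Injective A := Function.LeftInverse.injective hCA
    let eA := LinearEquiv.ofInjectiveOfFinrankEq
      (A : EuclideanSpace ℝ (Fin 4) →ₗ[ℝ] EuclideanSpace ℝ (Fin 3) × ℝ) hinj (by simp)
    exact ⟨eA.toContinuousLinearEquiv, ContinuousLinearMap.ext fun x => rfl⟩

end CircleBundleCoordinates

/-! ### From convexity to linear independence -/

section Convexity

/-- In odd dimension `-id` reverses orientation, so `id` or `-id` does the job. -/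
theorem exists_orientationPreserving (o : Orientation ℝ (EuclideanSpace ℝ (Fin 3)) (Fin 3)) :
    ∃ A : EuclideanSpace ℝ (Fin 3) ≃ₗ[ℝ] EuclideanSpace ℝ (Fin 3), Orientation.map (Fin 3) A o =
      (EuclideanSpace.basisFun (Fin 3) ℝ).toBasis.orientation := by
  set b := (EuclideanSpace.basisFun (Fin 3) ℝ).toBasis
  rcases b.orientation_eq_or_eq_neg o with h | h
  · exact ⟨LinearEquiv.refl ℝ _, by rw [Orientation.map_refl]; exact h⟩
  · refine ⟨LinearEquiv.neg ℝ, ?_⟩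
    rw [Orientation.map_eq_neg_iff_det_neg _ _ (by simp) |>.2, h]
    · exact neg_neg b.orientation
    change LinearMap.det (-LinearMap.id) < 0
    rw [← neg_one_smul ℝ, LinearMap.det_smul]
    simp
    norm_num

/-- Normalising multiplies `A v` by a smooth function `r`, so `γ, γ', γ''` lie in the span of `A v,
A v', A v''`. The determinant makes the former independent, hence the span has dimension 3 and the
latter are independent too. Only its nonvanishing is needed, not its sign. -/
theorem linearIndependent_of_isConvexLineCurve
    {o : Orientation ℝ (EuclideanSpace ℝ (Fin 3)) (Fin 3)} {v : ℝ → EuclideanSpace ℝ (Fin 3)}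
    (h : IsConvexLineCurve o v) (hv : ContDiff ℝ ∞ v) (hne : ∀ t, v t ≠ 0) (t : ℝ) :
    LinearIndependent ℝ ![v t, deriv v t, deriv (deriv v) t] := by
  obtain ⟨A, hA⟩ := exists_orientationPreserving o
  let A' : EuclideanSpace ℝ (Fin 3) →L[ℝ] EuclideanSpace ℝ (Fin 3) :=
    LinearMap.toContinuousLinearMap (A : EuclideanSpace ℝ (Fin 3) →ₗ[ℝ] EuclideanSpace ℝ (Fin 3))
  have hv0 : ∀ s, HasDerivAt v (deriv v s) s := fun s =>
    (hv.differentiable (by simp) s).hasDerivAt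
  have hv1 : ContDiff ℝ ∞ (deriv v) := contDiff_iff_contDiffAt.2 fun s =>
    contDiffAt_deriv hv.contDiffAt
  have hv2 : ∀ s, HasDerivAt (deriv v) (deriv (deriv v) s) s := fun s =>
    (hv1.differentiable (by simp) s).hasDerivAt
  have hw : ∀ s, HasDerivAt (fun s => A (v s)) (A (deriv v s)) s := fun s =>
    A'.hasFDerivAt.comp_hasDerivAt s (hv0 s)
  have hw' : ∀ s, HasDerivAt (fun s => A (deriv v s)) (A (deriv (deriv v) s)) s := fun s =>
    A'.hasFDerivAt.comp_hasDerivAt s (hv2 s)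
  have hAne : ∀ s, A (v s) ≠ 0 := fun s hs => hne s (A.map_eq_zero_iff.1 hs)
  let r : ℝ → ℝ := fun s => ‖A (v s)‖⁻¹
  have hr : ContDiff ℝ ∞ r := by
    refine ContDiff.inv (ContDiff.norm ℝ ?_ hAne) fun s => norm_ne_zero_iff.2 (hAne s)
    exact A'.contDiff.comp hv
  have hr0 : ∀ s, HasDerivAt r (deriv r s) s := fun s =>
    (hr.differentiable (by simp) s).hasDerivAt
  have hr1 : ContDiff ℝ ∞ (deriv r) := contDiff_iff_contDiffAt.2 fun s =>
    contDiffAt_deriv hr.contDiffAt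
  have hr2 : ∀ s, HasDerivAt (deriv r) (deriv (deriv r) s) s := fun s =>
    (hr1.differentiable (by simp) s).hasDerivAt
  have d1 : deriv (fun s => r s • A (v s)) =
      fun s => r s • A (deriv v s) + deriv r s • A (v s) := by
    ext1 s
    exact ((hr0 s).smul (hw s)).deriv
  have d2 : ∀ s, deriv (fun s => r s • A (deriv v s) + deriv r s • A (v s)) s =
      (r s • A (deriv (deriv v) s) + deriv r s • A (deriv v s)) +
        (deriv r s • A (deriv v s) + deriv (deriv r) s • A (v s)) := fun s =>
    (((hr0 s).smul (hw' s)).add ((hr2 s).smul (hw s))).deriv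
  have hdet := h A hA t
  change 0 < (EuclideanSpace.basisFun (Fin 3) ℝ).toBasis.det ![r t • A (v t),
    deriv (fun s => r s • A (v s)) t, deriv (deriv (fun s => r s • A (v s))) t] at hdet
  rw [d1, d2] at hdet
  have hli := ((EuclideanSpace.basisFun (Fin 3) ℝ).toBasis.is_basis_iff_det.2
    (isUnit_iff_ne_zero.2 hdet.ne')).1
  have hliA : LinearIndependent ℝ ![A (v t), A (deriv v t), A (deriv (deriv v) t)] := by
    rw [linearIndependent_iff_card_le_finrank_span]
    have h1 := linearIndependent_iff_card_le_finrank_span.1 hli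
    refine h1.trans (Submodule.finrank_mono (Submodule.span_le.2 ?_))
    set S := Submodule.span ℝ (range ![A (v t), A (deriv v t), A (deriv (deriv v) t)])
    have m0 : A (v t) ∈ S := Submodule.subset_span ⟨0, rfl⟩
    have m1 : A (deriv v t) ∈ S := Submodule.subset_span ⟨1, rfl⟩
    have m2 : A (deriv (deriv v) t) ∈ S := Submodule.subset_span ⟨2, rfl⟩
    rintro _ ⟨i, rfl⟩
    fin_cases i
    · exact S.smul_mem _ m0
    · exact S.add_mem (S.smul_mem _ m1) (S.smul_mem _ m0)
    · exact S.add_mem (S.add_mem (S.smul_mem _ m2) (S.smul_mem _ m1))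
        (S.add_mem (S.smul_mem _ m1) (S.smul_mem _ m0))
  refine LinearIndependent.of_comp
    (A : EuclideanSpace ℝ (Fin 3) →ₗ[ℝ] EuclideanSpace ℝ (Fin 3)) ?_
  convert hliA using 1
  ext1 i
  fin_cases i <;> rfl

end Convexity

/-! ### Coordinates on the tangent bundle -/

section TangentCoordinates

variable {E : Type*} [NormedAddCommGroup E] [NormedSpace ℝ E]
  {H : Type*} [TopologicalSpace H] {I : ModelWithCorners ℝ E H}
  {M : Type*} [TopologicalSpace M] [ChartedSpace H M] [IsManifold I ∞ M]

/-- The trivialisation is the derivative of the chart, which at the chart's own centre is the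
identity. Computations at the centre thus need no coordinate change. -/
theorem trivializationAt_self_snd (u : TangentBundle I M) :
    (trivializationAt E (TangentSpace I : M → Type _) u.proj u).2 = (u.2 : E) := by
  obtain ⟨x, v⟩ := u
  have h : x ∈ (trivializationAt E (TangentSpace I : M → Type _) x).baseSet :=
    mem_baseSet_trivializationAt E (TangentSpace I : M → Type _) x
  have h1 := TangentBundle.continuousLinearMapAt_trivializationAt (I := I) (x₀ := x) (x := x)
    (mem_chart_source H x)
  rw [mfderiv_extChartAt_self] at h1
  have h2 := (trivializationAt E (TangentSpace I : M → Type _) x).continuousLinearMapAt_apply_of_mem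
    ℝ h v
  refine Eq.trans h2.symm ?_
  exact congrArg (fun L : E →L[ℝ] E => L v) h1

theorem trivializationAt_self_snd_of_eq {u : TangentBundle I M} {x : M} (h : u.proj = x) :
    (trivializationAt E (TangentSpace I : M → Type _) x u).2 = (u.2 : E) := by
  subst h
  exact trivializationAt_self_snd u

theorem trivializationAt_self_symm (x : M) (v : E) :
    (trivializationAt E (TangentSpace I : M → Type _) x).toOpenPartialHomeomorph.symm (x, v) =
      (⟨x, v⟩ : TangentBundle I M) := by
  have hb := mem_baseSet_trivializationAt E (TangentSpace I : M → Type _) x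
  set e := trivializationAt E (TangentSpace I : M → Type _) x
  have h : e (⟨x, v⟩ : TangentBundle I M) = (x, v) := by
    refine Prod.ext (e.coe_fst (e.mem_source.2 hb)) ?_
    exact trivializationAt_self_snd (⟨x, v⟩ : TangentBundle I M)
  rw [← h]
  exact e.toOpenPartialHomeomorph.left_inv (e.mem_source.2 hb)

/-- The parametrisation of the tangent bundle by a chart at `p₀`. -/
def tangentParam (I : ModelWithCorners ℝ E H) {M : Type*} [TopologicalSpace M] [ChartedSpace H M]
    [IsManifold I ∞ M] (p₀ : M) (z : E × E) : TangentBundle I M :=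
  (trivializationAt E (TangentSpace I : M → Type _) p₀).toOpenPartialHomeomorph.symm
    ((extChartAt I p₀).symm z.1, z.2)

theorem extChartAt_symm_mem_baseSet {p₀ : M} {y : E} (hy : y ∈ (extChartAt I p₀).target) :
    (extChartAt I p₀).symm y ∈ (trivializationAt E (TangentSpace I : M → Type _) p₀).baseSet := by
  have := (extChartAt I p₀).map_target hy
  rw [extChartAt_source] at this
  exact this

theorem contMDiffOn_tangentParam (p₀ : M) :
    ContMDiffOn 𝓘(ℝ, E × E) I.tangent ∞ (tangentParam I p₀) ((extChartAt I p₀).target ×ˢ univ) := by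
  refine (Trivialization.contMDiffOn_symm (IB := I) (n := ∞)
    (trivializationAt E (TangentSpace I : M → Type _) p₀)).comp
    (ContMDiffOn.prodMk ?_ contDiff_snd.contMDiff.contMDiffOn) fun z hz => ?_
  · exact (contMDiffOn_extChartAt_symm p₀).comp contDiff_fst.contMDiff.contMDiffOn
      fun z hz => hz.1
  · exact (trivializationAt E (TangentSpace I : M → Type _) p₀).mem_target.2
      (extChartAt_symm_mem_baseSet hz.1)

theorem tangentParam_self (p₀ : M) (v : E) :
    tangentParam I p₀ (extChartAt I p₀ p₀, v) = (⟨p₀, v⟩ : TangentBundle I M) := by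
  rw [tangentParam, extChartAt_to_inv]
  exact trivializationAt_self_symm p₀ v

/-- Scalar multiplication on the tangent bundle. -/
def fibreSmul (ε : ℝ) (u : TangentBundle I M) : TangentBundle I M := ⟨u.proj, ε • u.2⟩

theorem tangentParam_fibreSmul {p₀ : M} {u : TangentBundle I M}
    (hu : u.proj ∈ (extChartAt I p₀).source) (ε : ℝ) :
    tangentParam I p₀ (extChartAt I p₀ u.proj,
      ε • (trivializationAt E (TangentSpace I : M → Type _) p₀ u).2) = fibreSmul ε u := by
  set e := trivializationAt E (TangentSpace I : M → Type _) p₀ with he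
  have hb : u.proj ∈ e.baseSet := by
    rw [extChartAt_source] at hu
    exact hu
  have h1 : e (fibreSmul ε u) = (u.proj, ε • (e u).2) := by
    refine Prod.ext (e.coe_fst (e.mem_source.2 hb)) ?_
    exact (e.linear ℝ hb).map_smul ε u.2
  rw [tangentParam, (extChartAt I p₀).left_inv hu, ← he, ← h1]
  exact e.toOpenPartialHomeomorph.left_inv (e.mem_source.2 hb)

theorem tangentParam_zero {p₀ : M} {y : E} (hy : y ∈ (extChartAt I p₀).target) :
    tangentParam I p₀ (y, 0) = (⟨(extChartAt I p₀).symm y, 0⟩ : TangentBundle I M) := by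
  have h := tangentParam_fibreSmul (I := I) (p₀ := p₀)
    (u := (⟨(extChartAt I p₀).symm y, 0⟩ : TangentBundle I M)) ((extChartAt I p₀).map_target hy) 0
  rw [zero_smul, (extChartAt I p₀).right_inv hy] at h
  rw [h, fibreSmul, zero_smul]

theorem proj_tangentParam {p₀ : M} {z : E × E} (hz : z.1 ∈ (extChartAt I p₀).target) :
    (tangentParam I p₀ z).proj = (extChartAt I p₀).symm z.1 :=
  (trivializationAt E (TangentSpace I : M → Type _) p₀).proj_symm_apply
    ((trivializationAt E (TangentSpace I : M → Type _) p₀).mem_target.2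
      (extChartAt_symm_mem_baseSet hz))

end TangentCoordinates

/-! ### The almost complex structure in a chart -/

section AlmostComplexCoordinates

variable {E : Type*} [NormedAddCommGroup E] [NormedSpace ℝ E]
  {H : Type*} [TopologicalSpace H] {I : ModelWithCorners ℝ E H}
  {X : Type*} [TopologicalSpace X] [ChartedSpace H X] [IsManifold I ∞ X]

/-- The almost complex structure in the chart at `c`. -/
def AlmostComplexStructure.inChart (J : AlmostComplexStructure I X) (c : X) (y : E) : E →ₗ[ℝ] E :=
  ((trivializationAt E (TangentSpace I : X → Type _) c).continuousLinearMapAt ℝ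
      ((extChartAt I c).symm y)).toLinearMap ∘ₗ J.J ((extChartAt I c).symm y) ∘ₗ
    ((trivializationAt E (TangentSpace I : X → Type _) c).symmL ℝ
      ((extChartAt I c).symm y)).toLinearMap

theorem AlmostComplexStructure.inChart_apply (J : AlmostComplexStructure I X) (c : X) {y : E}
    (hy : y ∈ (extChartAt I c).target) (v : E) :
    J.inChart c y v = (trivializationAt E (TangentSpace I : X → Type _) c
      ((fun v : TangentBundle I X => (⟨v.proj, J.J v.proj v.2⟩ : TangentBundle I X))
        (tangentParam I c (y, v)))).2 := by
  have hb := extChartAt_symm_mem_baseSet hy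
  set e := trivializationAt E (TangentSpace I : X → Type _) c with he
  have h1 : tangentParam I c (y, v) =
      (⟨(extChartAt I c).symm y, e.symm ((extChartAt I c).symm y) v⟩ : TangentBundle I X) :=
    (e.mk_symm hb v).symm
  rw [h1]
  refine Eq.trans (e.continuousLinearMapAt_apply_of_mem ℝ hb _) ?_
  exact congrArg (fun w => (e (⟨_, J.J _ w⟩ : TangentBundle I X)).2) (e.symmL_apply (R := ℝ) hb v)

theorem AlmostComplexStructure.contDiffOn_inChart (J : AlmostComplexStructure I X) (c : X) :
    ContDiffOn ℝ ∞ (fun p : E × E => J.inChart c p.1 p.2) ((extChartAt I c).target ×ˢ univ) := by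
  rw [← contMDiffOn_iff_contDiffOn]
  have h1 := J.smooth.comp_contMDiffOn (contMDiffOn_tangentParam (I := I) c)
  set e := trivializationAt E (TangentSpace I : X → Type _) c with he
  have h2 : ContMDiffOn I.tangent (I.prod 𝓘(ℝ, E)) ∞ e e.source :=
    Trivialization.contMDiffOn (IB := I) (n := ∞) e
  have h3 := contMDiff_snd.comp_contMDiffOn (h2.comp h1 fun p hp => by
    rw [mem_preimage, e.mem_source]
    change (tangentParam I c p).proj ∈ _
    rw [proj_tangentParam hp.1]
    exact extChartAt_symm_mem_baseSet hp.1)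
  exact h3.congr fun p hp => J.inChart_apply c hp.1 p.2

theorem AlmostComplexStructure.inChart_extChartAt (J : AlmostComplexStructure I X) {c x : X}
    (hx : x ∈ (extChartAt I c).source) (v : TangentSpace I x) :
    J.inChart c (extChartAt I c x) (mfderiv I 𝓘(ℝ, E) (extChartAt I c) x v) =
      mfderiv I 𝓘(ℝ, E) (extChartAt I c) x (J.J x v) := by
  have hxc : x ∈ (chartAt H c).source := by rwa [← extChartAt_source I]
  rw [← TangentBundle.continuousLinearMapAt_trivializationAt hxc, AlmostComplexStructure.inChart,
    (extChartAt I c).left_inv hx]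
  have hb : x ∈ (trivializationAt E (TangentSpace I : X → Type _) c).baseSet := hxc
  have := (trivializationAt E (TangentSpace I : X → Type _) c).symmL_continuousLinearMapAt
    (R := ℝ) hb v
  exact congrArg (fun w =>
    (trivializationAt E (TangentSpace I : X → Type _) c).continuousLinearMapAt
    ℝ x (J.J x w)) this

theorem AlmostComplexStructure.inChart_self (J : AlmostComplexStructure I X) (c : X) (v : E) :
    J.inChart c (extChartAt I c c) v = J.J c v := by
  have h := J.inChart_extChartAt (mem_extChartAt_source (I := I) c) v
  rw [mfderiv_extChartAt_self] at h
  exact h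

end AlmostComplexCoordinates

/-! ### Thickening a totally real immersion -/

section Tube

variable {E : Type*} [NormedAddCommGroup E] [NormedSpace ℝ E]
  {H : Type*} [TopologicalSpace H] {I : ModelWithCorners ℝ E H}
  {M : Type*} [TopologicalSpace M] [ChartedSpace H M] [IsManifold I ∞ M]
  {H' : Type*} [TopologicalSpace H']

/-- A thickening `Ψ : TM → X` of a map `ι : M → X`: it restricts to `ι` on the zero section, and its
fibre derivative there is a nonzero multiple of `J ∘ ι_*`. -/
structure IsTube {E' : Type*} [NormedAddCommGroup E'] [NormedSpace ℝ E']
    {I' : ModelWithCorners ℝ E' H'}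
    {X : Type*} [TopologicalSpace X] [ChartedSpace H' X] [IsManifold I' ∞ X]
    (J : AlmostComplexStructure I' X) (ι : M → X) (Ψ : TangentBundle I M → X)
    (c : M → ℝ) : Prop where
  contMDiff : ContMDiff I.tangent I' ∞ Ψ
  zero : ∀ p, Ψ ⟨p, 0⟩ = ι p
  ne_zero : ∀ p, c p ≠ 0
  exists_hasMFDerivAt : ∀ p, ∃ L : E →L[ℝ] E',
    HasMFDerivAt 𝓘(ℝ, E) I' (fun v : E => Ψ ⟨p, v⟩) 0 L ∧
      ∀ v : E, L v = c p • (J.J (ι p) (mfderiv I I' ι p v) : E')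

/-- Take `Ψ(u) = R (J ι_* u, ι p)` for an addition `R` nondegenerate over the compact set `ι(M)`.
The chain rule gives the fibre derivative `ρ(ι p) • J ι_*`, so `c = ρ ∘ ι`; a nonconstant factor is
harmless, as only its nonvanishing is used. -/
theorem exists_isTube [FiniteDimensional ℝ E] [CompactSpace M]
    {E' : Type*} [NormedAddCommGroup E'] [InnerProductSpace ℝ E'] [FiniteDimensional ℝ E']
    {I' : ModelWithCorners ℝ E' H'} [I'.Boundaryless]
    {X : Type*} [TopologicalSpace X] [T2Space X] [ChartedSpace H' X] [IsManifold I' ∞ X]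
    (J : AlmostComplexStructure I' X) {ι : M → X} (hι : ContMDiff I I' ∞ ι) :
    ∃ (Ψ : TangentBundle I M → X) (c : M → ℝ), IsTube J ι Ψ c := by
  obtain ⟨R, ρ, hR, hρ⟩ := exists_isAddition_of_isCompact (I := I') (isCompact_range hι.continuous)
  have hproj : ContMDiff I.tangent I ∞ (fun u : TangentBundle I M => u.proj) :=
    contMDiff_proj (TangentSpace I : M → Type _)
  refine ⟨fun u => R ((⟨ι u.proj, J.J (ι u.proj) (mfderiv I I' ι u.proj u.2)⟩ :
    TangentBundle I' X), ι u.proj), fun p => ρ (ι p), ?_, ?_, fun p => (hρ _ ⟨p, rfl⟩).ne', ?_⟩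
  · have h1 := J.smooth.comp (hι.contMDiff_tangentMap (m := ∞) (by simp))
    exact hR.contMDiff.comp (h1.prodMk (hι.comp hproj))
  · intro p
    change R (⟨ι p, J.J (ι p) (mfderiv I I' ι p 0)⟩, ι p) = ι p
    rw [map_zero, map_zero]
    exact hR.zero _ _
  · intro p
    let K : E →L[ℝ] E' := mfderiv I I' ι p
    let J' : E' →ₗ[ℝ] E' := J.J (ι p)
    let A : E →L[ℝ] E' := LinearMap.toContinuousLinearMap (J' ∘ₗ K.toLinearMap)
    refine ⟨ρ (ι p) • A, ?_, fun v => rfl⟩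
    have h1 : HasMFDerivAt 𝓘(ℝ, E') I' (fun u : E' => R ((⟨ι p, u⟩ : TangentBundle I' X), ι p))
        (A 0) (ρ (ι p) • ContinuousLinearMap.id ℝ E') := by
      rw [map_zero]
      exact hR.hasMFDerivAt (ι p)
    exact (h1.comp (0 : E) A.hasFDerivAt.hasMFDerivAt).congr_mfderiv
      (ContinuousLinearMap.ext fun v => rfl)

variable {E' : Type*} [NormedAddCommGroup E'] [NormedSpace ℝ E']
  {I' : ModelWithCorners ℝ E' H'}
  {X : Type*} [TopologicalSpace X] [ChartedSpace H' X] [IsManifold I' ∞ X]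
  {J : AlmostComplexStructure I' X} {ι : M → X} {Ψ : TangentBundle I M → X} {c : M → ℝ}

/-- The map `Ψ : TM → X` in the charts at `p₀` and `x₀`. -/
def tubeChart (I' : ModelWithCorners ℝ E' H') (Ψ : TangentBundle I M → X) (p₀ : M) (x₀ : X)
    (z : E × E) : E' :=
  extChartAt I' x₀ (Ψ (tangentParam I p₀ z))

/-- The domain of `tubeChart`. -/
def tubeChartDomain (I' : ModelWithCorners ℝ E' H') (Ψ : TangentBundle I M → X) (p₀ : M) (x₀ : X) :
    Set (E × E) :=
  ((extChartAt I p₀).target ×ˢ univ) ∩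
    (fun z => Ψ (tangentParam I p₀ z)) ⁻¹' (extChartAt I' x₀).source

theorem IsTube.contMDiffOn_comp_tangentParam (h : IsTube J ι Ψ c) (p₀ : M) :
    ContMDiffOn 𝓘(ℝ, E × E) I' ∞ (fun z => Ψ (tangentParam I p₀ z))
      ((extChartAt I p₀).target ×ˢ univ) :=
  h.contMDiff.comp_contMDiffOn (contMDiffOn_tangentParam p₀)

theorem IsTube.isOpen_tubeChartDomain [I.Boundaryless] (h : IsTube J ι Ψ c) (p₀ : M) (x₀ : X) :
    IsOpen (tubeChartDomain I' Ψ p₀ x₀) :=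
  (h.contMDiffOn_comp_tangentParam p₀).continuousOn.isOpen_inter_preimage
    ((isOpen_extChartAt_target p₀).prod isOpen_univ) (isOpen_extChartAt_source x₀)

theorem IsTube.contDiffOn_tubeChart (h : IsTube J ι Ψ c) (p₀ : M) (x₀ : X) :
    ContDiffOn ℝ ∞ (tubeChart I' Ψ p₀ x₀) (tubeChartDomain I' Ψ p₀ x₀) := by
  rw [← contMDiffOn_iff_contDiffOn]
  refine (contMDiffOn_extChartAt (I := I') (x := x₀)).comp
    ((h.contMDiffOn_comp_tangentParam p₀).mono inter_subset_left) fun z hz => ?_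
  rw [mem_preimage, ← extChartAt_source I']
  exact hz.2

theorem IsTube.mem_tubeChartDomain (h : IsTube J ι Ψ c) (p₀ : M) :
    (extChartAt I p₀ p₀, 0) ∈ tubeChartDomain I' Ψ p₀ (ι p₀) := by
  refine ⟨⟨mem_extChartAt_target p₀, mem_univ _⟩, ?_⟩
  rw [mem_preimage, tangentParam_self]
  change Ψ ⟨p₀, 0⟩ ∈ _
  rw [h.zero]
  exact mem_extChartAt_source _

theorem IsTube.tubeChart_self (h : IsTube J ι Ψ c) (p₀ : M) (x₀ : X) :
    tubeChart I' Ψ p₀ x₀ (extChartAt I p₀ p₀, 0) = extChartAt I' x₀ (ι p₀) := by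
  rw [tubeChart, tangentParam_self]
  exact congrArg _ (h.zero p₀)

theorem IsTube.hasFDerivAt_tubeChart [I.Boundaryless] (h : IsTube J ι Ψ c) (p₀ : M) :
    HasFDerivAt (tubeChart I' Ψ p₀ (ι p₀))
      (fderiv ℝ (tubeChart I' Ψ p₀ (ι p₀)) (extChartAt I p₀ p₀, 0)) (extChartAt I p₀ p₀, 0) :=
  (((h.contDiffOn_tubeChart p₀ (ι p₀)).contDiffAt
    ((h.isOpen_tubeChartDomain p₀ (ι p₀)).mem_nhds (h.mem_tubeChartDomain p₀))).differentiableAt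
      (by simp)).hasFDerivAt

theorem IsTube.fderiv_tubeChart_left [I.Boundaryless] (h : IsTube J ι Ψ c)
    (hι : ContMDiff I I' ∞ ι) (p₀ : M) (w : E) :
    fderiv ℝ (tubeChart I' Ψ p₀ (ι p₀)) (extChartAt I p₀ p₀, 0) (w, 0) =
      (mfderiv I I' ι p₀ w : E') := by
  let K : E →L[ℝ] E' := mfderiv I I' ι p₀
  have h1 : HasFDerivWithinAt (writtenInExtChartAt I I' p₀ ι) K (range I) (extChartAt I p₀ p₀) :=
    (hι.mdifferentiableAt (x := p₀) (by simp)).hasMFDerivAt.2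
  rw [I.range_eq_univ, hasFDerivWithinAt_univ] at h1
  have h2 : HasFDerivAt (fun y : E => ((y, 0) : E × E)) (ContinuousLinearMap.inl ℝ E E)
      (extChartAt I p₀ p₀) := hasFDerivAt_prodMk_left _ _
  have h3 := HasFDerivAt.comp (extChartAt I p₀ p₀) (h.hasFDerivAt_tubeChart p₀) h2
  have h4 : (tubeChart I' Ψ p₀ (ι p₀) ∘ fun y : E => ((y, 0) : E × E)) =ᶠ[𝓝 (extChartAt I p₀ p₀)]
      writtenInExtChartAt I I' p₀ ι := by
    filter_upwards [(isOpen_extChartAt_target (I := I) p₀).mem_nhds (mem_extChartAt_target p₀)]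
      with y hy
    change extChartAt I' (ι p₀) (Ψ (tangentParam I p₀ (y, 0))) = _
    rw [tangentParam_zero hy]
    exact congrArg _ (h.zero _)
  exact congrArg (fun L : E →L[ℝ] E' => L w) (h3.unique (h1.congr_of_eventuallyEq h4))

theorem IsTube.fderiv_tubeChart_right [I.Boundaryless] (h : IsTube J ι Ψ c) (p₀ : M) (v : E) :
    fderiv ℝ (tubeChart I' Ψ p₀ (ι p₀)) (extChartAt I p₀ p₀, 0) (0, v) =
      c p₀ • (J.J (ι p₀) (mfderiv I I' ι p₀ v) : E') := by
  obtain ⟨L, hL, hLv⟩ := h.exists_hasMFDerivAt p₀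
  rw [← hLv]
  have h1 : HasFDerivWithinAt (writtenInExtChartAt 𝓘(ℝ, E) I' 0 (fun v : E => Ψ ⟨p₀, v⟩)) L
      (range 𝓘(ℝ, E)) (0 : E) := hL.2
  rw [ModelWithCorners.range_eq_univ, hasFDerivWithinAt_univ] at h1
  have h2 : HasFDerivAt (fun y : E => ((extChartAt I p₀ p₀, y) : E × E))
      (ContinuousLinearMap.inr ℝ E E) 0 := hasFDerivAt_prodMk_right _ _
  have h3 := HasFDerivAt.comp (0 : E) (h.hasFDerivAt_tubeChart p₀) h2
  have h4 : (tubeChart I' Ψ p₀ (ι p₀) ∘ fun y : E => ((extChartAt I p₀ p₀, y) : E × E)) =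
      writtenInExtChartAt 𝓘(ℝ, E) I' 0 (fun v : E => Ψ ⟨p₀, v⟩) := by
    ext1 y
    change extChartAt I' (ι p₀) (Ψ (tangentParam I p₀ (_, y))) =
      extChartAt I' (Ψ ⟨p₀, 0⟩) (Ψ ⟨p₀, y⟩)
    rw [tangentParam_self, h.zero]
  rw [h4] at h3
  exact congrArg (fun L : E →L[ℝ] E' => L v) (h3.unique h1)

theorem IsTube.fderiv_tubeChart_fibre [I.Boundaryless] (h : IsTube J ι Ψ c)
    (hι : ContMDiff I I' ∞ ι) (p₀ : M) (v : E) :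
    fderiv ℝ (tubeChart I' Ψ p₀ (ι p₀)) (extChartAt I p₀ p₀, 0) (0, v) =
      c p₀ • J.inChart (ι p₀) (tubeChart I' Ψ p₀ (ι p₀) (extChartAt I p₀ p₀, 0))
        (fderiv ℝ (tubeChart I' Ψ p₀ (ι p₀)) (extChartAt I p₀ p₀, 0) (v, 0)) := by
  rw [h.tubeChart_self, h.fderiv_tubeChart_right, h.fderiv_tubeChart_left hι]
  exact congrArg (fun w : E' => c p₀ • w) (J.inChart_self (ι p₀) _).symm

/-- The relation says `ι_* w = J ι_* (-w')`, a vector of `W ∩ J W = 0` with `W = ι_* T_pM`. Both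
terms vanish, and `J` and `ι_*` are injective. -/
theorem IsTotallyRealImmersion.eq_zero_of_add_eq_zero (hι : IsTotallyRealImmersion I J ι) {p : M}
    {w w' : TangentSpace I p} (h : mfderiv I I' ι p w + J.J (ι p) (mfderiv I I' ι p w') = 0) :
    w = 0 ∧ w' = 0 := by
  have hinj := hι.isImmersion.injective_mfderiv p
  have h1 : mfderiv I I' ι p w ∈ imageTangency I J ι p := by
    refine ⟨⟨w, rfl⟩, mfderiv I I' ι p (-w'), ⟨-w', rfl⟩, ?_⟩
    rw [map_neg, map_neg, eq_neg_of_add_eq_zero_left h]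
  rw [hι.totallyReal p, Submodule.mem_bot] at h1
  rw [h1, zero_add] at h
  have h2 := J.J_J (ι p) (mfderiv I I' ι p w')
  rw [h, map_zero, eq_comm, neg_eq_zero] at h2
  exact ⟨hinj (h1.trans (map_zero _).symm), hinj (h2.trans (map_zero _).symm)⟩

theorem IsTube.eq_zero_of_fderiv_tubeChart [I.Boundaryless] (h : IsTube J ι Ψ c)
    (hι : IsTotallyRealImmersion I J ι) (p₀ : M) (w w' : E)
    (hw : fderiv ℝ (tubeChart I' Ψ p₀ (ι p₀)) (extChartAt I p₀ p₀, 0) (w, 0) +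
      J.inChart (ι p₀) (tubeChart I' Ψ p₀ (ι p₀) (extChartAt I p₀ p₀, 0))
        (fderiv ℝ (tubeChart I' Ψ p₀ (ι p₀)) (extChartAt I p₀ p₀, 0) (w', 0)) = 0) :
    w = 0 ∧ w' = 0 := by
  rw [h.tubeChart_self, h.fderiv_tubeChart_left hι.isImmersion.contMDiff,
    h.fderiv_tubeChart_left hι.isImmersion.contMDiff] at hw
  refine hι.eq_zero_of_add_eq_zero (p := p₀) (Eq.trans ?_ hw)
  let K : E →L[ℝ] E' := mfderiv I I' ι p₀
  exact congrArg (fun v : E' => K w + v) (J.inChart_self (ι p₀) _).symm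

end Tube

/-! ### Reading differentials and complex tangencies in charts -/

section ChartTransfer

variable {E : Type*} [NormedAddCommGroup E] [NormedSpace ℝ E]
  {H : Type*} [TopologicalSpace H] {I : ModelWithCorners ℝ E H}
  {N : Type*} [TopologicalSpace N] [ChartedSpace H N]
  {P : Type*} [NormedAddCommGroup P] [NormedSpace ℝ P]
  {E' : Type*} [NormedAddCommGroup E'] [NormedSpace ℝ E']
  {H' : Type*} [TopologicalSpace H'] {I' : ModelWithCorners ℝ E' H'}
  {X : Type*} [TopologicalSpace X] [ChartedSpace H' X] [IsManifold I' ∞ X]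

theorem AlmostComplexStructure.inChart_inChart (J : AlmostComplexStructure I' X) {c x : X}
    (hx : x ∈ (extChartAt I' c).source) (v : E') :
    J.inChart c (extChartAt I' c x) (J.inChart c (extChartAt I' c x) v) = -v := by
  obtain ⟨T, hT⟩ := isInvertible_mfderiv_extChartAt (I := I') hx
  obtain ⟨w, rfl⟩ := T.surjective v
  have hTw : ∀ w, T w = mfderiv I' 𝓘(ℝ, E') (extChartAt I' c) x w := fun w =>
    congrArg (fun L : TangentSpace I' x →L[ℝ] E' => L w) hT
  rw [hTw, J.inChart_extChartAt hx, J.inChart_extChartAt hx, J.J_J, map_neg]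
  rfl

variable {f : N → X} {q : N} {c : X} {ψ : N → P} {Φ : P → E'}

theorem mfderiv_extChartAt_comp_eq (hf : MDifferentiableAt I I' f q)
    (hc : f q ∈ (extChartAt I' c).source) (hψ : MDifferentiableAt I 𝓘(ℝ, P) ψ q)
    (hΦ : DifferentiableAt ℝ Φ (ψ q)) (heq : extChartAt I' c ∘ f =ᶠ[𝓝 q] Φ ∘ ψ)
    (ξ : TangentSpace I q) :
    (mfderiv I' 𝓘(ℝ, E') (extChartAt I' c) (f q) (mfderiv I I' f q ξ) : E') =
      fderiv ℝ Φ (ψ q) (mfderiv I 𝓘(ℝ, P) ψ q ξ) := by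
  have h1 := (mdifferentiableAt_extChartAt
    ((extChartAt_source I' c).subset hc)).hasMFDerivAt.comp q hf.hasMFDerivAt
  have h2 := hΦ.hasFDerivAt.hasMFDerivAt.comp q hψ.hasMFDerivAt
  have h3 := hasMFDerivAt_unique h1 (h2.congr_of_eventuallyEq heq)
  exact congrArg (fun L : TangentSpace I q →L[ℝ] E' => L ξ) h3

theorem injective_mfderiv_of_extChartAt (hf : MDifferentiableAt I I' f q)
    (hc : f q ∈ (extChartAt I' c).source) (hψ : MDifferentiableAt I 𝓘(ℝ, P) ψ q)
    (hinv : (mfderiv I 𝓘(ℝ, P) ψ q).IsInvertible)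
    (hΦ : DifferentiableAt ℝ Φ (ψ q)) (heq : extChartAt I' c ∘ f =ᶠ[𝓝 q] Φ ∘ ψ)
    (hinj : Function.Injective (fderiv ℝ Φ (ψ q))) : Function.Injective (mfderiv I I' f q) := by
  obtain ⟨θ, hθ⟩ := hinv
  intro ξ ξ' h
  have h1 := mfderiv_extChartAt_comp_eq hf hc hψ hΦ heq ξ
  have h2 := mfderiv_extChartAt_comp_eq hf hc hψ hΦ heq ξ'
  rw [h] at h1
  have h3 := hinj (h1.symm.trans h2)
  rw [← hθ] at h3
  exact θ.injective h3

/-- The chart derivative intertwines `J` with `J.inChart`, and the derivative of `ψ` is onto, so the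
image of `f_*` corresponds to the range of `fderiv ℝ Φ (ψ q)`. The problem becomes one about a
linear map between vector spaces. -/
theorem mem_complexTangencies_iff_of_extChartAt (J : AlmostComplexStructure I' X)
    (hf : MDifferentiableAt I I' f q)
    (hc : f q ∈ (extChartAt I' c).source) (hψ : MDifferentiableAt I 𝓘(ℝ, P) ψ q)
    (hinv : (mfderiv I 𝓘(ℝ, P) ψ q).IsInvertible)
    (hΦ : DifferentiableAt ℝ Φ (ψ q)) (heq : extChartAt I' c ∘ f =ᶠ[𝓝 q] Φ ∘ ψ)
    (ξ : TangentSpace I q) :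
    ξ ∈ complexTangencies I J f q ↔
      fderiv ℝ Φ (ψ q) (mfderiv I 𝓘(ℝ, P) ψ q ξ) ∈
        (LinearMap.range (fderiv ℝ Φ (ψ q) : P →ₗ[ℝ] E') ⊓
        (LinearMap.range (fderiv ℝ Φ (ψ q) : P →ₗ[ℝ] E')).map
          (J.inChart c (extChartAt I' c (f q)))) := by
  obtain ⟨θ, hθ⟩ := hinv
  obtain ⟨T, hT⟩ := isInvertible_mfderiv_extChartAt (I := I') hc
  have hTinj : Function.Injective (mfderiv I' 𝓘(ℝ, E') (extChartAt I' c) (f q)) := by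
    rw [← hT]
    exact T.injective
  have key := mfderiv_extChartAt_comp_eq hf hc hψ hΦ heq
  have hJ := fun v => J.inChart_extChartAt hc v
  constructor
  · rintro ⟨-, _, ⟨η, rfl⟩, hη⟩
    refine ⟨⟨_, rfl⟩, _, ⟨mfderiv I 𝓘(ℝ, P) ψ q η, rfl⟩, ?_⟩
    change J.inChart c (extChartAt I' c (f q)) (fderiv ℝ Φ (ψ q) (mfderiv I 𝓘(ℝ, P) ψ q η)) = _
    refine Eq.trans (congrArg _ (key η).symm) ((hJ _).trans ?_)
    exact (congrArg (mfderiv I' 𝓘(ℝ, E') (extChartAt I' c) (f q)) hη).trans (key ξ)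
  · rintro ⟨-, _, ⟨ζ, rfl⟩, hζ⟩
    obtain ⟨η, rfl⟩ := θ.surjective ζ
    have hθη : θ η = mfderiv I 𝓘(ℝ, P) ψ q η :=
      congrArg (fun L : TangentSpace I q →L[ℝ] P => L η) hθ
    rw [hθη] at hζ
    refine ⟨⟨ξ, rfl⟩, mfderiv I I' f q η, ⟨η, rfl⟩, hTinj ?_⟩
    refine (hJ _).symm.trans (Eq.trans ?_ (hζ.trans (key ξ).symm))
    exact congrArg _ (key η)

end ChartTransfer

/-! ### The scaled map is co-real and Engel for small parameters -/

section BundleMap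

variable {M : Type*} [TopologicalSpace M] [ChartedSpace (EuclideanSpace ℝ (Fin 3)) M]
  [IsManifold (𝓡 3) ∞ M]
  {N : Type*} [TopologicalSpace N] [ChartedSpace (EuclideanSpace ℝ (Fin 4)) N]
  [IsManifold (𝓡 4) ∞ N] {pr : N → M} {B : OrientedCircleBundle pr}
  {g : N → TangentBundle (𝓡 3) M}
  {X : Type*} [TopologicalSpace X] [ChartedSpace (EuclideanSpace ℝ (Fin 6)) X]
  [IsManifold (𝓡 6) ∞ X]
  {J : AlmostComplexStructure (𝓡 6) X} {ι : M → X} {Ψ : TangentBundle (𝓡 3) M → X} {c : M → ℝ}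

/-- The fibre coordinate of a bundle map `g : N → TM`. -/
def fibreCoord (g : N → TangentBundle (𝓡 3) M) (e : Trivialization Circle pr) (p₀ : M)
    (z : EuclideanSpace ℝ (Fin 3) × ℝ) : EuclideanSpace ℝ (Fin 3) :=
  (trivializationAt (EuclideanSpace ℝ (Fin 3)) (TangentSpace (𝓡 3) : M → Type _) p₀
    (g (bundleParam e p₀ z))).2

theorem IsBundleImmersion.contDiffOn_fibreCoord (hg : IsBundleImmersion B g)
    {e : Trivialization Circle pr} (he : e ∈ B.atlas) (p₀ : M) :
    ContDiffOn ℝ ∞ (fibreCoord g e p₀) (bundleParamDomain e p₀) := by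
  rw [← contMDiffOn_iff_contDiffOn]
  have h1 := hg.contMDiff.comp_contMDiffOn (B.contMDiffOn_bundleParam he p₀)
  set T := trivializationAt (EuclideanSpace ℝ (Fin 3)) (TangentSpace (𝓡 3) : M → Type _) p₀ with hT
  have h2 : ContMDiffOn (𝓡 3).tangent ((𝓡 3).prod 𝓘(ℝ, EuclideanSpace ℝ (Fin 3))) ∞ T T.source :=
    Trivialization.contMDiffOn (IB := 𝓡 3) (n := ∞) T
  refine contMDiff_snd.comp_contMDiffOn (h2.comp h1 fun z hz => ?_)
  rw [mem_preimage, T.mem_source]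
  rw [hg.proj_eq, pr_bundleParam hz]
  exact extChartAt_symm_mem_baseSet hz.1.1

/-- Over the chart centre the coordinate expression is the fibre curve itself, so the convexity
hypothesis applies to it verbatim. -/
theorem IsBundleImmersion.fibreCoord_extChartAt (hg : IsBundleImmersion B g)
    {e : Trivialization Circle pr} {p₀ : M} (hp₀ : p₀ ∈ e.baseSet) (s : ℝ) :
    fibreCoord g e p₀ (extChartAt (𝓡 3) p₀ p₀, s) = fibreCurve g e p₀ s := by
  have h : bundleParam e p₀ (extChartAt (𝓡 3) p₀ p₀, s) =
      e.toOpenPartialHomeomorph.symm (p₀, Circle.exp s) := by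
    simp only [bundleParam, extChartAt_to_inv]
  rw [fibreCoord, h]
  refine trivializationAt_self_snd_of_eq ?_
  rw [hg.proj_eq]
  exact e.proj_symm_apply (e.mem_target.2 hp₀)

theorem mem_bundleParamDomain_self {e : Trivialization Circle pr} {p₀ : M} (hp₀ : p₀ ∈ e.baseSet)
    (s : ℝ) : (extChartAt (𝓡 3) p₀ p₀, s) ∈ bundleParamDomain e p₀ := by
  refine ⟨⟨mem_extChartAt_target p₀, ?_⟩, mem_univ _⟩
  rw [mem_preimage, extChartAt_to_inv]
  exact hp₀

theorem IsConvexBundleImmersion.linearIndependent_fibreCoord {o : ManifoldOrientation (𝓡 3) M 3}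
    (hg : IsConvexBundleImmersion o B g) {e : Trivialization Circle pr} (he : e ∈ B.atlas) {p₀ : M}
    (hp₀ : p₀ ∈ e.baseSet) (t : ℝ) :
    LinearIndependent ℝ ![deriv (fun s => fibreCoord g e p₀ (extChartAt (𝓡 3) p₀ p₀, s)) t,
      deriv (deriv (fun s => fibreCoord g e p₀ (extChartAt (𝓡 3) p₀ p₀, s))) t,
      deriv (deriv (deriv (fun s => fibreCoord g e p₀ (extChartAt (𝓡 3) p₀ p₀, s)))) t] := by
  have hg' := hg.isBundleImmersion
  let u : ℝ → EuclideanSpace ℝ (Fin 3) := fibreCurve g e p₀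
  have hu : (fun s => fibreCoord g e p₀ (extChartAt (𝓡 3) p₀ p₀, s)) = u :=
    funext fun s => hg'.fibreCoord_extChartAt hp₀ s
  have hsmooth : ContDiff ℝ ∞ u := by
    rw [← hu, ← contDiffOn_univ]
    exact (hg'.contDiffOn_fibreCoord he p₀).comp (contDiff_const.prodMk contDiff_id).contDiffOn
      fun s _ => mem_bundleParamDomain_self hp₀ s
  have hsmooth' : ContDiff ℝ ∞ (deriv u) := contDiff_iff_contDiffAt.2 fun s =>
    contDiffAt_deriv hsmooth.contDiffAt
  rw [hu]
  exact linearIndependent_of_isConvexLineCurve (o := o.orientation p₀) (hg.convex e he p₀ hp₀)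
    hsmooth' (hg'.fibre_immersed e he p₀ hp₀) t

/-- The map `N → X` obtained by scaling a bundle map `g : N → TM` and composing with `Ψ`. -/
def tubeMap (Ψ : TangentBundle (𝓡 3) M → X) (g : N → TangentBundle (𝓡 3) M) (ε : ℝ) (q : N) : X :=
  Ψ (fibreSmul ε (g q))

theorem IsTube.contMDiff_tubeMap_uncurry (h : IsTube J ι Ψ c)
    (hg : ContMDiff (𝓡 4) (𝓡 3).tangent ∞ g) :
    ContMDiff (𝓘(ℝ, ℝ).prod (𝓡 4)) (𝓡 6) ∞ (fun p : ℝ × N => tubeMap Ψ g p.1 p.2) :=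
  h.contMDiff.comp ((contMDiff_smul_tangentBundle (I := 𝓡 3) (X := M)).comp
    (contMDiff_fst.prodMk (hg.comp contMDiff_snd)))

theorem IsTube.contMDiff_tubeMap (h : IsTube J ι Ψ c)
    (hg : ContMDiff (𝓡 4) (𝓡 3).tangent ∞ g) (ε : ℝ) :
    ContMDiff (𝓡 4) (𝓡 6) ∞ (tubeMap Ψ g ε) :=
  (h.contMDiff_tubeMap_uncurry hg).comp (contMDiff_const.prodMk contMDiff_id)

theorem IsTube.tubeMap_zero (h : IsTube J ι Ψ c) (hg : IsBundleImmersion B g) (q : N) :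
    tubeMap Ψ g 0 q = ι (pr q) := by
  rw [tubeMap, fibreSmul, zero_smul, h.zero, hg.proj_eq]

theorem IsBundleImmersion.tangentParam_fibreCoord (hg : IsBundleImmersion B g)
    {e : Trivialization Circle pr} {p₀ : M} {z : EuclideanSpace ℝ (Fin 3) × ℝ}
    (hz : z ∈ bundleParamDomain e p₀) (ε : ℝ) :
    tangentParam (𝓡 3) p₀ (z.1, ε • fibreCoord g e p₀ z) =
      fibreSmul ε (g (bundleParam e p₀ z)) := by
  have hp : (g (bundleParam e p₀ z)).proj = (extChartAt (𝓡 3) p₀).symm z.1 := by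
    rw [hg.proj_eq, pr_bundleParam hz]
  rw [← tangentParam_fibreSmul (p₀ := p₀) (u := g (bundleParam e p₀ z))
    (by rw [hp]; exact (extChartAt (𝓡 3) p₀).map_target hz.1.1), hp,
    (extChartAt (𝓡 3) p₀).right_inv hz.1.1]
  rfl

/-- The neighbourhood is taken in `ℝ × N`, so that the size of `ε` is uniform near `q₀` and
compactness can be applied. The value `ε = 0` is excluded because there the map collapses each fibre
to a point. -/
theorem IsTube.eventually_isEngelFrameAt {o : ManifoldOrientation (𝓡 3) M 3}
    (h : IsTube J ι Ψ c) (hι : IsTotallyRealImmersion (𝓡 3) J ι)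
    (hg : IsConvexBundleImmersion o B g) (q₀ : N) :
    ∀ᶠ p : ℝ × N in 𝓝 (0, q₀), p.1 ≠ 0 →
      Function.Injective (mfderiv (𝓡 4) (𝓡 6) (tubeMap Ψ g p.1) p.2) ∧
      Module.finrank ℝ (complexTangencies (𝓡 4) J (tubeMap Ψ g p.1) p.2) = 2 ∧
      ∃ u₁ u₂, IsEngelFrameAt (I := 𝓡 4) (complexTangencies (𝓡 4) J (tubeMap Ψ g p.1)) u₁ u₂
        p.2 := by
  have hg' := hg.isBundleImmersion
  obtain ⟨e, he, t₀, hb, U, hU, hq₀, ψ, hψ, hψq₀, hψm, hψl, hψi⟩ := B.exists_coordinates q₀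
  set p₀ := pr q₀ with hp₀
  obtain ⟨Ω, hΩ, h0Ω, a, b, ha, hb', hΩp⟩ := exists_isCoRealDatum (by simp)
    (J.inChart (ι p₀)) (J.contDiffOn_inChart (ι p₀)) (h.isOpen_tubeChartDomain p₀ (ι p₀))
    (h.contDiffOn_tubeChart p₀ (ι p₀)) (fun z hz => (extChartAt (𝓡 6) (ι p₀)).map_source hz.2)
    (isOpen_bundleParamDomain e p₀) (hg'.contDiffOn_fibreCoord he p₀) (h.mem_tubeChartDomain p₀)
    (mem_bundleParamDomain_self hb t₀) (h.ne_zero p₀)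
    (h.fderiv_tubeChart_fibre hι.isImmersion.contMDiff p₀) (h.eq_zero_of_fderiv_tubeChart hι p₀)
    (hg.linearIndependent_fibreCoord he hb t₀)
  have hev : ∀ᶠ p : ℝ × N in 𝓝 (0, q₀), p.2 ∈ U ∧ (p.1, ψ p.2) ∈ Ω := by
    have h1 : ∀ᶠ p : ℝ × N in 𝓝 (0, q₀), p.2 ∈ U :=
      continuousAt_snd.eventually (hU.mem_nhds hq₀)
    have h2 : ContinuousAt (fun p : ℝ × N => (p.1, ψ p.2)) (0, q₀) :=
      continuousAt_fst.prodMk (ContinuousAt.comp (f := Prod.snd) (x := ((0 : ℝ), q₀))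
        (hψ.continuousOn.continuousAt (hU.mem_nhds hq₀)) continuousAt_snd)
    refine h1.and (h2.eventually (hΩ.mem_nhds ?_))
    change ((0 : ℝ), ψ q₀) ∈ Ω
    rw [hψq₀]
    exact h0Ω
  filter_upwards [hev] with p hp hε
  obtain ⟨ε, q⟩ := p
  simp only at hp hε ⊢
  let Uε : Set N := U ∩ ψ ⁻¹' {z | (ε, z) ∈ Ω}
  have hYε : IsOpen {z | (ε, z) ∈ Ω} := hΩ.preimage (Continuous.prodMk_right ε)
  have hUε : IsOpen Uε := hψ.continuousOn.isOpen_inter_preimage hU hYε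
  -- `Φ` is the coordinate expression of `tubeMap Ψ g ε`: through `ψ` on `N` and the chart at `ι p₀`
  -- on `X`.
  let Φ : EuclideanSpace ℝ (Fin 3) × ℝ → EuclideanSpace ℝ (Fin 6) := fun z =>
    tubeChart (𝓡 6) Ψ p₀ (ι p₀) (z.1, ε • fibreCoord g e p₀ z)
  have hrep : ∀ x ∈ Uε, tangentParam (𝓡 3) p₀ ((ψ x).1, ε • fibreCoord g e p₀ (ψ x)) =
      fibreSmul ε (g x) := by
    intro x hx
    rw [hg'.tangentParam_fibreCoord (hψm hx.1), hψl x hx.1]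
  have hF : ∀ x, MDifferentiableAt (𝓡 4) (𝓡 6) (tubeMap Ψ g ε) x := fun x =>
    (h.contMDiff_tubeMap hg'.contMDiff ε).mdifferentiableAt (by simp)
  have hsrc : ∀ x ∈ Uε, tubeMap Ψ g ε x ∈ (extChartAt (𝓡 6) (ι p₀)).source := by
    intro x hx
    have := (hΩp _ hx.2).2.1.2
    rw [mem_preimage, hrep x hx] at this
    exact this
  have hψd : ∀ x ∈ Uε, MDifferentiableAt (𝓡 4) 𝓘(ℝ, EuclideanSpace ℝ (Fin 3) × ℝ) ψ x :=
    fun x hx => (hψ.contMDiffAt (hU.mem_nhds hx.1)).mdifferentiableAt (by simp)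
  have hloc : ∀ x ∈ Uε, extChartAt (𝓡 6) (ι p₀) (tubeMap Ψ g ε x) = Φ (ψ x) := fun x hx =>
    congrArg (fun u => extChartAt (𝓡 6) (ι p₀) (Ψ u)) (hrep x hx).symm
  have heq : ∀ x ∈ Uε, extChartAt (𝓡 6) (ι p₀) ∘ tubeMap Ψ g ε =ᶠ[𝓝 x] Φ ∘ ψ := fun x hx => by
    filter_upwards [hUε.mem_nhds hx] with x' hx' using hloc x' hx'
  have hΦd : ∀ x ∈ Uε, DifferentiableAt ℝ Φ (ψ x) := by
    intro x hx
    obtain ⟨hz, hS, -⟩ := hΩp _ hx.2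
    have h1 : DifferentiableAt ℝ (fibreCoord g e p₀) (ψ x) :=
      ((hg'.contDiffOn_fibreCoord he p₀).contDiffAt
        ((isOpen_bundleParamDomain e p₀).mem_nhds hz)).differentiableAt (by simp)
    have h2 : DifferentiableAt ℝ (tubeChart (𝓡 6) Ψ p₀ (ι p₀))
        ((ψ x).1, ε • fibreCoord g e p₀ (ψ x)) :=
      ((h.contDiffOn_tubeChart p₀ (ι p₀)).contDiffAt
        ((h.isOpen_tubeChartDomain p₀ (ι p₀)).mem_nhds hS)).differentiableAt (by simp)
    exact DifferentiableAt.comp (g := tubeChart (𝓡 6) Ψ p₀ (ι p₀))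
      (f := fun z => (z.1, ε • fibreCoord g e p₀ z)) (ψ x) h2
        (differentiableAt_fst.prodMk (h1.const_smul ε))
  -- The tangencies are identified on an open set, not only at `q`, because the Engel frame has to
  -- be tangent to them on a neighbourhood.
  have hmem : ∀ x ∈ Uε, ∀ ξ : TangentSpace (𝓡 4) x,
      ξ ∈ complexTangencies (𝓡 4) J (tubeMap Ψ g ε) x ↔
        (mfderiv (𝓡 4) 𝓘(ℝ, EuclideanSpace ℝ (Fin 3) × ℝ) ψ x ξ : EuclideanSpace ℝ (Fin 3) × ℝ) ∈
          Submodule.span ℝ {vField a (ε, ψ x), hField b (ε, ψ x)} := by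
    intro x hx ξ
    rw [mem_complexTangencies_iff_of_extChartAt J (hF x) (hsrc x hx) (hψd x hx) (hψi x hx.1)
      (hΦd x hx) (heq x hx), hloc x hx]
    refine (hΩp _ hx.2).2.2.1.mem_iff hε (fun v => ?_) _
    have := J.inChart_inChart (hsrc x hx) v
    rw [hloc x hx] at this
    exact this
  refine ⟨?_, ?_, ?_⟩
  · exact injective_mfderiv_of_extChartAt (hF q) (hsrc q hp) (hψd q hp) (hψi q hp.1)
      (hΦd q hp) (heq q hp) ((hΩp _ hp.2).2.2.1.injective hε)
  · obtain ⟨θ, hθ⟩ := hψi q hp.1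
    let θ' : EuclideanSpace ℝ (Fin 4) ≃ₗ[ℝ] EuclideanSpace ℝ (Fin 3) × ℝ := θ.toLinearEquiv
    let S : Submodule ℝ (EuclideanSpace ℝ (Fin 3) × ℝ) :=
      Submodule.span ℝ {vField a (ε, ψ q), hField b (ε, ψ q)}
    have hS : complexTangencies (𝓡 4) J (tubeMap Ψ g ε) q =
        S.comap (θ' : EuclideanSpace ℝ (Fin 4) →ₗ[ℝ] EuclideanSpace ℝ (Fin 3) × ℝ) := by
      ext ξ
      rw [hmem q hp, ← hθ]
      rfl
    have hli : LinearIndependent ℝ ![vField a (ε, ψ q), hField b (ε, ψ q)] := by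
      have := (hΩp _ hp.2).2.2.2.comp ![0, 1] (by decide)
      convert this using 1
      ext1 i
      fin_cases i <;> rfl
    rw [hS]
    refine (congrArg (fun S' : Submodule ℝ (EuclideanSpace ℝ (Fin 4)) => Module.finrank ℝ S')
      (Submodule.map_equiv_eq_comap_symm θ'.symm S).symm).trans ?_
    rw [LinearEquiv.finrank_map_eq]
    have := finrank_span_eq_card hli
    rw [range_cons_two] at this
    simpa using this
  · have hv : ContDiffOn ℝ ∞ (vField a) Ω := ((contDiffOn_fst.smul ha).neg).prodMk contDiffOn_const
    have hh : ContDiffOn ℝ ∞ (hField b) Ω := hb'.prodMk contDiffOn_const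
    have hslice : ∀ {W : ℝ × (EuclideanSpace ℝ (Fin 3) × ℝ) → EuclideanSpace ℝ (Fin 3) × ℝ},
        ContDiffOn ℝ ∞ W Ω → ContDiffOn ℝ ∞ (fun z => W (ε, z)) {z | (ε, z) ∈ Ω} := fun hW =>
      hW.comp (contDiff_const.prodMk contDiff_id).contDiffOn fun z hz => hz
    refine ⟨_, _, isEngelFrameAt_mpullback hUε (hψ.mono inter_subset_left)
      (fun x hx => hψi x hx.1) hYε (hslice hv) (hslice hh) (fun x hx => hx.2) (fun x hx => ?_) hp
      (hΩp _ hp.2).2.2.2⟩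
    -- Pushing the pulled-back field forward by `ψ` recovers `W`, so `hmem` shows that the pullbacks
    -- of `vField a` and `hField b` are tangent to the distribution.
    have hθ : ∀ W : EuclideanSpace ℝ (Fin 3) × ℝ → EuclideanSpace ℝ (Fin 3) × ℝ,
        mfderiv (𝓡 4) 𝓘(ℝ, EuclideanSpace ℝ (Fin 3) × ℝ) ψ x
          (VectorField.mpullback (𝓡 4) 𝓘(ℝ, EuclideanSpace ℝ (Fin 3) × ℝ) ψ W x) = W (ψ x) := by
      intro W
      obtain ⟨θ, hθ⟩ := hψi x hx.1
      change mfderiv (𝓡 4) 𝓘(ℝ, EuclideanSpace ℝ (Fin 3) × ℝ) ψ x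
        ((mfderiv (𝓡 4) 𝓘(ℝ, EuclideanSpace ℝ (Fin 3) × ℝ) ψ x).inverse (W (ψ x))) = _
      rw [← hθ, ContinuousLinearMap.inverse_equiv]
      exact θ.apply_symm_apply _
    exact ⟨(hmem x hx _).2 (mem_of_eq_of_mem (hθ fun z => vField a (ε, z))
        (Submodule.subset_span (mem_insert _ _))),
      (hmem x hx _).2 (mem_of_eq_of_mem (hθ fun z => hField b (ε, z))
        (Submodule.subset_span (mem_insert_of_mem _ rfl)))⟩

end BundleMap

/-! ### Injectivity for small parameters -/

section Embedding

variable {M : Type*} [TopologicalSpace M] [ChartedSpace (EuclideanSpace ℝ (Fin 3)) M]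
  [IsManifold (𝓡 3) ∞ M]
  {N : Type*} [TopologicalSpace N] [ChartedSpace (EuclideanSpace ℝ (Fin 4)) N]
  [IsManifold (𝓡 4) ∞ N] {pr : N → M} {B : OrientedCircleBundle pr}
  {g : N → TangentBundle (𝓡 3) M}
  {X : Type*} [TopologicalSpace X] [ChartedSpace (EuclideanSpace ℝ (Fin 6)) X]
  [IsManifold (𝓡 6) ∞ X]
  {J : AlmostComplexStructure (𝓡 6) X} {ι : M → X} {Ψ : TangentBundle (𝓡 3) M → X} {c : M → ℝ}

/-- The derivative at the zero section is `(w, v) ↦ ι_* w + J ι_* (c v)`, injective by total reality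
and `c ≠ 0`. Dimensions agree, so the inverse function theorem makes `Ψ` locally injective near each
zero vector. -/
theorem IsTube.injective_fderiv_tubeChart (h : IsTube J ι Ψ c)
    (hι : IsTotallyRealImmersion (𝓡 3) J ι) (p₀ : M) :
    Function.Injective (fderiv ℝ (tubeChart (𝓡 6) Ψ p₀ (ι p₀)) (extChartAt (𝓡 3) p₀ p₀, 0)) := by
  rw [injective_iff_map_eq_zero]
  rintro ⟨w, v⟩ hwv
  have h1 : ((w, v) : EuclideanSpace ℝ (Fin 3) × EuclideanSpace ℝ (Fin 3)) = (w, 0) + (0, v) := by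
    simp
  have h2 : ((c p₀ • v, 0) : EuclideanSpace ℝ (Fin 3) × EuclideanSpace ℝ (Fin 3)) =
      c p₀ • (v, 0) := by simp
  rw [h1, map_add, h.fderiv_tubeChart_fibre hι.isImmersion.contMDiff, ← map_smul, ← map_smul,
    ← h2] at hwv
  obtain ⟨h3, h4⟩ := h.eq_zero_of_fderiv_tubeChart hι p₀ _ _ hwv
  rw [h3, (smul_eq_zero.1 h4).resolve_left (h.ne_zero p₀)]
  rfl

theorem IsTube.exists_injOn_tubeChart (h : IsTube J ι Ψ c)
    (hι : IsTotallyRealImmersion (𝓡 3) J ι) (p₀ : M) :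
    ∃ V ∈ 𝓝 (extChartAt (𝓡 3) p₀ p₀, (0 : EuclideanSpace ℝ (Fin 3))),
      InjOn (tubeChart (𝓡 6) Ψ p₀ (ι p₀)) V := by
  let A := (LinearEquiv.ofInjectiveOfFinrankEq
    (fderiv ℝ (tubeChart (𝓡 6) Ψ p₀ (ι p₀)) (extChartAt (𝓡 3) p₀ p₀, 0)).toLinearMap
    (h.injective_fderiv_tubeChart hι p₀) (by simp)).toContinuousLinearEquiv
  have hA : HasStrictFDerivAt (tubeChart (𝓡 6) Ψ p₀ (ι p₀))
      (A : EuclideanSpace ℝ (Fin 3) × EuclideanSpace ℝ (Fin 3) →L[ℝ] EuclideanSpace ℝ (Fin 6))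
      (extChartAt (𝓡 3) p₀ p₀, 0) := by
    have := ((h.contDiffOn_tubeChart p₀ (ι p₀)).contDiffAt ((h.isOpen_tubeChartDomain p₀
      (ι p₀)).mem_nhds (h.mem_tubeChartDomain p₀))).hasStrictFDerivAt (by simp)
    exact this.congr_fderiv (ContinuousLinearMap.ext fun _ => rfl)
  exact ⟨_, (hA.toOpenPartialHomeomorph _).open_source.mem_nhds
    hA.mem_toOpenPartialHomeomorph_source, (hA.toOpenPartialHomeomorph _).injOn⟩

theorem fibreSmul_inv_fibreSmul {ε : ℝ} (hε : ε ≠ 0) (u : TangentBundle (𝓡 3) M) :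
    fibreSmul ε⁻¹ (fibreSmul ε u) = u := by
  rw [fibreSmul, fibreSmul]
  exact congrArg (fun v => (⟨u.proj, v⟩ : TangentBundle (𝓡 3) M)) (inv_smul_smul₀ hε u.2)

/-- If `q` and `q'` lie over the same `p₀`, both scaled vectors are near the zero vector at `p₀`,
where `Ψ` is injective; dividing by `ε` leaves `g r = g r'`. Otherwise the images are near the
distinct points `ι (pr q)` and `ι (pr q')`. The diagonal `q = q'` falls under the first case. -/
theorem IsTube.eventually_eq_of_tubeMap_eq [T2Space X] (h : IsTube J ι Ψ c)
    (hι : IsTotallyRealImmersion (𝓡 3) J ι) (hg : IsBundleImmersion B g)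
    (hιi : Function.Injective ι) (hgi : Function.Injective g) (q q' : N) :
    ∀ᶠ p : ℝ × (N × N) in 𝓝 (0, (q, q')), p.1 ≠ 0 →
      tubeMap Ψ g p.1 p.2.1 = tubeMap Ψ g p.1 p.2.2 → p.2.1 = p.2.2 := by
  have hc1 : Tendsto (fun p : ℝ × (N × N) => (p.1, p.2.1)) (𝓝 (0, (q, q'))) (𝓝 (0, q)) :=
    (continuous_fst.prodMk (continuous_fst.comp continuous_snd)).tendsto _
  have hc2 : Tendsto (fun p : ℝ × (N × N) => (p.1, p.2.2)) (𝓝 (0, (q, q'))) (𝓝 (0, q')) :=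
    (continuous_fst.prodMk (continuous_snd.comp continuous_snd)).tendsto _
  by_cases hpq : pr q = pr q'
  · set p₀ := pr q with hp₀
    obtain ⟨V, hV, hVi⟩ := h.exists_injOn_tubeChart hι p₀
    let T := trivializationAt (EuclideanSpace ℝ (Fin 3)) (TangentSpace (𝓡 3) : M → Type _) p₀
    let C : ℝ × N → EuclideanSpace ℝ (Fin 3) × EuclideanSpace ℝ (Fin 3) := fun p =>
      (extChartAt (𝓡 3) p₀ (pr p.2), p.1 • (T (g p.2)).2)
    have hC : ∀ r, pr r = p₀ → ∀ᶠ p : ℝ × N in 𝓝 (0, r),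
        C p ∈ V ∧ pr p.2 ∈ (extChartAt (𝓡 3) p₀).source := by
      intro r hr
      have hpr : ContinuousAt (fun p : ℝ × N => pr p.2) (0, r) :=
        (B.continuous.comp continuous_snd).continuousAt
      have hT : ContinuousAt (fun p : ℝ × N => (T (g p.2)).2) (0, r) := by
        have hs : g r ∈ T.source := T.mem_source.2 (by
          rw [hg.proj_eq, hr]
          exact mem_baseSet_trivializationAt _ _ _)
        have h1 : ContinuousAt T (g r) :=
          T.toOpenPartialHomeomorph.continuousOn.continuousAt (T.open_source.mem_nhds hs)
        exact continuousAt_snd.comp (ContinuousAt.comp (f := fun p : ℝ × N => g p.2)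
          (x := ((0 : ℝ), r)) h1 (hg.contMDiff.continuous.comp continuous_snd).continuousAt)
      have hκ : ContinuousAt (fun p : ℝ × N => extChartAt (𝓡 3) p₀ (pr p.2)) (0, r) := by
        refine ContinuousAt.comp (f := fun p : ℝ × N => pr p.2) (x := ((0 : ℝ), r)) ?_ hpr
        change ContinuousAt (extChartAt (𝓡 3) p₀) (pr r)
        rw [hr]
        exact continuousAt_extChartAt p₀
      have hCc : ContinuousAt C (0, r) := hκ.prodMk (continuousAt_fst.smul hT)
      refine (hCc.eventually ?_).and (hpr.eventually ?_)
      · change V ∈ 𝓝 (extChartAt (𝓡 3) p₀ (pr r), (0 : ℝ) • (T (g r)).2)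
        rw [zero_smul, hr]
        exact hV
      · change (extChartAt (𝓡 3) p₀).source ∈ 𝓝 (pr r)
        rw [hr]
        exact extChartAt_source_mem_nhds p₀
    have hrep : ∀ p : ℝ × N, pr p.2 ∈ (extChartAt (𝓡 3) p₀).source →
        tangentParam (𝓡 3) p₀ (C p) = fibreSmul p.1 (g p.2) := by
      intro p hp
      rw [← tangentParam_fibreSmul (p₀ := p₀) (u := g p.2) (by rwa [hg.proj_eq]), hg.proj_eq]
    filter_upwards [hc1.eventually (hC q rfl), hc2.eventually (hC q' hpq.symm)]
      with p hp hp' hε hpp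
    obtain ⟨ε, r, r'⟩ := p
    simp only at hp hp' hε hpp ⊢
    have h1 := hrep (ε, r) hp.2
    have h2 := hrep (ε, r') hp'.2
    have h3 : C (ε, r) = C (ε, r') := by
      refine hVi hp.1 hp'.1 ?_
      rw [tubeChart, tubeChart, h1, h2]
      exact congrArg _ hpp
    rw [h3, h2] at h1
    have h4 := congrArg (fibreSmul ε⁻¹) h1
    simp only [fibreSmul_inv_fibreSmul hε] at h4
    exact (hgi h4).symm
  · have hcont : ∀ r : N, Tendsto (fun p : ℝ × N => tubeMap Ψ g p.1 p.2) (𝓝 (0, r))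
        (𝓝 (ι (pr r))) := by
      intro r
      have h1 := (h.contMDiff_tubeMap_uncurry hg.contMDiff).continuous.tendsto ((0 : ℝ), r)
      rwa [h.tubeMap_zero hg] at h1
    have h1 := ((hcont q).comp hc1).prodMk_nhds ((hcont q').comp hc2)
    have h2 : {x : X × X | x.1 ≠ x.2} ∈ 𝓝 (ι (pr q), ι (pr q')) :=
      (isOpen_ne_fun continuous_fst continuous_snd).mem_nhds fun h => hpq (hιi h)
    filter_upwards [h1.eventually h2] with p hp _ hpp
    exact absurd hpp hp

end Embedding

end CREngel

end

theorem theorem1p2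
    -- a closed oriented 3-manifold
    {M : Type*} [TopologicalSpace M] [T2Space M] [CompactSpace M]
    [ChartedSpace (EuclideanSpace ℝ (Fin 3)) M] [IsManifold (𝓡 3) ∞ M]
    (o : CREngel.ManifoldOrientation (𝓡 3) M 3)
    -- an oriented circle bundle over it
    {N : Type*} [TopologicalSpace N] [ChartedSpace (EuclideanSpace ℝ (Fin 4)) N]
    [IsManifold (𝓡 4) ∞ N]
    (pr : N → M) (B : CREngel.OrientedCircleBundle pr)
    -- a convex bundle immersion
    (g : N → TangentBundle (𝓡 3) M) (hg : CREngel.IsConvexBundleImmersion o B g)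
    -- a totally real immersion into an almost complex manifold of real dimension 6
    {X : Type*} [TopologicalSpace X] [T2Space X] [SecondCountableTopology X]
    [ChartedSpace (EuclideanSpace ℝ (Fin 6)) X] [IsManifold (𝓡 6) ∞ X]
    (J : CREngel.AlmostComplexStructure (𝓡 6) X)
    (ι : M → X) (hι : CREngel.IsTotallyRealImmersion (𝓡 3) J ι) :
    ∃ g' : N → X,
      CREngel.IsCoRealImmersion (𝓡 4) J g' ∧
      CREngel.IsEngel (𝓡 4) (CREngel.complexTangencies (𝓡 4) J g') ∧
      (CREngel.IsEmbedding (𝓡 4) (𝓡 3).tangent g → CREngel.IsEmbedding (𝓡 3) (𝓡 6) ι →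
        CREngel.IsEmbedding (𝓡 4) (𝓡 6) g') := by
  obtain ⟨Ψ, c, hΨ⟩ := CREngel.exists_isTube J hι.isImmersion.contMDiff
  have hg' := hg.isBundleImmersion
  have : T2Space N := B.t2Space
  have : CompactSpace N := B.compactSpace
  -- Compactness of `N` turns the local statements near `(0, q)` into one valid for all `q` at once
  -- when `ε` is small.
  have h1 := isCompact_univ.eventually_forall_of_forall_eventually (x₀ := (0 : ℝ))
    (P := fun (ε : ℝ) (q : N) => ε ≠ 0 →
      Function.Injective (mfderiv (𝓡 4) (𝓡 6) (CREngel.tubeMap Ψ g ε) q) ∧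
      Module.finrank ℝ (CREngel.complexTangencies (𝓡 4) J (CREngel.tubeMap Ψ g ε) q) = 2 ∧
      ∃ u₁ u₂, CREngel.IsEngelFrameAt (I := 𝓡 4)
        (CREngel.complexTangencies (𝓡 4) J (CREngel.tubeMap Ψ g ε)) u₁ u₂ q)
    fun (q : N) _ => hΨ.eventually_isEngelFrameAt hι hg q
  have h2 : ∀ᶠ ε in 𝓝 (0 : ℝ), CREngel.IsEmbedding (𝓡 4) (𝓡 3).tangent g →
      CREngel.IsEmbedding (𝓡 3) (𝓡 6) ι → ε ≠ 0 →
        Function.Injective (CREngel.tubeMap Ψ g ε) := by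
    -- The embedding hypotheses do not involve `ε`, so they can be assumed before it is chosen; the
    -- same `ε` then serves both conclusions.
    rw [eventually_imp_distrib_left]
    intro hge
    rw [eventually_imp_distrib_left]
    intro hιe
    filter_upwards [isCompact_univ.eventually_forall_of_forall_eventually (x₀ := (0 : ℝ))
      (P := fun (ε : ℝ) (q : N × N) => ε ≠ 0 →
        CREngel.tubeMap Ψ g ε q.1 = CREngel.tubeMap Ψ g ε q.2 → q.1 = q.2)
      fun (q : N × N) _ => hΨ.eventually_eq_of_tubeMap_eq hι hg' hιe.isEmbedding.injective
        hge.isEmbedding.injective q.1 q.2] with ε hε hne q q' hqq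
    exact hε (q, q') (mem_univ _) hne hqq
  -- Zero is not isolated in `ℝ`, so some nonzero `ε` satisfies both conditions.
  obtain ⟨ε, ⟨hε, hε'⟩, hne⟩ := (((h1.and h2).filter_mono nhdsWithin_le_nhds).and
    (self_mem_nhdsWithin (s := {(0 : ℝ)}ᶜ))).exists
  have hgood := fun q => hε q (mem_univ q) hne
  have himm : CREngel.IsImmersion (𝓡 4) (𝓡 6) (CREngel.tubeMap Ψ g ε) :=
    ⟨hΨ.contMDiff_tubeMap hg'.contMDiff ε, fun q => (hgood q).1⟩
  refine ⟨CREngel.tubeMap Ψ g ε, ⟨himm, fun q => (hgood q).2.1⟩, ?_, fun hge hιe => ⟨himm, ?_⟩⟩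
  · exact CREngel.isEngel_of_isEngelFrameAt (by simp) (fun q => (hgood q).2.1)
      fun q => (hgood q).2.2
  -- An injective continuous map from a compact space to a Hausdorff space is a closed embedding.
  · exact (himm.contMDiff.continuous.isClosedEmbedding (hε' hge hιe hne)).isEmbedding
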